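/- Work in geometrized units. A dust cloud of initial radius $R_1>0$ is given by an initial density profile $\rho(R)$ and an initial radial velocity profile $v(R)$, $R\ge 0$. Put $$m(R)=4\pi\int_0^R\rho(x)x^2\,dx,\quad E(R)=\tfrac12 v(R)^2-\frac{m(R)}{R},\quad c(R)=\frac{2m(R)}{R^3},\quad q(R)=\sqrt{-\frac{R\,E(R)}{m(R)}} .$$ Values at $R=0$ of $E/R^2$, $c'/R$, $q'/R$ are understood as limits $R\to0^+$. Assume that (i) on $[0,R_1)$, $\rho(R)$ and $v(R)/R$ are restrictions of even $C^\infty$ functions on $(-R_1,R_1)$; (ii) $\rho>0$ on $[0,R_1)$ and $\rho=0$ on $[R_1,\infty)$; (iii) $\rho'\le 0$ on $(0,R_1)$; (iv) $2m(R)/R<1$ on $(0,R_1)$ (no trapped surfaces initially); (v) $v\le 0$ on $(0,R_1)$; (vi) $E(R)/R^2<0$ for $0\le R<R_1$ (bounded collapse); (vii) $q'\ge 0$ on $(0,R_1)$ (no shell crossing); (viii) $c'(R)/R<0$ or $q'(R)/R>0$ at $R=0$ (nondegeneracy). Let $r(\tau,R)$ be the areal radius of the collapsing shell $R$: $r(0,R)=R$,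 $\tfrac12\dot r^2-m(R)/r=E(R)$ with $\dot r<0$ for $0<\tau<\tau_s(R)$, where $\tau_s(R)$ is the proper time at which $r$ reaches $0$. The spacetime inside the cloud is $0<R<R_1$, $0<\tau<\tau_s(R)$ with the metric $$-d\tau^2+\frac{r'^2}{1+2E}\,dR^2+r^2(d\vartheta^2+\sin^2\vartheta\,d\varphi^2),$$ and its central singularity is the event $R=0$, $\tau=\lim_{R\to0^+}\tau_s(R)$. Along an affinely parametrized equatorial ($\vartheta=\pi/2$) null geodesic put $$\chi=\sqrt{\frac{2m(R)}{r}},\qquad \Pi=\frac{r'}{\sqrt{1+2E}}\,\frac{dR/d\lambda}{d\tau/d\lambda},\qquad \ell=r^2\frac{d\varphi}{d\lambda};$$ the geodesic is radial if $\ell=0$. In terms of $s=1/R$, the null geodesic equations for $(\chi,\Pi)$ read $$\frac{d}{ds}(\chi,\Pi)=X(R,\chi,\Pi)\big|_{R=1/s}, \tag{1}$$ where $X=(X_1,X_2)$ is defined for $0<R<R_1$, $\chi>R\sqrt{c(R)}$, $\Pi\ne0$ by $$X_1=\frac{\chi}{2}\Big\{\Big[R+\frac{\chi^3}{c^{3/2}}\sqrt{1+2E\chi^{-2}}\,\Lambda(y,R)\Big]\Big[1-\sqrt{\frac{1+2E\chi^{-2}}{1+2E}}\,\frac{\chi}{\Pi}\Big]-3R-R^2\frac{c'}{c}\Big\},$$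 $$X_2=(1-\Pi^2)\Big\{\frac{\chi^3}{c^{3/2}}\Lambda(y,R)\Big[\frac{3+4E\chi^{-2}}{2\sqrt{1+2E}}\chi-\frac{\sqrt{1+2E\chi^{-2}}}{\Pi}\Big]-R\,K(y,R)\,\chi-\frac{R}{\Pi}\Big\},$$ with $c,q,E$ evaluated at $R$, $y=R\sqrt{c(R)}/\chi$ and $$K(y,R)=\frac{1}{\sqrt{1+2E}}\Big[\sqrt{1-q^2y^2}\,\frac{Rc'}{2c}-\frac{q^2y^2}{\sqrt{1-q^2y^2}}\frac{Rq'}{q}\Big],\quad \Lambda(y,R)=\frac{2q'}{Rq}h(q,y)-\frac{c'}{2Rc}g(q,y),$$ $$h(q,y)=\frac1{\sqrt{1-q^2}}-\frac{y^3}{\sqrt{1-q^2y^2}}-\frac32 g(q,y),\quad g(q,y)=\frac{f(qy)-f(q)}{q^3},\quad f(x)=x\sqrt{1-x^2}+\arccos x$$ (at shells with $q(R)=1$, where $q'(R)=0$, the term of $\Lambda$ containing $q'$ is $0$). Then there are an open neighbourhood $V\subset\mathbb R^2$ of $(\chi,\Pi)=(1,1)$ and an $R_0\in(0,R_1)$ such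 that for every $\hat R\in(0,R_0]$: 1. Through every point of $V$ at $s=1/\hat R$ there passes a maximally extended (to the right) solution of (1), and every such solution that lies in $V$ at $s=1/\hat R$ exists for all $s\ge 1/\hat R$ and converges to $(1,1)$ as $s\to\infty$, i.e. as $R\to0$. 2. For every $(\chi_0,\Pi_0)\in V$ with $\Pi_0\le1$ there is a future-directed equatorial null geodesic emanating from the central singularity (that is, $(\tau,R)\to(\lim_{R\to0^+}\tau_s(R),0)$ as its affine parameter decreases to a finite value) which passes through the shell $R=\hat R$ with $(\chi,\Pi)=(\chi_0,\Pi_0)$ and along which $(\chi,\Pi)\to(1,1)$ at the singularity; it is radial if and only if $\Pi_0=1$. 3. In particular infinitely many radial and infinitely many nonradial future-directed null geodesics emanate from the central singularity; they reach the shell $R=\hat R$ at infinitely many different times $\tau$, both for the radial and for the nonradial ones. -/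

import Mathlib

open Set Filter Topology
open scoped ContDiff

noncomputable section

/-- Initial data of a spherical dust cloud (geometrized units): the initial density profile
`ρ(R)`, the initial radial velocity profile `v(R)`, and the initial areal radius `R₁` of the cloud.
The label `R` of a dust shell is its areal radius on the initial slice `τ = 0`.
Only the values at `R ≥ 0` are meaningful. -/
structure DustData where
  ρ : ℝ → ℝ
  v : ℝ → ℝ
  R₁ : ℝ

namespace DustData

variable (D : DustData)

/-- The mass function `m(R) = 4π ∫₀ᴿ ρ(x) x² dx`. -/
def mass (R : ℝ) : ℝ := 4 * Real.pi * ∫ x in (0 : ℝ)..R, D.ρ x * x ^ 2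

/-- The energy `E(R) = v(R)²/2 - m(R)/R` of the dust shell `R`. -/
def energy (R : ℝ) : ℝ := D.v R ^ 2 / 2 - D.mass R / R

/-- `c(R) = 2 m(R) / R³`. -/
def c (R : ℝ) : ℝ := 2 * D.mass R / R ^ 3

/-- `q(R) = √(-R E(R) / m(R))`. -/
def q (R : ℝ) : ℝ := √(-(R * D.energy R / D.mass R))

/-- The standing assumptions on a bounded Tolman-Bondi collapse. Values at the centre `R = 0` of
functions such as `E(R)/R²` or `c'(R)/R` are understood as limits `R → 0⁺`. -/
structure IsAdmissible : Prop where
  radius_pos : 0 < D.R₁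
  /-- the density has a smooth even extension through the centre -/
  smooth_density : ∃ w : ℝ → ℝ, (∀ x, w (-x) = w x) ∧ ContDiffOn ℝ ∞ w (Ioo (-D.R₁) D.R₁) ∧
    ∀ R ∈ Ico 0 D.R₁, D.ρ R = w R
  /-- `v(R)/R` has a smooth even extension through the centre -/
  smooth_velocity : ∃ u : ℝ → ℝ, (∀ x, u (-x) = u x) ∧ ContDiffOn ℝ ∞ u (Ioo (-D.R₁) D.R₁) ∧
    ∀ R ∈ Ico 0 D.R₁, D.v R = R * u R
  /-- finite cloud of positive density -/
  density_pos : ∀ R ∈ Ico 0 D.R₁, 0 < D.ρ R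
  density_eq_zero : ∀ R, D.R₁ ≤ R → D.ρ R = 0
  /-- monotonically decreasing density -/
  density_deriv_nonpos : ∀ R ∈ Ioo 0 D.R₁, deriv D.ρ R ≤ 0
  /-- absence of trapped surfaces on the initial slice -/
  not_trapped : ∀ R ∈ Ioo 0 D.R₁, 2 * D.mass R / R < 1
  /-- the cloud is not expanding initially -/
  collapsing : ∀ R ∈ Ioo 0 D.R₁, D.v R ≤ 0
  /-- bounded collapse: `E(R)/R² < 0` for `0 < R < R₁` and at the centre -/
  bounded : ∀ R ∈ Ioo 0 D.R₁, D.energy R < 0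
  bounded_center : ∃ κ < 0, Tendsto (fun R => D.energy R / R ^ 2) (𝓝[>] 0) (𝓝 κ)
  /-- exclusion of shell-crossing singularities -/
  no_shell_crossing : ∀ R ∈ Ioo 0 D.R₁, 0 ≤ deriv D.q R
  /-- nondegeneracy at the centre: `c'(R)/R < 0` or `q'(R)/R > 0` at `R = 0` -/
  nondegenerate :
    (∃ κ < 0, Tendsto (fun R => deriv D.c R / R) (𝓝[>] 0) (𝓝 κ)) ∨
    (∃ κ > 0, Tendsto (fun R => deriv D.q R / R) (𝓝[>] 0) (𝓝 κ))

/-! ### The dynamical system for `(χ, Π)` -/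

/-- `f(x) = x √(1 - x²) + arccos x`. -/
def f (x : ℝ) : ℝ := x * √(1 - x ^ 2) + Real.arccos x

/-- `g(q, y) = (f(q y) - f(q)) / q³`. -/
def g (q y : ℝ) : ℝ := (f (q * y) - f q) / q ^ 3

/-- `h(q, y) = 1/√(1 - q²) - y³/√(1 - q² y²) - (3/2) g(q, y)`. For `q = 1` the first summand is
`0` by convention; under the standing assumptions `q(R) = 1` forces `q'(R) = 0`, and `h` enters
below only through the product `q'(R) h(q(R), y)`, whose correct value is then `0`. -/
def h (q y : ℝ) : ℝ :=
  1 / √(1 - q ^ 2) - y ^ 3 / √(1 - q ^ 2 * y ^ 2) - 3 / 2 * g q y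

def Lam (y R : ℝ) : ℝ :=
  2 * (deriv D.q R / (R * D.q R)) * h (D.q R) y
    - deriv D.c R / (2 * R * D.c R) * g (D.q R) y

def K (y R : ℝ) : ℝ :=
  1 / √(1 + 2 * D.energy R) *
    (√(1 - D.q R ^ 2 * y ^ 2) * (R * deriv D.c R / (2 * D.c R))
      - D.q R ^ 2 * y ^ 2 / √(1 - D.q R ^ 2 * y ^ 2) * (R * deriv D.q R / D.q R))

/-- First component of the vector field (`p` stands for `Π`). -/
def X₁ (R χ p : ℝ) : ℝ :=
  χ / 2 *
    ((R + χ ^ 3 / D.c R ^ (3 / 2 : ℝ) * √(1 + 2 * D.energy R / χ ^ 2)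
          * D.Lam (R * √(D.c R) / χ) R)
        * (1 - √((1 + 2 * D.energy R / χ ^ 2) / (1 + 2 * D.energy R)) * (χ / p))
      - 3 * R - R ^ 2 * (deriv D.c R / D.c R))

/-- Second component of the vector field (`p` stands for `Π`). -/
def X₂ (R χ p : ℝ) : ℝ :=
  (1 - p ^ 2) *
    (χ ^ 3 / D.c R ^ (3 / 2 : ℝ) * D.Lam (R * √(D.c R) / χ) R
        * ((3 + 4 * D.energy R / χ ^ 2) / (2 * √(1 + 2 * D.energy R)) * χ
            - √(1 + 2 * D.energy R / χ ^ 2) * (1 / p))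
      - R * D.K (R * √(D.c R) / χ) R * χ - R / p)

/-- The vector field `X(R, χ, Π)`. -/
def X (R : ℝ) (x : ℝ × ℝ) : ℝ × ℝ := (D.X₁ R x.1 x.2, D.X₂ R x.1 x.2)

/-- The set of `(χ, Π)` where `X(R, χ, Π)` is defined: `0 < R < R₁`, `χ > 0`, `Π ≠ 0` and
`y = √(r/R) = R √(c(R)) / χ` lies below `1`, that is, to the future of the initial slice. -/
def phaseDomain (R : ℝ) : Set (ℝ × ℝ) :=
  {x | R ∈ Ioo 0 D.R₁ ∧ 0 < x.1 ∧ x.2 ≠ 0 ∧ R * √(D.c R) / x.1 < 1}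

/-- `x = (χ, Π)` solves `dx/ds = X(1/s, x)` on `[s₀, T)`, where `s₀ < T ≤ ∞`. -/
def IsSolutionOn (s₀ : ℝ) (T : EReal) (x : ℝ → ℝ × ℝ) : Prop :=
  (s₀ : EReal) < T ∧ ∀ s : ℝ, s₀ ≤ s → (s : EReal) < T →
    x s ∈ D.phaseDomain (1 / s) ∧
    HasDerivWithinAt x (D.X (1 / s) (x s)) {t : ℝ | s₀ ≤ t ∧ (t : EReal) < T} s

/-- A solution on `[s₀, T)` that is not the restriction of a solution on a longer interval
`[s₀, T')`. -/
def IsMaximalSolutionOn (s₀ : ℝ) (T : EReal) (x : ℝ → ℝ × ℝ) : Prop :=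
  D.IsSolutionOn s₀ T x ∧
    ∀ (T' : EReal) (x' : ℝ → ℝ × ℝ), T < T' → D.IsSolutionOn s₀ T' x' →
      ¬ ∀ s : ℝ, s₀ ≤ s → (s : EReal) < T → x' s = x s

/-! ### The collapsing spacetime -/

/-- The proper time that the shell `R`, starting at areal radius `R` and falling inwards with
`ṙ = -√(2 E(R) + 2 m(R)/r)`, needs to reach the areal radius `x`. -/
def infallTime (R x : ℝ) : ℝ := ∫ z in x..R, 1 / √(2 * D.energy R + 2 * D.mass R / z)

/-- The proper time at which the shell `R` collapses to zero areal radius. -/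
def collapseTime (R : ℝ) : ℝ := D.infallTime R 0

/-- The areal radius `r(τ, R)`, for `0 ≤ τ ≤ collapseTime R`: the radius `x ∈ [0, R]` at which the
infall time of the shell equals `τ` (the infall time decreases strictly in `x`, so that `x` is
the largest radius with infall time at least `τ`). It solves the free-fall equation, see
`hasDerivAt_arealRadius` and `freeFall`. -/
def arealRadius (τ R : ℝ) : ℝ := sSup {x : ℝ | x ∈ Icc 0 R ∧ τ ≤ D.infallTime R x}

/-- `r'(τ, R)`. -/
def arealRadiusPrime (τ R : ℝ) : ℝ := deriv (fun R' => D.arealRadius τ R') R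

/-- The components of the Tolman-Bondi metric
`-dτ² + r'(τ,R)²/(1 + 2E(R)) dR² + r(τ,R)² (dϑ² + sin²ϑ dφ²)` in the coordinates
`x 0 = τ`, `x 1 = R`, `x 2 = ϑ`, `x 3 = φ`. -/
def metric (x : Fin 4 → ℝ) : Matrix (Fin 4) (Fin 4) ℝ :=
  Matrix.diagonal ![-1, D.arealRadiusPrime (x 0) (x 1) ^ 2 / (1 + 2 * D.energy (x 1)),
    D.arealRadius (x 0) (x 1) ^ 2, D.arealRadius (x 0) (x 1) ^ 2 * Real.sin (x 2) ^ 2]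

/-- The part of the spacetime inside the cloud, after the initial slice and before the
shell-focusing singularity. -/
def spacetime : Set (Fin 4 → ℝ) :=
  {x | x 1 ∈ Ioo 0 D.R₁ ∧ x 0 ∈ Ioo 0 (D.collapseTime (x 1)) ∧ x 2 ∈ Ioo 0 Real.pi}

/-- `γ`, restricted to the parameter interval `(0, b)`, is an affinely parametrized, future-directed
null geodesic: the geodesic equation is written as
`d/dλ (g_{ij} dγ^j/dλ) = (1/2) ∂_i g_{jk} (dγ^j/dλ) (dγ^k/dλ)`. -/
structure IsFutureNullGeodesic (γ : ℝ → Fin 4 → ℝ) (b : ℝ) : Prop where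
  pos : 0 < b
  mem : ∀ l ∈ Ioo 0 b, γ l ∈ D.spacetime
  differentiable : ∀ l ∈ Ioo 0 b, DifferentiableAt ℝ γ l
  geodesic : ∀ l ∈ Ioo 0 b, ∀ i : Fin 4,
    HasDerivAt (fun l' => ∑ j, D.metric (γ l') i j * deriv γ l' j)
      (1 / 2 * ∑ j, ∑ k, lineDeriv ℝ (fun x => D.metric x j k) (γ l) (Pi.single i 1)
        * deriv γ l j * deriv γ l k) l
  null : ∀ l ∈ Ioo 0 b, ∑ i, ∑ j, D.metric (γ l) i j * deriv γ l i * deriv γ l j = 0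
  future : ∀ l ∈ Ioo 0 b, 0 < deriv γ l 0

/-- A future-directed null geodesic on the parameter interval `(0, b)` that starts, in the limit
`λ → 0⁺`, at the central singularity: the event `R = 0`, `τ = lim_{R → 0} collapseTime R`. -/
structure EmanatesFromCentralSingularity (γ : ℝ → Fin 4 → ℝ) (b : ℝ) : Prop where
  geodesic : D.IsFutureNullGeodesic γ b
  radius : Tendsto (fun l => γ l 1) (𝓝[>] 0) (𝓝 0)
  time : ∃ τ₀ : ℝ, Tendsto D.collapseTime (𝓝[>] 0) (𝓝 τ₀) ∧
    Tendsto (fun l => γ l 0) (𝓝[>] 0) (𝓝 τ₀)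

/-- The curve lies in the equatorial plane `ϑ = π/2`. -/
def IsEquatorial (γ : ℝ → Fin 4 → ℝ) (b : ℝ) : Prop :=
  ∀ l ∈ Ioo 0 b, γ l 2 = Real.pi / 2

/-- The angular momentum `ℓ = r² dφ/dλ` of an equatorial curve. -/
def angularMomentum (γ : ℝ → Fin 4 → ℝ) (l : ℝ) : ℝ :=
  D.arealRadius (γ l 0) (γ l 1) ^ 2 * deriv γ l 3

/-- `χ = √(2m/r)` along a curve. -/
def chiAlong (γ : ℝ → Fin 4 → ℝ) (l : ℝ) : ℝ :=
  √(2 * D.mass (γ l 1) / D.arealRadius (γ l 0) (γ l 1))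

/-- `Π = (r'/√(1 + 2E)) (dR/dλ) / (dτ/dλ)` along a curve. -/
def PiAlong (γ : ℝ → Fin 4 → ℝ) (l : ℝ) : ℝ :=
  D.arealRadiusPrime (γ l 0) (γ l 1) / √(1 + 2 * D.energy (γ l 1))
    * (deriv γ l 1 / deriv γ l 0)

/-! ### The areal radius solves the free-fall equation -/

section FreeFall

variable {D}

lemma infall_speed_lower {R z : ℝ} (hR : 0 < R) (hm : 0 < D.mass R) (hz : z ∈ Ioo 0 R) :
    2 * D.mass R / R ^ 2 * (R - z) ≤ 2 * D.energy R + 2 * D.mass R / z := by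
  obtain ⟨hz0, hzR⟩ := hz
  have h1 : 2 * D.mass R / R ^ 2 * (R - z) ≤ 2 * D.mass R / z - 2 * D.mass R / R := by
    have : 2 * D.mass R / z - 2 * D.mass R / R - 2 * D.mass R / R ^ 2 * (R - z)
        = 2 * D.mass R * (R - z) ^ 2 / (R ^ 2 * z) := by
      field_simp
    have h2 : 0 ≤ 2 * D.mass R * (R - z) ^ 2 / (R ^ 2 * z) := by positivity
    linarith
  have h3 : 2 * D.energy R = D.v R ^ 2 - 2 * D.mass R / R := by
    unfold energy; ring
  nlinarith [sq_nonneg (D.v R)]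

lemma infall_speed_pos {R z : ℝ} (hR : 0 < R) (hm : 0 < D.mass R) (hz : z ∈ Ioo 0 R) :
    0 < 2 * D.energy R + 2 * D.mass R / z := by
  refine lt_of_lt_of_le ?_ (infall_speed_lower hR hm hz)
  have : 0 < R - z := by linarith [hz.2]
  positivity

lemma infall_continuousAt {R z : ℝ} (hR : 0 < R) (hm : 0 < D.mass R) (hz : z ∈ Ioo 0 R) :
    ContinuousAt (fun z => 1 / √(2 * D.energy R + 2 * D.mass R / z)) z := by
  have h0 := infall_speed_pos hR hm hz
  have hz0 : z ≠ 0 := hz.1.ne'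
  have h1 : √(2 * D.energy R + 2 * D.mass R / z) ≠ 0 := (Real.sqrt_pos.2 h0).ne'
  fun_prop (disch := assumption)

lemma infall_integrable {R : ℝ} (hR : 0 < R) (hm : 0 < D.mass R) :
    IntervalIntegrable (fun z => 1 / √(2 * D.energy R + 2 * D.mass R / z))
      MeasureTheory.volume 0 R := by
  have hb : IntervalIntegrable (fun z => 1 / √(2 * D.mass R / R ^ 2) * (R - z) ^ (-(1/2) : ℝ))
      MeasureTheory.volume 0 R := by
    have h1 : IntervalIntegrable (fun x : ℝ => x ^ (-(1/2) : ℝ)) MeasureTheory.volume 0 R :=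
      intervalIntegral.intervalIntegrable_rpow' (by norm_num)
    have h2 := (h1.comp_sub_left R).symm
    simp only [sub_zero, sub_self] at h2
    exact h2.const_mul _
  refine hb.mono_fun ?_ ?_
  · refine Measurable.aestronglyMeasurable ?_
    fun_prop
  · rw [uIoc_of_le hR.le]
    have hne : ∀ᵐ z : ℝ ∂(MeasureTheory.volume.restrict (Ioc 0 R)), z ≠ R := by
      refine MeasureTheory.ae_restrict_of_ae ?_
      simp [MeasureTheory.ae_iff]
    filter_upwards [hne, MeasureTheory.ae_restrict_mem measurableSet_Ioc] with z hz hzm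
    have hzI : z ∈ Ioo 0 R := ⟨hzm.1, lt_of_le_of_ne hzm.2 hz⟩
    have hd : 0 < R - z := by linarith [hzI.2]
    have hlow := infall_speed_lower hR hm hzI
    rw [Real.norm_of_nonneg (by positivity), Real.norm_of_nonneg (by positivity),
      Real.rpow_neg hd.le, ← Real.sqrt_eq_rpow, ← one_div, one_div_mul_one_div,
      ← Real.sqrt_mul (by positivity)]
    exact one_div_le_one_div_of_le (Real.sqrt_pos.2 (by positivity)) (Real.sqrt_le_sqrt hlow)

lemma infallTime_sub {R x y : ℝ} (hR : 0 < R) (hm : 0 < D.mass R) (hx : x ∈ Icc 0 R)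
    (hy : y ∈ Icc 0 R) : D.infallTime R x - D.infallTime R y =
      ∫ z in x..y, 1 / √(2 * D.energy R + 2 * D.mass R / z) := by
  have hI := infall_integrable hR hm
  have h1 : ∀ x ∈ Icc 0 R, IntervalIntegrable
      (fun z => 1 / √(2 * D.energy R + 2 * D.mass R / z)) MeasureTheory.volume x R := by
    intro x hx
    refine hI.mono_set ?_
    rw [uIcc_of_le hx.2, uIcc_of_le hR.le]
    exact Icc_subset_Icc_left hx.1
  have := intervalIntegral.integral_add_adjacent_intervals ((h1 x hx).trans (h1 y hy).symm) (h1 y hy)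
  unfold infallTime
  linarith

lemma infallTime_strictAntiOn {R : ℝ} (hR : 0 < R) (hm : 0 < D.mass R) :
    StrictAntiOn (D.infallTime R) (Icc 0 R) := by
  intro x hx y hy hxy
  have h1 := infallTime_sub hR hm hx hy
  have hI : IntervalIntegrable (fun z => 1 / √(2 * D.energy R + 2 * D.mass R / z))
      MeasureTheory.volume x y := by
    refine (infall_integrable hR hm).mono_set ?_
    rw [uIcc_of_le hxy.le, uIcc_of_le hR.le]
    exact Icc_subset_Icc hx.1 hy.2
  have h2 : 0 < ∫ z in x..y, 1 / √(2 * D.energy R + 2 * D.mass R / z) := by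
    refine intervalIntegral.intervalIntegral_pos_of_pos_on hI ?_ hxy
    intro z hz
    have := infall_speed_pos hR hm (z := z) ⟨by linarith [hx.1, hz.1], by linarith [hy.2, hz.2]⟩
    have := Real.sqrt_pos.2 this
    positivity
  linarith

lemma infallTime_continuousOn {R : ℝ} (hR : 0 < R) (hm : 0 < D.mass R) :
    ContinuousOn (D.infallTime R) (Icc 0 R) := by
  have h := intervalIntegral.continuousOn_primitive_interval_left
    ((intervalIntegrable_iff' (by simp)).1 (infall_integrable hR hm))
  rw [uIcc_of_le hR.le] at h
  exact h

lemma infallTime_hasDerivAt {R x : ℝ} (hR : 0 < R) (hm : 0 < D.mass R) (hx : x ∈ Ioo 0 R) :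
    HasDerivAt (D.infallTime R) (-(1 / √(2 * D.energy R + 2 * D.mass R / x))) x := by
  have hI : IntervalIntegrable (fun z => 1 / √(2 * D.energy R + 2 * D.mass R / z))
      MeasureTheory.volume x R := by
    refine (infall_integrable hR hm).mono_set ?_
    rw [uIcc_of_le hx.2.le, uIcc_of_le hR.le]
    exact Icc_subset_Icc_left hx.1.le
  refine intervalIntegral.integral_hasDerivAt_left hI ?_ (infall_continuousAt hR hm hx)
  refine Measurable.stronglyMeasurable (by fun_prop) |>.stronglyMeasurableAtFilter

/-- `r(τ, R)` is the unique radius in `(0, R)` with infall time `τ`. -/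
theorem arealRadius_spec {R τ : ℝ} (hR : 0 < R) (hm : 0 < D.mass R)
    (hτ : τ ∈ Ioo 0 (D.collapseTime R)) :
    D.arealRadius τ R ∈ Ioo 0 R ∧ D.infallTime R (D.arealRadius τ R) = τ := by
  have hG := infallTime_continuousOn hR hm
  have hA := infallTime_strictAntiOn hR hm
  have hGR : D.infallTime R R = 0 := by simp [infallTime]
  have hivt := intermediate_value_Ioo' hR.le hG
  rw [hGR] at hivt
  obtain ⟨x, hx, hxτ⟩ := hivt hτ
  have hgr : IsGreatest {x : ℝ | x ∈ Icc 0 R ∧ τ ≤ D.infallTime R x} x := by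
    refine ⟨⟨Ioo_subset_Icc_self hx, hxτ.ge⟩, ?_⟩
    rintro y ⟨hy, hyτ⟩
    rw [← hxτ] at hyτ
    exact (hA.le_iff_ge (Ioo_subset_Icc_self hx) hy).1 hyτ
  have : D.arealRadius τ R = x := hgr.csSup_eq
  rw [this]
  exact ⟨hx, hxτ⟩

theorem hasDerivAt_arealRadius {R τ : ℝ} (hR : 0 < R) (hm : 0 < D.mass R)
    (hτ : τ ∈ Ioo 0 (D.collapseTime R)) :
    HasDerivAt (fun t => D.arealRadius t R)
      (-√(2 * D.energy R + 2 * D.mass R / D.arealRadius τ R)) τ := by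
  obtain ⟨hr, hrτ⟩ := arealRadius_spec hR hm hτ
  have hA := infallTime_strictAntiOn hR hm
  have hpos := Real.sqrt_pos.2 (infall_speed_pos hR hm hr)
  have hd := infallTime_hasDerivAt hR hm hr
  have hnhds : ∀ᶠ t in 𝓝 τ, t ∈ Ioo 0 (D.collapseTime R) := isOpen_Ioo.mem_nhds hτ
  have hinv : ∀ᶠ t in 𝓝 τ, D.infallTime R (D.arealRadius t R) = t := by
    filter_upwards [hnhds] with t ht using (arealRadius_spec hR hm ht).2
  have hcont : ContinuousAt (fun t => D.arealRadius t R) τ := by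
    set x := D.arealRadius τ R with hx
    refine tendsto_order.2 ⟨fun a ha => ?_, fun a ha => ?_⟩
    · have ha' : max a 0 < x := max_lt ha hr.1
      have hI : max a 0 ∈ Icc 0 R := ⟨le_max_right _ _, (ha'.trans hr.2).le⟩
      have hlt : τ < D.infallTime R (max a 0) := hrτ ▸ hA hI (Ioo_subset_Icc_self hr) ha'
      filter_upwards [hnhds, eventually_lt_nhds hlt] with t ht htl
      obtain ⟨h1, h2⟩ := arealRadius_spec hR hm ht
      rw [← h2] at htl
      exact (le_max_left a 0).trans_lt ((hA.lt_iff_gt (Ioo_subset_Icc_self h1) hI).1 htl)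
    · have ha' : x < min a R := lt_min ha hr.2
      have hI : min a R ∈ Icc 0 R := ⟨(hr.1.trans ha').le, min_le_right _ _⟩
      have hlt : D.infallTime R (min a R) < τ := hrτ ▸ hA (Ioo_subset_Icc_self hr) hI ha'
      filter_upwards [hnhds, eventually_gt_nhds hlt] with t ht htl
      obtain ⟨h1, h2⟩ := arealRadius_spec hR hm ht
      rw [← h2] at htl
      exact ((hA.lt_iff_gt hI (Ioo_subset_Icc_self h1)).1 htl).trans_le (min_le_left _ _)
  have := hd.of_local_left_inverse hcont (by simpa using hpos.ne') hinv
  rwa [one_div, inv_neg, inv_inv] at this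

/-- The free-fall equation `ṙ²/2 - m(R)/r = E(R)`. -/
theorem freeFall {R τ : ℝ} (hR : 0 < R) (hm : 0 < D.mass R)
    (hτ : τ ∈ Ioo 0 (D.collapseTime R)) :
    deriv (fun t => D.arealRadius t R) τ ^ 2 / 2 - D.mass R / D.arealRadius τ R
      = D.energy R := by
  rw [(hasDerivAt_arealRadius hR hm hτ).deriv, neg_sq,
    Real.sq_sqrt (infall_speed_pos hR hm (arealRadius_spec hR hm hτ).1).le]
  ring

end FreeFall

end DustData

end

open Set Filter Topology
open scoped ContDiff

noncomputable section


/-! ### Ordinary differential equations -/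

/-! In the variable s = 1/R the centre lies at s = ∞, and X has an autonomous limit there. To see
this, write c' = R·α and q' = R·β. The field becomes a function `XPar` of (χ, Π) and of eight radial
quantities, collected in `params`, and it is smooth near the central values. These quantities
converge as R → 0, because the evenness of ρ and v/R makes c'/R and q'/R converge. In the limit R, E
and y = √(r/R) vanish. The limit field has a zero at (1, 1), and with (u, w) = (χ - 1, Π - 1) its
linearization there is (a(w - u)/2, -a w), where a is the limit of Λ(0, R)/c^{3/2}.

Everything depends on a > 0. The limit of Λ is a sum of two terms, one proportional to -c'/R with
positive coefficient and one proportional to q'/R with coefficient a positive multiple of h(q, 0).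
Decreasing density and absence of shell crossing make both nonnegative, and nondegeneracy makes one
of them positive (`h_zero_pos`, `exists_isRegularCentre`). Hence (1, 1) is attracting: the squared
distance l to it satisfies l' ≤ -(a/4) l + η(s) with η → 0 (`exists_isAttracting`). Every solution
that starts in a small disc stays there, is global, and converges to (1, 1). This covers the
dynamical part.

For the geometry, infall times have the closed form (f(q√(x/R)) - f(q))/(q³√c). The implicit
function theorem then shows that r(τ, R) is smooth, and differentiating the closed form gives r'.
With these formulas X is recognised as the null geodesic system (`prime_eq`, `X₁Par_eq`,
`X₂Par_eq`), so an orbit determines τ(R) and Π(R). The frequency ω = dτ/dλ solves a linear equation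
whose logarithmic s-derivative is `ZPar`, and the angular momentum is recovered from L² = r²ω²(1 -
Π²), which is where Π ≤ 1 is needed. The metric is diagonal, so the geodesic equations can be
verified component by component (`isFutureNullGeodesic`).

It remains to reach the centre at a finite affine parameter and at the right time. Near (1, 1)
`ZPar` is positive, so ω grows towards the centre. Hence dλ/dR = √g_RR/(Πω) stays below √g_RR/Π,
which tends to 0. Since y → 0, the infall time along the orbit has the same limit as the collapse
time. Finally, all χ near 1 are admissible at a fixed shell, and r, hence χ, is determined there by
τ, so infinitely many χ require infinitely many arrival times. -/

/-- A globally Lipschitz, bounded, time-dependent vector field has global integral curves. -/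
theorem exists_global_solution {E : Type*} [NormedAddCommGroup E] [NormedSpace ℝ E]
    [CompleteSpace E] {F : ℝ → E → E} {K M : NNReal} (hlip : ∀ t, LipschitzWith K (F t))
    (hcont : ∀ x, Continuous fun t => F t x) (hb : ∀ t x, ‖F t x‖ ≤ M) (t₀ : ℝ) (x₀ : E) :
    ∃ x : ℝ → E, x t₀ = x₀ ∧ ∀ t, HasDerivAt x (F t (x t)) t := by
  have key : ∀ n : ℕ, ∃ α : ℝ → E, α t₀ = x₀ ∧ ∀ t ∈ Ioo (t₀ - (n + 1)) (t₀ + (n + 1)),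
      HasDerivAt α (F t (α t)) t := by
    intro n
    have hn : (0 : ℝ) < n + 1 := by positivity
    have hmem : t₀ ∈ Icc (t₀ - (n + 1)) (t₀ + (n + 1)) := ⟨by linarith, by linarith⟩
    -- A solution of speed at most M travels no further than M(n+1) in time n+1, so with a ball of
    -- that radius Picard–Lindelöf covers the whole interval.
    have hPL : IsPicardLindelof F (⟨t₀, hmem⟩ : Icc (t₀ - (n + 1)) (t₀ + (n + 1))) x₀
        (M * (n + 1)) 0 M K := by
      refine ⟨fun t _ => (hlip t).lipschitzOnWith, fun x _ => (hcont x).continuousOn,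
        fun t _ x _ => hb t x, ?_⟩
      simp
    obtain ⟨α, h0, h1⟩ := hPL.exists_eq_forall_mem_Icc_hasDerivWithinAt₀
    exact ⟨α, h0, fun t ht => (h1 t (Ioo_subset_Icc_self ht)).hasDerivAt (Icc_mem_nhds ht.1 ht.2)⟩
  choose α h0 h1 using key
  have hagree : ∀ n m : ℕ, n ≤ m → EqOn (α n) (α m) (Ioo (t₀ - (n + 1)) (t₀ + (n + 1))) := by
    intro n m hnm
    have hn : (0 : ℝ) < n + 1 := by positivity
    have hnm' : (n : ℝ) ≤ m := by exact_mod_cast hnm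
    refine ODE_solution_unique_of_mem_Ioo (v := F) (s := fun _ => univ) (K := K)
      (fun t _ => (hlip t).lipschitzOnWith) (t₀ := t₀) ⟨by linarith, by linarith⟩
      (fun t ht => ⟨h1 n t ht, mem_univ _⟩)
      (fun t ht => ⟨h1 m t ⟨by linarith [ht.1], by linarith [ht.2]⟩, mem_univ _⟩) ?_
    rw [h0, h0]
  have hloc : ∀ t, ∀ N : ℕ, |t - t₀| < N → α ⌈|t - t₀|⌉₊ t = α N t := by
    intro t N hN
    refine hagree _ _ (Nat.ceil_le.2 hN.le) ?_
    have h2 := Nat.le_ceil |t - t₀|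
    have h3 := abs_le.1 (le_refl |t - t₀|)
    constructor <;> linarith
  -- The n-th local solution lives on an open interval of radius n+1 rather than n, so the index ⌈|t
  -- - t₀|⌉ always has t in its interior. Uniqueness makes the choice of index irrelevant.
  refine ⟨fun t => α ⌈|t - t₀|⌉₊ t, by simp [h0], fun t => ?_⟩
  obtain ⟨N, hN⟩ := exists_nat_gt |t - t₀|
  have hev : (fun t => α ⌈|t - t₀|⌉₊ t) =ᶠ[𝓝 t] α N := by
    have : ∀ᶠ t' in 𝓝 t, |t' - t₀| < N :=
      (by fun_prop : Continuous fun t' : ℝ => |t' - t₀|).continuousAt.eventually_lt_const hN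
    filter_upwards [this] with t' ht' using hloc t' N ht'
  have h3 := abs_lt.1 hN
  have := h1 N t ⟨by linarith, by linarith⟩
  rw [← hloc t N hN] at this
  exact this.congr_of_eventuallyEq hev

/-- A function with `ℓ' ≤ -α ℓ + η` stays below every level `d` with `η < α d`. -/
theorem le_of_deriv_le_neg_mul_add {l l' η : ℝ → ℝ} {a b α d : ℝ} (hl : ContinuousOn l (Icc a b))
    (hl' : ∀ s ∈ Ico a b, HasDerivWithinAt l (l' s) (Ici s) s) (h0 : l a ≤ d)
    (h : ∀ s ∈ Ico a b, l s ≤ d → l' s ≤ -α * l s + η s) (hη : ∀ s ∈ Ico a b, η s < α * d) :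
    ∀ s ∈ Icc a b, l s ≤ d := by
  refine image_le_of_deriv_right_lt_deriv_boundary hl hl' (B := fun _ => d) (B' := fun _ => 0) h0
    (fun x => hasDerivAt_const _ _) ?_
  intro s hs hsd
  have := h s hs hsd.le
  have := hη s hs
  rw [hsd] at *
  linarith

/-- A nonnegative function with `ℓ' ≤ -α ℓ + η` and `η → 0` tends to `0`. -/
theorem tendsto_zero_of_deriv_le_neg_mul_add {l l' η : ℝ → ℝ} {a α : ℝ} (hα : 0 < α)
    (hl' : ∀ s, a ≤ s → HasDerivWithinAt l (l' s) (Ici s) s) (hl : ContinuousOn l (Ici a))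
    (hl0 : ∀ s, 0 ≤ l s) (h : ∀ s, a ≤ s → l' s ≤ -α * l s + η s)
    (hη : Tendsto η atTop (𝓝 0)) : Tendsto l atTop (𝓝 0) := by
  refine tendsto_order.2 ⟨fun e he => Eventually.of_forall fun s => he.trans_le (hl0 s), fun e he => ?_⟩
  obtain ⟨s₁, hs₁⟩ := eventually_atTop.1 ((tendsto_order.1 hη).2 (α * (e / 2)) (by positivity))
  set s₂ := max a s₁
  have ha2 : a ≤ s₂ := le_max_left _ _
  set C := l s₂
  have hC : 0 ≤ C := hl0 _
  -- The barrier decays at half the available rate. Where l touches it, η < α·e/2 makes l' strictly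
  -- smaller than the barrier's slope, even if C = 0.
  have hbound : ∀ b, ∀ s ∈ Icc s₂ b, l s ≤ e / 2 + C * Real.exp (-(α / 2) * (s - s₂)) := by
    intro b
    refine image_le_of_deriv_right_lt_deriv_boundary (f' := l')
      (B := fun s => e / 2 + C * Real.exp (-(α / 2) * (s - s₂)))
      (B' := fun s => C * (Real.exp (-(α / 2) * (s - s₂)) * (-(α / 2))))
      (hl.mono fun s hs => ha2.trans hs.1) (fun s hs => hl' s (ha2.trans hs.1)) ?_ ?_ ?_
    · simp [C]; positivity
    · intro s
      have : HasDerivAt (fun s => -(α / 2) * (s - s₂)) (-(α / 2)) s := by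
        simpa using ((hasDerivAt_id s).sub_const s₂).const_mul (-(α / 2))
      exact (this.exp.const_mul C).const_add _
    · intro s hs hse
      have h1 := h s (ha2.trans hs.1)
      have h2 := hs₁ s ((le_max_right _ _).trans hs.1)
      rw [hse] at h1
      have : 0 ≤ α * (C * Real.exp (-(α / 2) * (s - s₂))) := by positivity
      nlinarith
  have hlim : Tendsto (fun s => e / 2 + C * Real.exp (-(α / 2) * (s - s₂))) atTop
      (𝓝 (e / 2 + C * 0)) := by
    refine tendsto_const_nhds.add (tendsto_const_nhds.mul ?_)
    refine Real.tendsto_exp_atBot.comp ?_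
    exact (tendsto_atTop_add_const_right _ _ tendsto_id).const_mul_atTop_of_neg (by linarith)
  filter_upwards [(tendsto_order.1 hlim).2 e (by linarith), eventually_ge_atTop s₂] with s hs hs2
  exact (hbound s s ⟨hs2, le_rfl⟩).trans_lt hs

/-! ### Attraction of a planar nonautonomous field to (1, 1) -/

/-- The squared Euclidean distance to `(1, 1)`. -/
def sqDist (x : ℝ × ℝ) : ℝ := (x.1 - 1) ^ 2 + (x.2 - 1) ^ 2

lemma sqDist_nonneg (x : ℝ × ℝ) : 0 ≤ sqDist x := by unfold sqDist; positivity

lemma continuous_sqDist : Continuous sqDist := by unfold sqDist; fun_prop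

/-- The closed square of half-width `e` about `(1, 1)`. -/
def box (e : ℝ) : Set (ℝ × ℝ) := Icc (1 - e) (1 + e) ×ˢ Icc (1 - e) (1 + e)

lemma mem_box_of_sqDist_le {e : ℝ} (he : 0 ≤ e) {x : ℝ × ℝ} (hx : sqDist x ≤ e ^ 2) :
    x ∈ box e := by
  unfold sqDist at hx
  have h1 := abs_le.1 (abs_le_of_sq_le_sq (by nlinarith [sq_nonneg (x.2 - 1)] :
    (x.1 - 1) ^ 2 ≤ e ^ 2) he)
  have h2 := abs_le.1 (abs_le_of_sq_le_sq (by nlinarith [sq_nonneg (x.1 - 1)] :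
    (x.2 - 1) ^ 2 ≤ e ^ 2) he)
  exact ⟨⟨by linarith, by linarith⟩, ⟨by linarith, by linarith⟩⟩

lemma hasDerivWithinAt_sqDist {x : ℝ → ℝ × ℝ} {v : ℝ × ℝ} {S : Set ℝ} {s : ℝ}
    (h : HasDerivWithinAt x v S s) :
    HasDerivWithinAt (fun s => sqDist (x s))
      (2 * (((x s).1 - 1) * v.1 + ((x s).2 - 1) * v.2)) S s := by
  have h1 : HasDerivWithinAt (fun s => (x s).1) v.1 S s := by
    exact (hasFDerivAt_fst (𝕜 := ℝ) (p := x s)).comp_hasDerivWithinAt s h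
  have h2 : HasDerivWithinAt (fun s => (x s).2) v.2 S s := by
    exact (hasFDerivAt_snd (𝕜 := ℝ) (p := x s)).comp_hasDerivWithinAt s h
  convert! ((h1.sub_const 1).pow 2).add ((h2.sub_const 1).pow 2) using 1
  simp; ring

/-- The time-dependent planar field `F`, on the box of half-width `e` and for times `s ≥ S`, is
Lipschitz, bounded, continuous, and asymptotically attracts towards `(1, 1)`. -/
structure IsAttracting (F : ℝ → ℝ × ℝ → ℝ × ℝ) (S e α : ℝ) (K M : NNReal) (η : ℝ → ℝ) : Prop where
  e_pos : 0 < e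
  rate_pos : 0 < α
  lipschitz : ∀ s, S ≤ s → LipschitzOnWith K (F s) (box e)
  bounded : ∀ s, S ≤ s → ∀ x ∈ box e, ‖F s x‖ ≤ M
  continuousOn : ∀ x ∈ box e, ContinuousOn (fun s => F s x) (Ici S)
  dissipative : ∀ s, S ≤ s → ∀ x ∈ box e,
    2 * ((x.1 - 1) * (F s x).1 + (x.2 - 1) * (F s x).2) ≤ -α * sqDist x + η s
  error_le : ∀ s, S ≤ s → η s ≤ α * e ^ 2 / 2
  tendsto_error : Tendsto η atTop (𝓝 0)

namespace IsAttracting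

variable {F : ℝ → ℝ × ℝ → ℝ × ℝ} {S e α : ℝ} {K M : NNReal} {η : ℝ → ℝ}

/-- A sublevel set of the squared distance is a trap once the damping α·d exceeds the error. The
derivative v is required to agree with F only inside the box, so the result applies both to genuine
solutions and to solutions of a field modified outside the box. -/
theorem sqDist_lt (hF : IsAttracting F S e α K M η) {a b : ℝ} (ha : S ≤ a) {x v : ℝ → ℝ × ℝ}
    (hx : ContinuousOn x (Icc a b))
    (hx' : ∀ s ∈ Ico a b, HasDerivWithinAt x (v s) (Ici s) s)
    (hv : ∀ s ∈ Ico a b, x s ∈ box e → v s = F s (x s)) (h0 : sqDist (x a) < e ^ 2) :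
    ∀ s ∈ Icc a b, sqDist (x s) < e ^ 2 := by
  have he2 := pow_pos hF.e_pos 2
  -- Any level strictly between e²/2 and e² would do in place of 3/4·e². The error is at most
  -- α·e²/2, hence below α·d, while d < e² keeps the level set inside the box.
  set d := max (sqDist (x a)) (3 / 4 * e ^ 2)
  have hd : d < e ^ 2 := max_lt h0 (by linarith)
  have := le_of_deriv_le_neg_mul_add (α := α) (η := η) (d := d)
    (continuous_sqDist.comp_continuousOn hx) (fun s hs => hasDerivWithinAt_sqDist (hx' s hs))
    (le_max_left _ _) (fun s hs hsd => ?_) (fun s hs => ?_)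
  · exact fun s hs => (this s hs).trans_lt hd
  · have hb := mem_box_of_sqDist_le hF.e_pos.le (hsd.trans hd.le)
    rw [hv s hs hb]
    exact hF.dissipative s (ha.trans hs.1) _ hb
  · have h1 := hF.error_le s (ha.trans hs.1)
    have h2 : 3 / 4 * e ^ 2 ≤ d := le_max_right _ _
    have := mul_le_mul_of_nonneg_left h2 hF.rate_pos.le
    nlinarith [mul_pos hF.rate_pos he2]

theorem tendsto (hF : IsAttracting F S e α K M η) {a : ℝ} (ha : S ≤ a) {x : ℝ → ℝ × ℝ}
    (hx' : ∀ s, a ≤ s → HasDerivAt x (F s (x s)) s ∧ x s ∈ box e) :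
    Tendsto x atTop (𝓝 (1, 1)) := by
  have h := tendsto_zero_of_deriv_le_neg_mul_add hF.rate_pos
    (fun s hs => hasDerivWithinAt_sqDist (hx' s hs).1.hasDerivWithinAt)
    (fun s hs => (continuous_sqDist.continuousAt.comp
      (hx' s hs).1.continuousAt).continuousWithinAt)
    (fun s => sqDist_nonneg _)
    (fun s hs => hF.dissipative s (ha.trans hs) _ (hx' s hs).2) hF.tendsto_error
  have hsq : Tendsto (fun s => √(sqDist (x s))) atTop (𝓝 0) := by
    simpa using h.sqrt
  have hc : ∀ g : ℝ × ℝ → ℝ, (∀ y, (g y - 1) ^ 2 ≤ sqDist y) →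
      Tendsto (fun s => g (x s)) atTop (𝓝 1) := by
    intro g hg
    refine tendsto_iff_norm_sub_tendsto_zero.2
      (squeeze_zero (fun _ => norm_nonneg _) (fun s => ?_) hsq)
    exact Real.abs_le_sqrt (hg _)
  exact (hc Prod.fst fun y => by unfold sqDist; nlinarith [sq_nonneg (y.2 - 1)]).prodMk_nhds
    (hc Prod.snd fun y => by unfold sqDist; nlinarith [sq_nonneg (y.1 - 1)])

theorem eqOn (hF : IsAttracting F S e α K M η) {a b : ℝ} (ha : S ≤ a) {x y : ℝ → ℝ × ℝ}
    (hx : ContinuousOn x (Icc a b))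
    (hx' : ∀ s ∈ Ico a b, HasDerivWithinAt x (F s (x s)) (Ici s) s ∧ x s ∈ box e)
    (hy : ContinuousOn y (Icc a b))
    (hy' : ∀ s ∈ Ico a b, HasDerivWithinAt y (F s (y s)) (Ici s) s ∧ y s ∈ box e)
    (h0 : x a = y a) : EqOn x y (Icc a b) :=
  ODE_solution_unique_of_mem_Icc_right (v := F) (s := fun _ => box e) (K := K)
    (fun s hs => hF.lipschitz s (ha.trans hs.1)) hx (fun s hs => (hx' s hs).1)
    (fun s hs => (hx' s hs).2) hy (fun s hs => (hy' s hs).1) (fun s hs => (hy' s hs).2) h0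

/-- Solutions through the disc exist up to `+∞`, and a little into the past. -/
theorem exists_solution (hF : IsAttracting F S e α K M η) {a : ℝ} (ha : S < a) {x₀ : ℝ × ℝ}
    (hx₀ : sqDist x₀ < e ^ 2) :
    ∃ (x : ℝ → ℝ × ℝ) (a' : ℝ), S ≤ a' ∧ a' < a ∧ x a = x₀ ∧
      (∀ s, a' < s → HasDerivAt x (F s (x s)) s ∧ sqDist (x s) < e ^ 2) ∧
      Tendsto x atTop (𝓝 (1, 1)) := by
  have he := hF.e_pos
  -- Composing with the retraction onto the box and freezing time before S gives a globally
  -- Lipschitz bounded field. Its solution never leaves the disc after time a, so there it solves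
  -- the original equation.
  set clamp : ℝ × ℝ → ℝ × ℝ := fun x => (max (1 - e) (min (1 + e) x.1), max (1 - e) (min (1 + e) x.2))
  have hclamp : ∀ x, clamp x ∈ box e := fun x =>
    ⟨⟨le_max_left _ _, max_le (by linarith) (min_le_left _ _)⟩,
      ⟨le_max_left _ _, max_le (by linarith) (min_le_left _ _)⟩⟩
  have hclamp_id : ∀ x ∈ box e, clamp x = x := by
    rintro ⟨x, y⟩ ⟨hx, hy⟩
    simp only [clamp]
    rw [min_eq_right hx.2, max_eq_right hx.1, min_eq_right hy.2, max_eq_right hy.1]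
  have hclamp_lip : LipschitzWith 1 clamp := by
    have := ((LipschitzWith.prod_fst (α := ℝ) (β := ℝ)).const_min (1 + e)).const_max (1 - e)
    have h2 := ((LipschitzWith.prod_snd (α := ℝ) (β := ℝ)).const_min (1 + e)).const_max (1 - e)
    simpa using this.prodMk h2
  obtain ⟨x, hxa, hx⟩ := exists_global_solution (F := fun s x => F (max s S) (clamp x))
    (K := K) (M := M) (fun s => by
      have h := (hF.lipschitz (max s S) (le_max_right _ _)).comp
        (hclamp_lip.lipschitzOnWith (s := univ)) (fun x _ => hclamp x)
      rw [mul_one] at h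
      exact lipschitzOnWith_univ.1 h)
    (fun x => (hF.continuousOn _ (hclamp x)).comp_continuous (by fun_prop)
      fun s => mem_Ici.2 (le_max_right _ _))
    (fun s x => hF.bounded _ (le_max_right _ _) _ (hclamp x)) a x₀
  have hxc : Continuous x := continuous_iff_continuousAt.2 fun s => (hx s).continuousAt
  have hx_eq : ∀ s, S ≤ s → x s ∈ box e → F (max s S) (clamp (x s)) = F s (x s) := by
    intro s hs hb
    rw [max_eq_left hs, hclamp_id _ hb]
  have hfut : ∀ s, a ≤ s → sqDist (x s) < e ^ 2 := by
    intro s hs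
    refine hF.sqDist_lt ha.le (v := fun s => F (max s S) (clamp (x s))) hxc.continuousOn
      (fun s _ => (hx s).hasDerivWithinAt) (fun s hs hb => hx_eq s (ha.le.trans hs.1) hb)
      (hxa ▸ hx₀) s ⟨hs, le_rfl⟩
  -- The disc is open, so the solution also lies in it shortly before a. This margin later makes the
  -- starting shell an interior point of the geodesic.
  have hev : ∀ᶠ s in 𝓝 a, sqDist (x s) < e ^ 2 :=
    (continuous_sqDist.comp hxc).continuousAt.eventually_lt_const (by simpa [hxa] using hx₀)
  obtain ⟨δ, hδ, hball⟩ := Metric.eventually_nhds_iff.1 hev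
  have hall : ∀ s, max S (a - δ) < s → HasDerivAt x (F s (x s)) s ∧ sqDist (x s) < e ^ 2 := by
    intro s hs
    have hd : sqDist (x s) < e ^ 2 := by
      rcases le_or_gt a s with h | h
      · exact hfut s h
      · refine hball ?_
        have := (le_max_right S (a - δ)).trans_lt hs
        rw [Real.dist_eq, abs_lt]
        constructor <;> linarith
    refine ⟨?_, hd⟩
    have h := hx s
    rwa [hx_eq s ((le_max_left _ _).trans hs.le) (mem_box_of_sqDist_le he.le hd.le)] at h
  have hmax : max S (a - δ) < a := max_lt ha (by linarith)
  refine ⟨x, max S (a - δ), le_max_left _ _, hmax, hxa, hall, ?_⟩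
  exact hF.tendsto ha.le fun s hs => ⟨(hall s (hmax.trans_le hs)).1,
    mem_box_of_sqDist_le he.le (hall s (hmax.trans_le hs)).2.le⟩

end IsAttracting


/-! ### The radial profiles near the centre -/

/-- The derivative of a smooth even function, divided by the variable, converges at `0`. -/
lemma tendsto_deriv_div_of_even {w : ℝ → ℝ} (heven : ∀ x, w (-x) = w x)
    (hw : ContDiffAt ℝ ∞ w 0) : Tendsto (fun x => deriv w x / x) (𝓝[>] 0) (𝓝 (deriv (deriv w) 0)) := by
  have h0 : deriv w 0 = 0 := by
    have h := deriv_comp_neg w (0 : ℝ)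
    rw [show (fun x => w (-x)) = w from funext heven, neg_zero] at h
    linarith
  have hd : DifferentiableAt ℝ (deriv w) 0 := by
    have h1 : ContDiffAt ℝ 1 (fderiv ℝ w) 0 := hw.fderiv_right (by norm_cast)
    exact (h1.clm_apply (contDiffAt_const (c := (1 : ℝ)))).differentiableAt one_ne_zero
  have := hasDerivAt_iff_tendsto_slope.1 hd.hasDerivAt
  refine (this.mono_left (nhdsWithin_mono 0 fun x hx => ne_of_gt hx)).congr fun x => ?_
  simp [slope_def_field, h0]

namespace DustData

variable {D : DustData}

/-- `c'(R) / R`. -/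
def alpha (D : DustData) (R : ℝ) : ℝ := deriv D.c R / R

/-- `q'(R) / R`. -/
def beta (D : DustData) (R : ℝ) : ℝ := deriv D.q R / R

/-- `q'(R) / (R √(1 - q²))`. -/
def delta (D : DustData) (R : ℝ) : ℝ := D.beta R / √(1 - D.q R ^ 2)

namespace IsAdmissible

lemma contDiffOn_density (hD : D.IsAdmissible) : ContDiffOn ℝ ∞ D.ρ (Ioo 0 D.R₁) := by
  obtain ⟨w, -, hw, hρ⟩ := hD.smooth_density
  exact (hw.mono fun x hx => ⟨by linarith [hx.1, hx.2], hx.2⟩).congr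
    fun x hx => hρ x ⟨hx.1.le, hx.2⟩

lemma continuousOn_density (hD : D.IsAdmissible) : ContinuousOn D.ρ (Ico 0 D.R₁) := by
  obtain ⟨w, -, hw, hρ⟩ := hD.smooth_density
  exact (hw.continuousOn.mono fun x hx => ⟨by linarith [hx.1, hx.2], hx.2⟩).congr hρ

lemma continuousOn_integrand (hD : D.IsAdmissible) :
    ContinuousOn (fun x => D.ρ x * x ^ 2) (Ico 0 D.R₁) :=
  hD.continuousOn_density.mul (by fun_prop)

lemma intervalIntegrable (hD : D.IsAdmissible) {R : ℝ} (hR : R ∈ Ico 0 D.R₁) :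
    IntervalIntegrable (fun x => D.ρ x * x ^ 2) MeasureTheory.volume 0 R := by
  refine (hD.continuousOn_integrand.mono ?_).intervalIntegrable
  rw [uIcc_of_le hR.1]
  exact fun x hx => ⟨hx.1, hx.2.trans_lt hR.2⟩

lemma hasDerivAt_mass (hD : D.IsAdmissible) {R : ℝ} (hR : R ∈ Ioo 0 D.R₁) :
    HasDerivAt D.mass (4 * Real.pi * (D.ρ R * R ^ 2)) R := by
  have hc : ContinuousOn (fun x => D.ρ x * x ^ 2) (Ioo 0 D.R₁) :=
    hD.continuousOn_integrand.mono Ioo_subset_Ico_self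
  exact (intervalIntegral.integral_hasDerivAt_right (hD.intervalIntegrable ⟨hR.1.le, hR.2⟩)
    (hc.stronglyMeasurableAtFilter isOpen_Ioo R hR)
    (hc.continuousAt (isOpen_Ioo.mem_nhds hR))).const_mul _

lemma mass_pos (hD : D.IsAdmissible) {R : ℝ} (hR : R ∈ Ioo 0 D.R₁) : 0 < D.mass R := by
  have := intervalIntegral.intervalIntegral_pos_of_pos_on (hD.intervalIntegrable ⟨hR.1.le, hR.2⟩)
    (fun x hx => mul_pos (hD.density_pos x ⟨hx.1.le, hx.2.trans hR.2⟩) (pow_pos hx.1 2)) hR.1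
  unfold mass
  positivity

lemma tendsto_mass (hD : D.IsAdmissible) : Tendsto D.mass (𝓝[>] 0) (𝓝 0) := by
  have h2 : (0 : ℝ) ≤ D.R₁ / 2 := by linarith [hD.radius_pos]
  have hi := hD.intervalIntegrable (R := D.R₁ / 2) ⟨h2, by linarith [hD.radius_pos]⟩
  have h := intervalIntegral.continuousOn_primitive_interval
    ((intervalIntegrable_iff' (by exact enorm_ne_top)).1 hi)
  have h0 := (h 0 left_mem_uIcc).tendsto.const_mul (4 * Real.pi)
  rw [intervalIntegral.integral_same, mul_zero, uIcc_of_le h2] at h0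
  refine h0.mono_left (nhdsWithin_le_iff.2 ?_)
  filter_upwards [Ioo_mem_nhdsGT (show (0 : ℝ) < D.R₁ / 2 by linarith [hD.radius_pos])] with x hx
    using Ioo_subset_Icc_self hx

lemma contDiffOn_mass (hD : D.IsAdmissible) : ContDiffOn ℝ ∞ D.mass (Ioo 0 D.R₁) := by
  refine (contDiffOn_infty_iff_deriv_of_isOpen isOpen_Ioo).2 ⟨fun R hR =>
    (hD.hasDerivAt_mass hR).differentiableAt.differentiableWithinAt, ?_⟩
  refine ContDiffOn.congr (f := fun R => 4 * Real.pi * (D.ρ R * R ^ 2)) ?_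
    fun R hR => (hD.hasDerivAt_mass hR).deriv
  exact contDiffOn_const.mul (hD.contDiffOn_density.mul (by fun_prop))

lemma contDiffOn_c (hD : D.IsAdmissible) : ContDiffOn ℝ ∞ D.c (Ioo 0 D.R₁) :=
  (contDiffOn_const.mul hD.contDiffOn_mass).div (by fun_prop) fun R hR => pow_ne_zero 3 hR.1.ne'

lemma contDiffOn_energy (hD : D.IsAdmissible) : ContDiffOn ℝ ∞ D.energy (Ioo 0 D.R₁) := by
  obtain ⟨u, -, hu, hv⟩ := hD.smooth_velocity
  have hv' : ContDiffOn ℝ ∞ D.v (Ioo 0 D.R₁) :=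
    (contDiffOn_id.mul (hu.mono fun x hx => ⟨by linarith [hx.1, hx.2], hx.2⟩)).congr
      fun x hx => hv x ⟨hx.1.le, hx.2⟩
  exact ((hv'.pow 2).div_const 2).sub
    (hD.contDiffOn_mass.div contDiffOn_id fun R hR => hR.1.ne')

lemma contDiffOn_q (hD : D.IsAdmissible) : ContDiffOn ℝ ∞ D.q (Ioo 0 D.R₁) := by
  refine ContDiffOn.sqrt ((contDiffOn_id.mul hD.contDiffOn_energy).div hD.contDiffOn_mass
    fun R hR => (hD.mass_pos hR).ne').neg ?_
  intro R hR
  have h1 := hD.mass_pos hR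
  have h2 := mul_neg_of_pos_of_neg hR.1 (hD.bounded R hR)
  have := div_neg_of_neg_of_pos h2 h1
  exact (neg_pos.2 this).ne'

lemma c_pos (hD : D.IsAdmissible) {R : ℝ} (hR : R ∈ Ioo 0 D.R₁) : 0 < D.c R := by
  have := hD.mass_pos hR
  have := hR.1
  unfold c
  positivity

lemma mass_eq {R : ℝ} (hR : R ≠ 0) : D.mass R = D.c R * R ^ 3 / 2 := by
  unfold c; field_simp

lemma q_sq (hD : D.IsAdmissible) {R : ℝ} (hR : R ∈ Ioo 0 D.R₁) :
    D.q R ^ 2 = -(R * D.energy R / D.mass R) := by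
  have h1 := hD.mass_pos hR
  have h2 := div_neg_of_neg_of_pos (mul_neg_of_pos_of_neg hR.1 (hD.bounded R hR)) h1
  unfold q
  rw [Real.sq_sqrt (by linarith)]

lemma q_pos (hD : D.IsAdmissible) {R : ℝ} (hR : R ∈ Ioo 0 D.R₁) : 0 < D.q R := by
  have h1 := hD.mass_pos hR
  have h2 := div_neg_of_neg_of_pos (mul_neg_of_pos_of_neg hR.1 (hD.bounded R hR)) h1
  exact Real.sqrt_pos.2 (by linarith)

lemma energy_eq (hD : D.IsAdmissible) {R : ℝ} (hR : R ∈ Ioo 0 D.R₁) :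
    D.energy R = -(D.q R ^ 2 * D.c R * R ^ 2 / 2) := by
  have h1 := (hD.mass_pos hR).ne'
  have h2 := hR.1.ne'
  rw [hD.q_sq hR, c]
  field_simp

lemma q_le_one (hD : D.IsAdmissible) {R : ℝ} (hR : R ∈ Ioo 0 D.R₁) : D.q R ≤ 1 := by
  have h1 := hD.mass_pos hR
  have h2 := hR.1
  have h3 : D.q R ^ 2 ≤ 1 ^ 2 := by
    rw [hD.q_sq hR, energy]
    have : -(R * (D.v R ^ 2 / 2 - D.mass R / R) / D.mass R)
        = 1 - R * D.v R ^ 2 / (2 * D.mass R) := by field_simp; ring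
    rw [this]
    have : 0 ≤ R * D.v R ^ 2 / (2 * D.mass R) := by positivity
    linarith
  exact le_of_sq_le_sq h3 (by norm_num)

lemma hasDerivAt_c (hD : D.IsAdmissible) {R : ℝ} (hR : R ∈ Ioo 0 D.R₁) :
    HasDerivAt D.c ((8 * Real.pi * D.ρ R - 3 * D.c R) / R) R := by
  have h := ((hD.hasDerivAt_mass hR).const_mul 2).div (hasDerivAt_pow 3 R)
    (pow_ne_zero 3 hR.1.ne')
  refine h.congr_deriv ?_
  have := hR.1.ne'
  unfold c
  simp
  field_simp
  ring

lemma tendsto_density (hD : D.IsAdmissible) : Tendsto D.ρ (𝓝[>] 0) (𝓝 (D.ρ 0)) := by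
  refine ((hD.continuousOn_density 0 ⟨le_rfl, hD.radius_pos⟩).mono_left
    (nhdsWithin_le_iff.2 ?_))
  filter_upwards [Ioo_mem_nhdsGT hD.radius_pos] with x hx using Ioo_subset_Ico_self hx

lemma tendsto_c (hD : D.IsAdmissible) :
    Tendsto D.c (𝓝[>] 0) (𝓝 (8 * Real.pi * D.ρ 0 / 3)) := by
  have hR := hD.radius_pos
  refine HasDerivAt.lhopital_zero_right_on_Ioo (f := fun R => 2 * D.mass R) (g := fun R => R ^ 3)
    (f' := fun R => 2 * (4 * Real.pi * (D.ρ R * R ^ 2))) (g' := fun R => 3 * R ^ 2) hR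
    (fun R hR => (hD.hasDerivAt_mass hR).const_mul 2) (fun R hR => by simpa using hasDerivAt_pow 3 R)
    (fun R hR => by have := hR.1; positivity) ?_ ?_ ?_
  · simpa using hD.tendsto_mass.const_mul 2
  · have : Tendsto (fun R : ℝ => R ^ 3) (𝓝 0) (𝓝 (0 ^ 3)) :=
      (by fun_prop : Continuous fun R : ℝ => R ^ 3).continuousAt
    simpa using this.mono_left nhdsWithin_le_nhds
  · refine ((hD.tendsto_density.const_mul (8 * Real.pi)).div_const 3).congr' ?_
    filter_upwards [self_mem_nhdsWithin] with R hR
    have : R ≠ 0 := ne_of_gt hR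
    field_simp
    ring

lemma exists_tendsto_deriv_density (hD : D.IsAdmissible) :
    ∃ κ ≤ 0, Tendsto (fun R => deriv D.ρ R / R) (𝓝[>] 0) (𝓝 κ) := by
  obtain ⟨w, hev, hw, hρ⟩ := hD.smooth_density
  have h0 : (0 : ℝ) ∈ Ioo (-D.R₁) D.R₁ := ⟨by linarith [hD.radius_pos], hD.radius_pos⟩
  have h := tendsto_deriv_div_of_even hev (hw.contDiffAt (isOpen_Ioo.mem_nhds h0))
  have h' : Tendsto (fun R => deriv D.ρ R / R) (𝓝[>] 0) (𝓝 (deriv (deriv w) 0)) := by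
    refine h.congr' ?_
    filter_upwards [Ioo_mem_nhdsGT hD.radius_pos] with x hx
    have : D.ρ =ᶠ[𝓝 x] w := by
      filter_upwards [isOpen_Ioo.mem_nhds hx] with y hy using hρ y ⟨hy.1.le, hy.2⟩
    rw [this.deriv_eq]
  refine ⟨_, le_of_tendsto h' ?_, h'⟩
  filter_upwards [Ioo_mem_nhdsGT hD.radius_pos] with x hx
  exact div_nonpos_of_nonpos_of_nonneg (hD.density_deriv_nonpos x hx) hx.1.le

/-- Here c'/R = (8πρR³ - 6m)/R⁵. By l'Hôpital the numerator has derivative 8πρ'R³, since the ρR²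
terms cancel. The limit is 8π/5 times that of ρ'/R, and its sign is that of ρ'. -/
lemma exists_tendsto_alpha (hD : D.IsAdmissible) :
    ∃ α₀ ≤ 0, Tendsto D.alpha (𝓝[>] 0) (𝓝 α₀) := by
  obtain ⟨κ, hκ, h⟩ := hD.exists_tendsto_deriv_density
  refine ⟨8 * Real.pi / 5 * κ, mul_nonpos_of_nonneg_of_nonpos (by positivity) hκ, ?_⟩
  have hL : Tendsto (fun R => (8 * Real.pi * (D.ρ R * R ^ 3) - 6 * D.mass R) / R ^ 5) (𝓝[>] 0)
      (𝓝 (8 * Real.pi / 5 * κ)) := by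
    refine HasDerivAt.lhopital_zero_right_on_Ioo (f' := fun R => 8 * Real.pi * (deriv D.ρ R * R ^ 3))
      (g' := fun R => 5 * R ^ 4) hD.radius_pos ?_ (fun R hR => by simpa using hasDerivAt_pow 5 R)
      (fun R hR => by have := hR.1; positivity) ?_ ?_ ?_
    · intro R hR
      have h1 : HasDerivAt D.ρ (deriv D.ρ R) R :=
        ((hD.contDiffOn_density.contDiffAt (isOpen_Ioo.mem_nhds hR)).differentiableAt
          (by simp)).hasDerivAt
      refine (((h1.mul (hasDerivAt_pow 3 R)).const_mul (8 * Real.pi)).sub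
        ((hD.hasDerivAt_mass hR).const_mul 6)).congr_deriv ?_
      push_cast
      ring
    · have h3 : Tendsto (fun R : ℝ => R ^ 3) (𝓝[>] 0) (𝓝 (0 ^ 3)) :=
        (by fun_prop : Continuous fun R : ℝ => R ^ 3).continuousAt.mono_left nhdsWithin_le_nhds
      simpa using ((hD.tendsto_density.mul h3).const_mul (8 * Real.pi)).sub
        (hD.tendsto_mass.const_mul 6)
    · have : Tendsto (fun R : ℝ => R ^ 5) (𝓝 0) (𝓝 (0 ^ 5)) :=
      (by fun_prop : Continuous fun R : ℝ => R ^ 5).continuousAt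
      simpa using this.mono_left nhdsWithin_le_nhds
    · refine (h.const_mul (8 * Real.pi / 5)).congr' ?_
      filter_upwards [self_mem_nhdsWithin] with R hR
      have : R ≠ 0 := ne_of_gt hR
      field_simp
  refine hL.congr' ?_
  filter_upwards [Ioo_mem_nhdsGT hD.radius_pos] with R hR
  have := hR.1.ne'
  rw [alpha, (hD.hasDerivAt_c hR).deriv, c]
  field_simp
  ring

lemma monotoneOn_q (hD : D.IsAdmissible) : MonotoneOn D.q (Ioo 0 D.R₁) := by
  refine monotoneOn_of_deriv_nonneg (convex_Ioo _ _) hD.contDiffOn_q.continuousOn ?_ ?_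
  · rw [interior_Ioo]; exact hD.contDiffOn_q.differentiableOn (by simp)
  · rw [interior_Ioo]; exact hD.no_shell_crossing

/-- With v = R·u one has E/R² = (u² - c)/2, hence q = √(1 - u²/c). Boundedness at the centre keeps
the radicand away from 0 in the limit, so the quotient for q'/R obtained by differentiating the root
converges along with u'/R and c'/R. -/
lemma exists_tendsto_q (hD : D.IsAdmissible) :
    ∃ q₀ β₀ : ℝ, 0 < q₀ ∧ q₀ ≤ 1 ∧ 0 ≤ β₀ ∧ Tendsto D.q (𝓝[>] 0) (𝓝 q₀) ∧
      Tendsto D.beta (𝓝[>] 0) (𝓝 β₀) := by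
  obtain ⟨u, hev, hu, hv⟩ := hD.smooth_velocity
  obtain ⟨κ, hκ, hE⟩ := hD.bounded_center
  obtain ⟨α₀, -, hα⟩ := hD.exists_tendsto_alpha
  have hc := hD.tendsto_c
  set c₀ := 8 * Real.pi * D.ρ 0 / 3
  have hc₀ : 0 < c₀ := by
    have := hD.density_pos 0 ⟨le_rfl, hD.radius_pos⟩
    positivity
  have h0 : (0 : ℝ) ∈ Ioo (-D.R₁) D.R₁ := ⟨by linarith [hD.radius_pos], hD.radius_pos⟩
  have hu0 := hu.contDiffAt (isOpen_Ioo.mem_nhds h0)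
  have hut : Tendsto u (𝓝[>] 0) (𝓝 (u 0)) := hu0.continuousAt.mono_left nhdsWithin_le_nhds
  have hu' := tendsto_deriv_div_of_even hev hu0
  have hIoo : ∀ᶠ R in 𝓝[>] (0 : ℝ), R ∈ Ioo 0 D.R₁ := Ioo_mem_nhdsGT hD.radius_pos
  have hEq : ∀ R ∈ Ioo 0 D.R₁, D.energy R / R ^ 2 = (u R ^ 2 - D.c R) / 2 := by
    intro R hR
    have := hR.1.ne'
    rw [energy, hv R ⟨hR.1.le, hR.2⟩, c]
    field_simp
  have hκ' : κ = (u 0 ^ 2 - c₀) / 2 := by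
    refine tendsto_nhds_unique hE ((((hut.pow 2).sub hc).div_const 2).congr' ?_)
    filter_upwards [hIoo] with R hR using (hEq R hR).symm
  have hQ : ∀ R ∈ Ioo 0 D.R₁, D.q R = √(1 - u R ^ 2 / D.c R) := by
    intro R hR
    rw [← Real.sqrt_sq (hD.q_pos hR).le, hD.q_sq hR]
    congr 1
    have h1 := hEq R hR
    have h2 := hR.1.ne'
    have h3 := (hD.c_pos hR).ne'
    rw [div_eq_iff (by positivity)] at h1
    rw [h1, mass_eq h2]
    field_simp
    ring
  have hq₀ : 0 < 1 - u 0 ^ 2 / c₀ := by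
    rw [sub_pos, div_lt_one hc₀]; linarith
  have htq : Tendsto D.q (𝓝[>] 0) (𝓝 √(1 - u 0 ^ 2 / c₀)) := by
    refine ((tendsto_const_nhds.sub ((hut.pow 2).div hc hc₀.ne')).sqrt).congr' ?_
    filter_upwards [hIoo] with R hR using (hQ R hR).symm
  have htb : Tendsto D.beta (𝓝[>] 0) (𝓝 (-((2 * u 0 * deriv (deriv u) 0 * c₀ - u 0 ^ 2 * α₀)
      / c₀ ^ 2) / (2 * √(1 - u 0 ^ 2 / c₀)))) := by
    have := ((((hut.const_mul 2).mul hu').mul hc).sub ((hut.pow 2).mul hα)).div (hc.pow 2)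
      (pow_ne_zero 2 hc₀.ne') |>.neg.div (htq.const_mul 2) (by positivity)
    refine this.congr' ?_
    filter_upwards [hIoo] with R hR
    have hR0 := hR.1.ne'
    have hq0 := (hD.q_pos hR)
    have hud : HasDerivAt u (deriv u R) R :=
      ((hu.contDiffAt (isOpen_Ioo.mem_nhds
        (⟨by linarith [hR.1, hR.2], hR.2⟩ : R ∈ Ioo (-D.R₁) D.R₁))).differentiableAt
          (by simp)).hasDerivAt
    have hcd := (hD.hasDerivAt_c hR).differentiableAt.hasDerivAt
    have hc0 := (hD.c_pos hR)
    have hpos : 1 - u R ^ 2 / D.c R ≠ 0 := by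
      intro h
      rw [hQ R hR, h] at hq0
      simp at hq0
    have hqd : HasDerivAt D.q (-((2 * u R * deriv u R * D.c R - u R ^ 2 * deriv D.c R)
        / D.c R ^ 2) / (2 * D.q R)) R := by
      have := ((((hud.pow 2).div hcd hc0.ne').const_sub 1).sqrt hpos).congr_of_eventuallyEq
        (f₁ := D.q) (by filter_upwards [isOpen_Ioo.mem_nhds hR] with x hx using hQ x hx)
      refine this.congr_deriv ?_
      rw [hQ R hR]
      simp
    simp only [beta, hqd.deriv, alpha, Pi.div_apply]
    field_simp
  refine ⟨_, _, Real.sqrt_pos.2 hq₀, ?_, ge_of_tendsto htb ?_, htq, htb⟩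
  · refine le_of_tendsto htq ?_
    filter_upwards [hIoo] with R hR using hD.q_le_one hR
  · filter_upwards [hIoo] with R hR
    exact div_nonneg (hD.no_shell_crossing R hR) hR.1.le

end IsAdmissible

/-! ### The function `f` -/

lemma continuous_f : Continuous f := by unfold f; fun_prop

lemma one_sub_sq_pos {x : ℝ} (hx : x ∈ Ioo (-1) 1) : 0 < 1 - x ^ 2 := by
  nlinarith [hx.1, hx.2]

lemma contDiffAt_f {x : ℝ} (hx : x ∈ Ioo (-1) 1) : ContDiffAt ℝ ∞ f x := by
  have h1 : ContDiffAt ℝ ∞ (fun x : ℝ => √(1 - x ^ 2)) x :=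
    ContDiffAt.sqrt (by fun_prop) (one_sub_sq_pos hx).ne'
  exact (contDiffAt_id.mul h1).add (Real.contDiffAt_arccos hx.1.ne' hx.2.ne)

lemma hasDerivAt_f {x : ℝ} (hx : x ∈ Ioo (-1) 1) :
    HasDerivAt f (-2 * x ^ 2 / √(1 - x ^ 2)) x := by
  have h0 := one_sub_sq_pos hx
  have h1 : HasDerivAt (fun x : ℝ => 1 - x ^ 2) (-(2 * x)) x := by
    simpa using (hasDerivAt_pow 2 x).const_sub 1
  refine (((hasDerivAt_id x).mul (h1.sqrt h0.ne')).add
    (Real.hasDerivAt_arccos hx.1.ne' hx.2.ne)).congr_deriv ?_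
  have h2 := Real.sq_sqrt h0.le
  have h3 := (Real.sqrt_pos.2 h0).ne'
  simp only [id]
  field_simp
  rw [h2]
  ring

lemma strictAntiOn_f : StrictAntiOn f (Icc 0 1) := by
  refine strictAntiOn_of_deriv_neg (convex_Icc _ _) continuous_f.continuousOn ?_
  rw [interior_Icc]
  intro x hx
  have hx' : x ∈ Ioo (-1 : ℝ) 1 := ⟨by linarith [hx.1], hx.2⟩
  rw [(hasDerivAt_f hx').deriv]
  have := Real.sqrt_pos.2 (one_sub_sq_pos hx')
  have := hx.1
  rw [neg_mul, neg_div]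
  exact neg_neg_of_pos (by positivity)

/-- Multiplying by 2q³/3 turns the claim into F(q) > F(0) for F(x) = (2/3)x³/√(1-x²) + f(x). The
singular terms combine so that F' = (2/3)x⁴/(1-x²)^{3/2}, which is positive for x > 0. -/
lemma h_zero_pos {q : ℝ} (hq : q ∈ Ioo 0 1) :
    0 < 1 / √(1 - q ^ 2) - 3 / 2 * ((f 0 - f q) / q ^ 3) := by
  set F : ℝ → ℝ := fun x => 2 / 3 * (x ^ 3 / √(1 - x ^ 2)) + f x
  have hder : ∀ x ∈ Ico (0 : ℝ) 1,
      HasDerivAt F (2 / 3 * (x ^ 4 / ((1 - x ^ 2) * √(1 - x ^ 2)))) x := by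
    intro x hx
    have hx' : x ∈ Ioo (-1 : ℝ) 1 := ⟨by linarith [hx.1], hx.2⟩
    have h0 := one_sub_sq_pos hx'
    have h3 := Real.sqrt_pos.2 h0
    have h1 : HasDerivAt (fun x : ℝ => 1 - x ^ 2) (-(2 * x)) x := by
      simpa using (hasDerivAt_pow 2 x).const_sub 1
    refine ((((hasDerivAt_pow 3 x).div (h1.sqrt h0.ne') h3.ne').const_mul (2 / 3)).add
      (hasDerivAt_f hx')).congr_deriv ?_
    have h2 := Real.sq_sqrt h0.le
    rw [h2]
    push_cast
    field_simp
    rw [h2]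
    ring
  have hmono : StrictMonoOn F (Ico 0 1) := by
    refine strictMonoOn_of_deriv_pos (convex_Ico _ _)
      (fun x hx => (hder x hx).continuousAt.continuousWithinAt) ?_
    rw [interior_Ico]
    intro x hx
    have h0 := one_sub_sq_pos (⟨by linarith [hx.1], hx.2⟩ : x ∈ Ioo (-1 : ℝ) 1)
    have := hx.1
    rw [(hder x ⟨hx.1.le, hx.2⟩).deriv]
    positivity
  have hlt := hmono ⟨le_rfl, one_pos⟩ ⟨hq.1.le, hq.2⟩ hq.1
  have hq0 := hq.1
  simp only [F] at hlt
  have : 1 / √(1 - q ^ 2) - 3 / 2 * ((f 0 - f q) / q ^ 3)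
      = 3 / (2 * q ^ 3) * (2 / 3 * (q ^ 3 / √(1 - q ^ 2)) + f q - f 0) := by
    field_simp
    ring
  rw [this]
  refine mul_pos (by positivity) ?_
  simpa using hlt

/-! ### The parameters of the vector field -/

/-- `g` as a function of the parameters `(R, E, c, q, f(q), c'/R, q'/R, q'/(R√(1-q²)))`. -/
def gPar (P : Fin 8 → ℝ) (y : ℝ) : ℝ := (f (P 3 * y) - P 4) / P 3 ^ 3

/-- `Λ` as a function of the parameters. -/
def LamPar (P : Fin 8 → ℝ) (y : ℝ) : ℝ :=
  2 / P 3 * (P 7 - P 6 * (y ^ 3 / √(1 - P 3 ^ 2 * y ^ 2)) - 3 / 2 * P 6 * gPar P y)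
    - P 5 / (2 * P 2) * gPar P y

/-- The radial functions on which the vector field depends. -/
def params (D : DustData) (R : ℝ) : Fin 8 → ℝ :=
  ![R, D.energy R, D.c R, D.q R, f (D.q R), D.alpha R, D.beta R, D.delta R]

/-- Regularity of the radial functions on `(0, b)`, with central values `P₀`. -/
structure IsRegularCentre (D : DustData) (b : ℝ) (P₀ : Fin 8 → ℝ) : Prop where
  pos : 0 < b
  lt : b < D.R₁
  zero₀ : P₀ 0 = 0
  zero₁ : P₀ 1 = 0
  pos₂ : 0 < P₀ 2
  pos₃ : 0 < P₀ 3
  Lam_pos : 0 < LamPar P₀ 0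
  tendsto : Tendsto D.params (𝓝[>] 0) (𝓝 P₀)
  continuousOn : ContinuousOn D.params (Ioo 0 b)
  contDiffOn_f_q : ContDiffOn ℝ ∞ (fun R => f (D.q R)) (Ioo 0 b)
  hasDerivAt_f_q : ∀ R ∈ Ioo 0 b,
    HasDerivAt (fun R => f (D.q R)) (-2 * D.q R ^ 2 * (R * D.delta R)) R

lemma alpha_continuousOn (hD : D.IsAdmissible) : ContinuousOn D.alpha (Ioo 0 D.R₁) :=
  (((contDiffOn_infty_iff_deriv_of_isOpen isOpen_Ioo).1 hD.contDiffOn_c).2.continuousOn).div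
    continuousOn_id fun _ hR => hR.1.ne'

lemma beta_continuousOn (hD : D.IsAdmissible) : ContinuousOn D.beta (Ioo 0 D.R₁) :=
  (((contDiffOn_infty_iff_deriv_of_isOpen isOpen_Ioo).1 hD.contDiffOn_q).2.continuousOn).div
    continuousOn_id fun _ hR => hR.1.ne'

lemma IsAdmissible.tendsto_energy (hD : D.IsAdmissible) : Tendsto D.energy (𝓝[>] 0) (𝓝 0) := by
  obtain ⟨κ, -, h⟩ := hD.bounded_center
  have h2 : Tendsto (fun R : ℝ => R ^ 2) (𝓝[>] 0) (𝓝 (0 ^ 2)) :=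
    (by fun_prop : Continuous fun R : ℝ => R ^ 2).continuousAt.mono_left nhdsWithin_le_nhds
  have := h.mul h2
  simp only [ne_eq, OfNat.ofNat_ne_zero, not_false_eq_true, zero_pow, mul_zero] at this
  refine this.congr' ?_
  filter_upwards [self_mem_nhdsWithin] with R hR
  have : R ≠ 0 := ne_of_gt hR
  field_simp

/-- The difficulty is q = 1, where neither f nor 1/√(1 - q²) is regular. For this reason f(q) and
q'/(R√(1 - q²)) are carried as separate parameters and the cases q₀ < 1 and q₀ = 1 are treated
apart. -/
theorem exists_isRegularCentre (hD : D.IsAdmissible) : ∃ b P₀, D.IsRegularCentre b P₀ := by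
  obtain ⟨q₀, β₀, hq₀, hq₁, hβ₀, htq, htβ⟩ := hD.exists_tendsto_q
  obtain ⟨α₀, hα₀, htα⟩ := hD.exists_tendsto_alpha
  have htc := hD.tendsto_c
  set c₀ := 8 * Real.pi * D.ρ 0 / 3
  have hc₀ : 0 < c₀ := by
    have := hD.density_pos 0 ⟨le_rfl, hD.radius_pos⟩
    positivity
  have hnd : α₀ < 0 ∨ 0 < β₀ := by
    rcases hD.nondegenerate with ⟨κ, hκ, h⟩ | ⟨κ, hκ, h⟩
    · exact Or.inl (tendsto_nhds_unique h htα ▸ hκ)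
    · exact Or.inr (tendsto_nhds_unique h htβ ▸ hκ)
  have hg₀ : 0 < (f 0 - f q₀) / q₀ ^ 3 :=
    div_pos (sub_pos.2 (strictAntiOn_f ⟨le_rfl, zero_le_one⟩ ⟨hq₀.le, hq₁⟩ hq₀)) (by positivity)
  have hR₁ := hD.radius_pos
  -- it remains to treat `delta` and `f ∘ q`, which depend on whether `q₀ < 1`
  suffices hmain : ∃ b δ₀ : ℝ, 0 < b ∧ b < D.R₁ ∧
      0 < 2 / q₀ * (δ₀ - 3 / 2 * β₀ * ((f 0 - f q₀) / q₀ ^ 3))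
        - α₀ / (2 * c₀) * ((f 0 - f q₀) / q₀ ^ 3) ∧
      Tendsto D.delta (𝓝[>] 0) (𝓝 δ₀) ∧ ContinuousOn D.delta (Ioo 0 b) ∧
      ContDiffOn ℝ ∞ (fun R => f (D.q R)) (Ioo 0 b) ∧ ∀ R ∈ Ioo 0 b,
        HasDerivAt (fun R => f (D.q R)) (-2 * D.q R ^ 2 * (R * D.delta R)) R by
    obtain ⟨b, δ₀, hb, hb', hpos, htδ, hcδ, hsm, hder⟩ := hmain
    have hsub : Ioo 0 b ⊆ Ioo 0 D.R₁ := Ioo_subset_Ioo_right hb'.le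
    refine ⟨b, ![0, 0, c₀, q₀, f q₀, α₀, β₀, δ₀], ⟨hb, hb', rfl, rfl, hc₀, hq₀, ?_, ?_,
      ?_, hsm, hder⟩⟩
    · simpa [LamPar, gPar] using hpos
    · refine tendsto_pi_nhds.2 fun i => ?_
      fin_cases i
      · exact tendsto_id.mono_left nhdsWithin_le_nhds
      · exact hD.tendsto_energy
      · exact htc
      · exact htq
      · exact (continuous_f.tendsto q₀).comp htq
      · exact htα
      · exact htβ
      · exact htδ
    · refine continuousOn_pi.2 fun i => ?_
      fin_cases i
      · exact continuousOn_id
      · exact hD.contDiffOn_energy.continuousOn.mono hsub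
      · exact hD.contDiffOn_c.continuousOn.mono hsub
      · exact hD.contDiffOn_q.continuousOn.mono hsub
      · exact hsm.continuousOn
      · exact (alpha_continuousOn hD).mono hsub
      · exact (beta_continuousOn hD).mono hsub
      · exact hcδ
  -- If q₀ < 1, then q < 1 near the centre and all compositions are smooth there. The central Λ
  -- splits into multiples of β₀ ≥ 0 and -α₀ ≥ 0 with positive coefficients, and nondegeneracy makes
  -- one of them positive.
  rcases hq₁.lt_or_eq with hlt | rfl
  · have hev : ∀ᶠ R in 𝓝[>] (0 : ℝ), D.q R < 1 := htq.eventually_lt_const hlt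
    obtain ⟨b₁, hb₁, hb₁'⟩ := mem_nhdsGT_iff_exists_Ioo_subset.1 hev
    have hb₁0 : (0 : ℝ) < b₁ := hb₁
    have hsub : Ioo 0 (min b₁ (D.R₁ / 2)) ⊆ Ioo 0 D.R₁ :=
      Ioo_subset_Ioo_right ((min_le_right _ _).trans (by linarith))
    have hq : ∀ R ∈ Ioo 0 (min b₁ (D.R₁ / 2)), D.q R ∈ Ioo (-1 : ℝ) 1 := fun R hR =>
      ⟨by linarith [hD.q_pos (hsub hR)], hb₁' ⟨hR.1, hR.2.trans_le (min_le_left _ _)⟩⟩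
    have hs₀ : 0 < √(1 - q₀ ^ 2) := Real.sqrt_pos.2 (by nlinarith)
    refine ⟨min b₁ (D.R₁ / 2), β₀ / √(1 - q₀ ^ 2), lt_min hb₁0 (by linarith),
      (min_le_right _ _).trans_lt (by linarith), ?_, ?_, ?_, ?_, ?_⟩
    · have hh := h_zero_pos ⟨hq₀, hlt⟩
      have : 2 / q₀ * (β₀ / √(1 - q₀ ^ 2) - 3 / 2 * β₀ * ((f 0 - f q₀) / q₀ ^ 3))
          - α₀ / (2 * c₀) * ((f 0 - f q₀) / q₀ ^ 3)
          = 2 / q₀ * β₀ * (1 / √(1 - q₀ ^ 2) - 3 / 2 * ((f 0 - f q₀) / q₀ ^ 3))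
            + (-α₀) / (2 * c₀) * ((f 0 - f q₀) / q₀ ^ 3) := by ring
      rw [this]
      rcases hnd with h | h
      · exact add_pos_of_nonneg_of_pos (by positivity)
          (mul_pos (div_pos (by linarith) (by positivity)) hg₀)
      · exact add_pos_of_pos_of_nonneg (by positivity)
          (mul_nonneg (div_nonneg (by linarith) (by positivity)) hg₀.le)
    · exact htβ.div (tendsto_const_nhds.sub (htq.pow 2)).sqrt hs₀.ne'
    · exact ((beta_continuousOn hD).mono hsub).div
        ((continuousOn_const.sub ((hD.contDiffOn_q.continuousOn.mono hsub).pow 2)).sqrt)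
        fun R hR => (Real.sqrt_pos.2 (one_sub_sq_pos (hq R hR))).ne'
    · exact fun R hR => (contDiffAt_f (hq R hR)).comp_contDiffWithinAt R
        (hD.contDiffOn_q.mono hsub R hR)
    · intro R hR
      have hqd : HasDerivAt D.q (deriv D.q R) R :=
        ((hD.contDiffOn_q.contDiffAt (isOpen_Ioo.mem_nhds (hsub hR))).differentiableAt
          (by simp)).hasDerivAt
      refine ((hasDerivAt_f (hq R hR)).comp R hqd).congr_deriv ?_
      have := hR.1.ne'
      rw [delta, beta]
      field_simp
  -- If q₀ = 1, monotonicity and q ≤ 1 force q ≡ 1. Both q'-parameters then vanish (with division by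
  -- zero giving 0), f(q) is constant, and nondegeneracy leaves only α₀ < 0.
  · have hq : ∀ R ∈ Ioo 0 D.R₁, D.q R = 1 := by
      intro R hR
      refine le_antisymm (hD.q_le_one hR) (le_of_tendsto htq ?_)
      filter_upwards [Ioo_mem_nhdsGT hR.1] with x hx
      exact hD.monotoneOn_q ⟨hx.1, hx.2.trans hR.2⟩ hR hx.2.le
    have hδ : ∀ R ∈ Ioo 0 D.R₁, D.delta R = 0 := by
      intro R hR; simp [delta, hq R hR]
    have hβ : β₀ = 0 := by
      refine tendsto_nhds_unique htβ (tendsto_const_nhds.congr' ?_)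
      filter_upwards [Ioo_mem_nhdsGT hR₁] with R hR
      have : D.q =ᶠ[𝓝 R] fun _ => 1 := by
        filter_upwards [isOpen_Ioo.mem_nhds hR] with x hx using hq x hx
      simp [beta, this.deriv_eq]
    have hsub : Ioo 0 (D.R₁ / 2) ⊆ Ioo 0 D.R₁ := Ioo_subset_Ioo_right (by linarith)
    have hf : ∀ R ∈ Ioo 0 (D.R₁ / 2), f (D.q R) = f 1 := fun R hR => by rw [hq R (hsub hR)]
    refine ⟨D.R₁ / 2, 0, by linarith, by linarith, ?_, ?_, ?_, contDiffOn_const.congr hf, ?_⟩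
    · have hα : α₀ < 0 := hnd.resolve_right (by simp [hβ])
      have : 0 < (-α₀) / (2 * c₀) * ((f 0 - f 1) / 1 ^ 3) :=
        mul_pos (div_pos (by linarith) (by positivity)) hg₀
      rw [hβ]
      linear_combination this
    · refine tendsto_const_nhds.congr' ?_
      filter_upwards [Ioo_mem_nhdsGT hR₁] with R hR using (hδ R hR).symm
    · exact continuousOn_const.congr fun R hR => hδ R (hsub hR)
    · intro R hR
      rw [hδ R (hsub hR), mul_zero, mul_zero]
      refine (hasDerivAt_const R (f 1)).congr_of_eventuallyEq ?_
      filter_upwards [isOpen_Ioo.mem_nhds hR] with x hx using hf x hx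

end DustData


namespace DustData

variable {D : DustData}

/-! ### The vector field as a smooth function of the parameters -/

/-- `y = √(r / R)`. -/
def yPar (z : (Fin 8 → ℝ) × (ℝ × ℝ)) : ℝ := z.1 0 * √(z.1 2) / z.2.1

/-- `√(1 + 2E/χ²)`. -/
def sigPar (z : (Fin 8 → ℝ) × (ℝ × ℝ)) : ℝ := √(1 + 2 * z.1 1 / z.2.1 ^ 2)

/-- `χ³ Λ / c^{3/2}`. -/
def rhoPar (z : (Fin 8 → ℝ) × (ℝ × ℝ)) : ℝ :=
  z.2.1 ^ 3 / z.1 2 ^ (3 / 2 : ℝ) * LamPar z.1 (yPar z)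

/-- Substituting c' = R·α moves every derivative of c into a positive power of R, so nothing is
singular at R = 0. The same is done for q' in the companion definitions. -/
def X₁Par (z : (Fin 8 → ℝ) × (ℝ × ℝ)) : ℝ :=
  z.2.1 / 2 *
    ((z.1 0 + rhoPar z * sigPar z)
        * (1 - √((1 + 2 * z.1 1 / z.2.1 ^ 2) / (1 + 2 * z.1 1)) * (z.2.1 / z.2.2))
      - 3 * z.1 0 - z.1 0 ^ 3 * z.1 5 / z.1 2)

def KPar (z : (Fin 8 → ℝ) × (ℝ × ℝ)) : ℝ :=
  1 / √(1 + 2 * z.1 1) *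
    (√(1 - z.1 3 ^ 2 * yPar z ^ 2) * (z.1 0 ^ 2 * z.1 5 / (2 * z.1 2))
      - z.1 3 ^ 2 * yPar z ^ 2 / √(1 - z.1 3 ^ 2 * yPar z ^ 2) * (z.1 0 ^ 2 * z.1 6 / z.1 3))

def X₂Par (z : (Fin 8 → ℝ) × (ℝ × ℝ)) : ℝ :=
  (1 - z.2.2 ^ 2) *
    (rhoPar z * ((3 + 4 * z.1 1 / z.2.1 ^ 2) / (2 * √(1 + 2 * z.1 1)) * z.2.1
            - sigPar z * (1 / z.2.2))
      - z.1 0 * KPar z * z.2.1 - z.1 0 / z.2.2)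

def XPar (z : (Fin 8 → ℝ) × (ℝ × ℝ)) : ℝ × ℝ := (X₁Par z, X₂Par z)

/-- The logarithmic derivative of `dτ/dλ` with respect to `s = 1/R`. -/
def ZPar (z : (Fin 8 → ℝ) × (ℝ × ℝ)) : ℝ :=
  1 / (√(1 + 2 * z.1 1) * z.2.2) *
    (z.2.2 ^ 2 * ((z.2.1 * (z.1 0 + rhoPar z * sigPar z) / 2
        - z.1 1 * (2 * z.1 6 * z.1 0 ^ 3 / z.1 3 + z.1 5 * z.1 0 ^ 3 / z.1 2 + 2 * z.1 0) / z.2.1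
        - z.2.1 / 2 * (z.1 0 ^ 3 * z.1 5 / z.1 2 + 3 * z.1 0)) / sigPar z)
      - (1 - z.2.2 ^ 2) * (z.1 0 + rhoPar z * sigPar z) * z.2.1 * sigPar z)

/-- The factor 1/√(1 - q²) inside h is absorbed into the eighth parameter. The identity survives q =
1, because both sides use 1/0 = 0. -/
lemma Lam_eq (y R : ℝ) : D.Lam y R = LamPar (D.params R) y := by
  simp only [Lam, LamPar, params, h, g, gPar, delta, alpha, beta, Matrix.cons_val]
  ring

lemma X_eq {R : ℝ} (hR : R ≠ 0) (x : ℝ × ℝ) : D.X R x = XPar (D.params R, x) := by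
  have h1 : R ^ 3 * D.alpha R / D.c R = R ^ 2 * (deriv D.c R / D.c R) := by
    rw [alpha]; field_simp
  have h2 : R ^ 2 * D.alpha R / (2 * D.c R) = R * deriv D.c R / (2 * D.c R) := by
    rw [alpha]; field_simp
  have h3 : R ^ 2 * D.beta R / D.q R = R * deriv D.q R / D.q R := by
    rw [beta]; field_simp
  have e : ∀ i, (D.params R) i = ![R, D.energy R, D.c R, D.q R, f (D.q R), D.alpha R, D.beta R,
    D.delta R] i := fun i => rfl
  refine Prod.ext ?_ ?_
  · simp only [X, X₁, XPar, X₁Par, rhoPar, sigPar, yPar, Lam_eq]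
    simp only [e, Matrix.cons_val, h1]
    ring
  · simp only [X, X₂, XPar, X₂Par, rhoPar, sigPar, yPar, Lam_eq, KPar, K]
    simp only [e, Matrix.cons_val, h2, h3]

/-- The non-degeneracy conditions under which the vector field is smooth. -/
structure Regular (z : (Fin 8 → ℝ) × (ℝ × ℝ)) : Prop where
  c_pos : 0 < z.1 2
  q_pos : 0 < z.1 3
  χ_pos : 0 < z.2.1
  p_pos : 0 < z.2.2
  E_pos : 0 < 1 + 2 * z.1 1
  sig_pos : 0 < 1 + 2 * z.1 1 / z.2.1 ^ 2
  y_lt : yPar z < 1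
  qy_mem : z.1 3 * yPar z ∈ Ioo (-1 : ℝ) 1

namespace Regular

variable {z : (Fin 8 → ℝ) × (ℝ × ℝ)}

lemma contDiffAt_apply (i : Fin 8) : ContDiffAt ℝ ∞ (fun z : (Fin 8 → ℝ) × (ℝ × ℝ) => z.1 i) z := by
  fun_prop

lemma contDiffAt_yPar (hz : Regular z) : ContDiffAt ℝ ∞ yPar z := by
  have h1 := hz.c_pos.ne'
  have h2 := hz.χ_pos.ne'
  unfold yPar
  fun_prop (disch := assumption)

lemma contDiffAt_sigPar (hz : Regular z) : ContDiffAt ℝ ∞ sigPar z := by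
  have h1 := hz.sig_pos.ne'
  have h2 := pow_ne_zero 2 hz.χ_pos.ne'
  unfold sigPar
  fun_prop (disch := assumption)

lemma one_sub_pos (hz : Regular z) : 0 < 1 - z.1 3 ^ 2 * yPar z ^ 2 := by
  have := one_sub_sq_pos hz.qy_mem
  rwa [mul_pow] at this

/-- Only f(q·y) is a genuine composition with f, and q·y stays away from ±1. The value f(q) enters
as a coordinate, so smoothness holds even where q = 1. -/
lemma contDiffAt_LamPar (hz : Regular z) :
    ContDiffAt ℝ ∞ (fun z : (Fin 8 → ℝ) × (ℝ × ℝ) => LamPar z.1 (yPar z)) z := by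
  have hy := hz.contDiffAt_yPar
  have h1 := hz.c_pos.ne'
  have h2 := hz.q_pos.ne'
  have h3 := hz.one_sub_pos.ne'
  have h4 := (Real.sqrt_pos.2 hz.one_sub_pos).ne'
  have hf : ContDiffAt ℝ ∞ (fun z : (Fin 8 → ℝ) × (ℝ × ℝ) => f (z.1 3 * yPar z)) z :=
    (contDiffAt_f hz.qy_mem).comp (f := fun z => z.1 3 * yPar z) z ((contDiffAt_apply 3).mul hy)
  have hg : ContDiffAt ℝ ∞ (fun z : (Fin 8 → ℝ) × (ℝ × ℝ) => gPar z.1 (yPar z)) z := by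
    unfold gPar
    exact (hf.sub (contDiffAt_apply 4)).div ((contDiffAt_apply 3).pow 3) (pow_ne_zero 3 h2)
  have h5 : 2 * z.1 2 ≠ 0 := by positivity
  unfold LamPar
  fun_prop (disch := assumption)

lemma contDiffAt_rhoPar (hz : Regular z) : ContDiffAt ℝ ∞ rhoPar z := by
  have h := hz.contDiffAt_LamPar
  have h1 := hz.c_pos.ne'
  have h2 : z.1 2 ^ (3 / 2 : ℝ) ≠ 0 := (Real.rpow_pos_of_pos hz.c_pos _).ne'
  have h3 : ContDiffAt ℝ ∞ (fun z : (Fin 8 → ℝ) × (ℝ × ℝ) => z.1 2 ^ (3 / 2 : ℝ)) z :=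
    (contDiffAt_apply 2).rpow_const_of_ne h1
  unfold rhoPar
  fun_prop (disch := assumption)

lemma contDiffAt_XPar (hz : Regular z) : ContDiffAt ℝ ∞ XPar z := by
  have hy := hz.contDiffAt_yPar
  have hs := hz.contDiffAt_sigPar
  have hr := hz.contDiffAt_rhoPar
  have h1 := hz.c_pos.ne'
  have h2 := hz.q_pos.ne'
  have h3 := hz.one_sub_pos.ne'
  have h4 := (Real.sqrt_pos.2 hz.one_sub_pos).ne'
  have h5 := hz.p_pos.ne'
  have h6 := hz.E_pos.ne'
  have h7 := (Real.sqrt_pos.2 hz.E_pos).ne'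
  have h8 : z.2.1 ^ 2 ≠ 0 := pow_ne_zero 2 hz.χ_pos.ne'
  have h9 := (div_pos hz.sig_pos hz.E_pos).ne'
  have h10 : 2 * z.1 2 ≠ 0 := by positivity
  have h11 : 2 * √(1 + 2 * z.1 1) ≠ 0 := by positivity
  refine ContDiffAt.prodMk ?_ ?_
  · unfold X₁Par
    fun_prop (disch := assumption)
  · unfold X₂Par KPar
    fun_prop (disch := assumption)

lemma continuousAt_ZPar (hz : Regular z) : ContinuousAt ZPar z := by
  have hs := hz.contDiffAt_sigPar.continuousAt
  have hr := hz.contDiffAt_rhoPar.continuousAt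
  have h1 := hz.c_pos.ne'
  have h2 := hz.q_pos.ne'
  have h5 := hz.χ_pos.ne'
  have h7 := mul_ne_zero (Real.sqrt_pos.2 hz.E_pos).ne' hz.p_pos.ne'
  have h8 : sigPar z ≠ 0 := (Real.sqrt_pos.2 hz.sig_pos).ne'
  unfold ZPar
  fun_prop (disch := assumption)

lemma eventually (hz : Regular z) : ∀ᶠ z' in 𝓝 z, Regular z' := by
  have hc : ∀ i, ContinuousAt (fun z : (Fin 8 → ℝ) × (ℝ × ℝ) => z.1 i) z := fun i =>
    (contDiffAt_apply i).continuousAt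
  have hy := hz.contDiffAt_yPar.continuousAt
  have hE : ContinuousAt (fun z : (Fin 8 → ℝ) × (ℝ × ℝ) => 1 + 2 * z.1 1) z := by fun_prop
  have hχ : ContinuousAt (fun z : (Fin 8 → ℝ) × (ℝ × ℝ) => 1 + 2 * z.1 1 / z.2.1 ^ 2) z := by
    have := pow_ne_zero 2 hz.χ_pos.ne'
    fun_prop (disch := assumption)
  filter_upwards [(hc 2).eventually_const_lt hz.c_pos, (hc 3).eventually_const_lt hz.q_pos,
    (by fun_prop : Continuous fun z : (Fin 8 → ℝ) × (ℝ × ℝ) => z.2.1).continuousAt.eventually_const_lt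
      hz.χ_pos,
    (by fun_prop : Continuous fun z : (Fin 8 → ℝ) × (ℝ × ℝ) => z.2.2).continuousAt.eventually_const_lt
      hz.p_pos, hE.eventually_const_lt hz.E_pos, hχ.eventually_const_lt hz.sig_pos,
    hy.eventually_lt_const hz.y_lt,
    ((hc 3).mul hy).eventually_mem (isOpen_Ioo.mem_nhds hz.qy_mem)] with z' h1 h2 h3 h4 h5 h6 h7 h8
  exact ⟨h1, h2, h3, h4, h5, h6, h7, h8⟩

end Regular

/-! ### The limit field at the centre and its linearization -/

namespace IsRegularCentre

variable {b : ℝ} {P₀ : Fin 8 → ℝ}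

lemma yPar_centre (hC : D.IsRegularCentre b P₀) (x : ℝ × ℝ) : yPar (P₀, x) = 0 := by
  simp [yPar, hC.zero₀]

lemma sigPar_centre (hC : D.IsRegularCentre b P₀) (x : ℝ × ℝ) : sigPar (P₀, x) = 1 := by
  simp [sigPar, hC.zero₁]

lemma regular_centre (hC : D.IsRegularCentre b P₀) : Regular (P₀, ((1 : ℝ), (1 : ℝ))) where
  c_pos := hC.pos₂
  q_pos := hC.pos₃
  χ_pos := one_pos
  p_pos := one_pos
  E_pos := by simp [hC.zero₁]
  sig_pos := by simp [hC.zero₁]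
  y_lt := by simp [hC.yPar_centre]
  qy_mem := by simp [hC.yPar_centre]

/-- The eigenvalues of the linearization at the centre are `-a` and `-a/2`. -/
def rate (P₀ : Fin 8 → ℝ) : ℝ := LamPar P₀ 0 / P₀ 2 ^ (3 / 2 : ℝ)

lemma rate_pos (hC : D.IsRegularCentre b P₀) : 0 < rate P₀ :=
  div_pos hC.Lam_pos (Real.rpow_pos_of_pos hC.pos₂ _)

lemma rhoPar_centre (hC : D.IsRegularCentre b P₀) (x : ℝ × ℝ) :
    rhoPar (P₀, x) = x.1 ^ 3 * rate P₀ := by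
  rw [rhoPar, hC.yPar_centre, rate]
  ring

lemma XPar_centre (hC : D.IsRegularCentre b P₀) (x : ℝ × ℝ) :
    XPar (P₀, x) = (x.1 / 2 * (x.1 ^ 3 * rate P₀ * (1 - x.1 / x.2)),
      (1 - x.2 ^ 2) * (x.1 ^ 3 * rate P₀ * (3 / 2 * x.1 - 1 / x.2))) := by
  simp [XPar, X₁Par, X₂Par, hC.rhoPar_centre, hC.sigPar_centre, hC.zero₀, hC.zero₁]

lemma ZPar_centre (hC : D.IsRegularCentre b P₀) : ZPar (P₀, ((1 : ℝ), (1 : ℝ))) = rate P₀ / 2 := by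
  simp [ZPar, hC.rhoPar_centre, hC.sigPar_centre, hC.zero₀, hC.zero₁]

/-- The derivative of the vector field at the centre in the directions of `(χ, Π)`. -/
lemma fderiv_XPar_centre (hC : D.IsRegularCentre b P₀) (v : ℝ × ℝ) :
    fderiv ℝ XPar (P₀, ((1 : ℝ), (1 : ℝ))) (0, v)
      = (rate P₀ / 2 * (v.2 - v.1), -(rate P₀ * v.2)) := by
  have hd : HasFDerivAt XPar (fderiv ℝ XPar (P₀, ((1 : ℝ), (1 : ℝ))))
      (P₀, ((1 : ℝ), (1 : ℝ))) :=
    (hC.regular_centre.contDiffAt_XPar.differentiableAt (by simp)).hasFDerivAt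
  have h1 : HasDerivAt (fun t : ℝ => 1 + t * v.1) v.1 0 := by
    simpa using ((hasDerivAt_id (0 : ℝ)).mul_const v.1).const_add 1
  have h2 : HasDerivAt (fun t : ℝ => 1 + t * v.2) v.2 0 := by
    simpa using ((hasDerivAt_id (0 : ℝ)).mul_const v.2).const_add 1
  -- Along this line the parameters are frozen at the centre, so the derivative can be read off the
  -- explicit limit field instead of the full one.
  have hline : HasDerivAt (fun t : ℝ => (P₀, (1 + t * v.1, 1 + t * v.2)))
      ((0 : Fin 8 → ℝ), v) 0 := (hasDerivAt_const _ _).prodMk (h1.prodMk h2)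
  have hcomp := HasFDerivAt.comp_hasDerivAt_of_eq (0 : ℝ) hd hline (by simp)
  refine hcomp.unique ?_
  have hfun : XPar ∘ (fun t : ℝ => (P₀, (1 + t * v.1, 1 + t * v.2))) = fun t =>
      ((1 + t * v.1) / 2 * ((1 + t * v.1) ^ 3 * rate P₀ * (1 - (1 + t * v.1) / (1 + t * v.2))),
      (1 - (1 + t * v.2) ^ 2) * ((1 + t * v.1) ^ 3 * rate P₀
        * (3 / 2 * (1 + t * v.1) - 1 / (1 + t * v.2)))) := by
    funext t
    simp [hC.XPar_centre]
  rw [hfun]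
  have hne : (1 : ℝ) + 0 * v.2 ≠ 0 := by simp
  refine HasDerivAt.prodMk ?_ ?_
  · refine ((h1.div_const 2).mul (((h1.pow 3).mul_const (rate P₀)).mul
      ((h1.div h2 hne).const_sub 1))).congr_deriv ?_
    simp
    ring
  · refine (((h2.pow 2).const_sub 1).mul (((h1.pow 3).mul_const (rate P₀)).mul
      ((h1.const_mul (3 / 2)).sub ((hasDerivAt_const (0 : ℝ) (1 : ℝ)).div h2 hne)))).congr_deriv ?_
    simp
    ring

lemma tendsto_params_inv (hC : D.IsRegularCentre b P₀) :
    Tendsto (fun s : ℝ => D.params (1 / s)) atTop (𝓝 P₀) := by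
  simp only [one_div]
  exact hC.tendsto.comp tendsto_inv_atTop_nhdsGT_zero

/-- X(s, x) is compared with X(s, (1, 1)) at the same s, so the parameters cancel in the difference
and only the phase-space part of the derivative matters. What is left over is the residual X(s, (1,
1)), which tends to 0. -/
theorem exists_isAttracting (hC : D.IsRegularCentre b P₀) :
    ∃ (S e α : ℝ) (K M : NNReal) (η : ℝ → ℝ), 1 / b < S ∧
      IsAttracting (fun s => D.X (1 / s)) S e α K M η ∧
      ∀ s, S ≤ s → ∀ x ∈ box e, Regular (D.params (1 / s), x) ∧
        0 < LamPar (D.params (1 / s)) (yPar (D.params (1 / s), x)) ∧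
        0 < ZPar (D.params (1 / s), x) := by
  set z₀ : (Fin 8 → ℝ) × (ℝ × ℝ) := (P₀, (1, 1)) with hz₀
  have hreg := hC.regular_centre
  have ha := hC.rate_pos
  set a := rate P₀ with ha_def
  -- Strict differentiability, jointly in parameters and phase point, gives a linear approximation
  -- with one constant for all parameters near the central ones. The threshold a/16 below fits the
  -- estimate at the end.
  have hsd : HasStrictFDerivAt XPar (fderiv ℝ XPar z₀) z₀ :=
    hreg.contDiffAt_XPar.hasStrictFDerivAt (by simp)
  have happrox : ∀ᶠ p : ((Fin 8 → ℝ) × (ℝ × ℝ)) × ((Fin 8 → ℝ) × (ℝ × ℝ)) in 𝓝 (z₀, z₀),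
      ‖XPar p.1 - XPar p.2 - fderiv ℝ XPar z₀ (p.1 - p.2)‖ ≤ a / 16 * ‖p.1 - p.2‖ :=
    hsd.isLittleO.def (by positivity)
  rw [nhds_prod_eq] at happrox
  obtain ⟨U, hU, hUapprox⟩ := eventually_prod_self_iff
    (r := fun p q => ‖XPar p - XPar q - fderiv ℝ XPar z₀ (p - q)‖ ≤ a / 16 * ‖p - q‖).1 happrox
  obtain ⟨K, U', hU', hlip⟩ := hsd.exists_lipschitzOnWith
  have hLam : ∀ᶠ z in 𝓝 z₀, 0 < LamPar z.1 (yPar z) := by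
    refine hreg.contDiffAt_LamPar.continuousAt.eventually_const_lt ?_
    simpa only [hC.yPar_centre] using hC.Lam_pos
  have hZ : ∀ᶠ z in 𝓝 z₀, 0 < ZPar z := by
    refine hreg.continuousAt_ZPar.eventually_const_lt ?_
    rw [hC.ZPar_centre]
    positivity
  have hbd : ∀ᶠ z in 𝓝 z₀, ‖XPar z‖ < 1 := by
    refine hreg.contDiffAt_XPar.continuousAt.norm.eventually_lt_const ?_
    simp [hC.XPar_centre]
  obtain ⟨e, he, hball⟩ := Metric.nhds_basis_closedBall.mem_iff.1
    (inter_mem (inter_mem hU hU') (hreg.eventually.and (hLam.and (hZ.and hbd))))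
  have hmem : ∀ P ∈ Metric.closedBall P₀ e, ∀ x ∈ box e, (P, x) ∈ Metric.closedBall z₀ e := by
    intro P hP x hx
    rw [hz₀, ← closedBall_prod_same, ← closedBall_prod_same, Real.closedBall_eq_Icc]
    exact ⟨hP, hx⟩
  have hself : ((1 : ℝ), (1 : ℝ)) ∈ box e := by simp [box, he.le]
  -- By Cauchy's bound componentwise, 2(u·g₁ + w·g₂) is at most 4e times the sup norm of the
  -- residual g, since |u|, |w| ≤ e.
  set η : ℝ → ℝ := fun s => 4 * e * ‖D.X (1 / s) (1, 1)‖ with hη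
  have hXt : Tendsto (fun s : ℝ => D.X (1 / s) (1, 1)) atTop (𝓝 0) := by
    have h1 := (hreg.contDiffAt_XPar.continuousAt.tendsto).comp
      (hC.tendsto_params_inv.prodMk_nhds (tendsto_const_nhds (x := ((1 : ℝ), (1 : ℝ)))))
    have h0 : XPar z₀ = 0 := by simp [hz₀, hC.XPar_centre]
    rw [← hz₀, h0] at h1
    refine h1.congr' ?_
    filter_upwards [eventually_gt_atTop (0 : ℝ)] with s hs
    rw [X_eq (by positivity)]
    rfl
  have hηt : Tendsto η atTop (𝓝 0) := by simpa [hη] using hXt.norm.const_mul (4 * e)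
  obtain ⟨S, hS⟩ := eventually_atTop.1 ((hC.tendsto_params_inv.eventually_mem
    (Metric.closedBall_mem_nhds P₀ he)).and ((hηt.eventually_le_const
      (show (0 : ℝ) < a / 4 * e ^ 2 / 2 by positivity)).and (eventually_gt_atTop (1 / b))))
  have hb : 0 < 1 / b := one_div_pos.2 hC.pos
  have hs0 : ∀ s, S ≤ s → 0 < s := fun s hs => hb.trans (hS s hs).2.2
  have hXeq : ∀ s, S ≤ s → ∀ x, D.X (1 / s) x = XPar (D.params (1 / s), x) := fun s hs x =>
    X_eq (one_div_pos.2 (hs0 s hs)).ne' x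
  have hin : ∀ s, S ≤ s → ∀ x ∈ box e, (D.params (1 / s), x) ∈ Metric.closedBall z₀ e :=
    fun s hs x hx => hmem _ (hS s hs).1 x hx
  refine ⟨S, e, a / 4, K, 1, η, (hS S le_rfl).2.2, ⟨he, by positivity, ?_, ?_, ?_, ?_,
    fun s hs => (hS s hs).2.1, hηt⟩, fun s hs x hx => ?_⟩
  · intro s hs
    refine LipschitzOnWith.of_dist_le_mul fun x hx y hy => ?_
    rw [hXeq s hs, hXeq s hs]
    have := hlip.dist_le_mul _ (hball (hin s hs x hx)).1.2 _ (hball (hin s hs y hy)).1.2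
    simpa [Prod.dist_eq] using this
  · intro s hs x hx
    rw [hXeq s hs]
    exact (hball (hin s hs x hx)).2.2.2.2.le
  · intro x hx s hs
    have hs' : 1 / s ∈ Ioo 0 b := ⟨one_div_pos.2 (hs0 s hs), by
      rw [one_div_lt (hs0 s hs) hC.pos]; exact (hS s hs).2.2⟩
    have h1 : ContinuousAt (fun s : ℝ => D.params (1 / s)) s :=
      ContinuousAt.comp (f := fun s : ℝ => 1 / s)
        (hC.continuousOn.continuousAt (isOpen_Ioo.mem_nhds hs'))
        (continuousAt_const.div continuousAt_id (hs0 s hs).ne')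
    have h2 : ContinuousAt (fun s : ℝ => XPar (D.params (1 / s), x)) s :=
      ContinuousAt.comp (f := fun s : ℝ => (D.params (1 / s), x))
        ((hball (hin s hs x hx)).2.1.contDiffAt_XPar.continuousAt)
        (h1.prodMk continuousAt_const)
    refine (h2.congr ?_).continuousWithinAt
    filter_upwards [lt_mem_nhds (hs0 s hs)] with t ht
    rw [X_eq (one_div_pos.2 ht).ne']
  · intro s hs x hx
    have h1 := hUapprox _ (hball (hin s hs x hx)).1.1 _ (hball (hin s hs _ hself)).1.1
    simp only [← hXeq s hs] at h1
    have hsub : (D.params (1 / s), x) - (D.params (1 / s), ((1 : ℝ), (1 : ℝ)))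
        = (0, (x.1 - 1, x.2 - 1)) := by simp [Prod.ext_iff]
    rw [hsub, hz₀, hC.fderiv_XPar_centre] at h1
    set u := x.1 - 1
    set w := x.2 - 1
    set v := D.X (1 / s) x
    set g₀ := D.X (1 / s) (1, 1) with hg₀
    have hm : ‖((0 : Fin 8 → ℝ), ((u, w) : ℝ × ℝ))‖ = max |u| |w| := by
      simp [Prod.norm_def]
    rw [hm] at h1
    have hu : |u| ≤ e := abs_le.2 ⟨by linarith [hx.1.1], by linarith [hx.1.2]⟩
    have hw : |w| ≤ e := abs_le.2 ⟨by linarith [hx.2.1], by linarith [hx.2.2]⟩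
    have e1 : |v.1 - g₀.1 - a / 2 * (w - u)| ≤ a / 16 * max |u| |w| := (norm_fst_le _).trans h1
    have e2 : |v.2 - g₀.2 + a * w| ≤ a / 16 * max |u| |w| := by
      have := (norm_snd_le _).trans h1
      simpa [sub_neg_eq_add] using this
    have hg1 : |g₀.1| ≤ ‖g₀‖ := norm_fst_le g₀
    have hg2 : |g₀.2| ≤ ‖g₀‖ := norm_snd_le g₀
    have t1 : u * (v.1 - g₀.1 - a / 2 * (w - u)) ≤ a / 16 * max |u| |w| * |u| := by
      have := (le_abs_self _).trans (abs_mul u (v.1 - g₀.1 - a / 2 * (w - u))).le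
      nlinarith [abs_nonneg u]
    have t2 : w * (v.2 - g₀.2 + a * w) ≤ a / 16 * max |u| |w| * |w| := by
      have := (le_abs_self _).trans (abs_mul w (v.2 - g₀.2 + a * w)).le
      nlinarith [abs_nonneg w]
    have t3 : u * g₀.1 ≤ e * ‖g₀‖ := by
      refine (le_abs_self _).trans ((abs_mul u g₀.1).le.trans ?_)
      exact mul_le_mul hu hg1 (abs_nonneg _) he.le
    have t4 : w * g₀.2 ≤ e * ‖g₀‖ := by
      refine (le_abs_self _).trans ((abs_mul w g₀.2).le.trans ?_)
      exact mul_le_mul hw hg2 (abs_nonneg _) he.le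
    have t5 : max |u| |w| * (|u| + |w|) ≤ 2 * (u ^ 2 + w ^ 2) := by
      rw [← sq_abs u, ← sq_abs w]
      rcases max_cases |u| |w| with ⟨h, -⟩ | ⟨h, -⟩ <;> rw [h] <;>
        nlinarith [sq_nonneg (|u| - |w|)]
    have t6 := mul_le_mul_of_nonneg_left t5 ha.le
    have t7 : a * (u * w) ≤ a * ((u ^ 2 + w ^ 2) / 2) :=
      mul_le_mul_of_nonneg_left (by nlinarith [sq_nonneg (u - w)]) ha.le
    have t8 : 0 ≤ a * w ^ 2 := by positivity
    simp only [hη, ← hg₀, sqDist]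
    -- The linear part contributes at most -(a/2)(u² + w²) after a·u·w ≤ (a/2)(u² + w²), and the
    -- remainder at most (a/4)(u² + w²). Decay at rate a/4 is left.
    change 2 * (u * v.1 + w * v.2) ≤ -(a / 4) * (u ^ 2 + w ^ 2) + 4 * e * ‖g₀‖
    nlinarith
  · have := (hball (hin s hs x hx)).2
    exact ⟨this.1, this.2.1, this.2.2.1⟩

end IsRegularCentre

end DustData


namespace DustData

variable {D : DustData}

/-! ### The areal radius -/

lemma arealRadius_infallTime {R x : ℝ} (hR : 0 < R) (hm : 0 < D.mass R) (hx : x ∈ Ioo 0 R) :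
    D.infallTime R x ∈ Ioo 0 (D.collapseTime R) ∧ D.arealRadius (D.infallTime R x) R = x := by
  have hA := infallTime_strictAntiOn hR hm
  have hxI := Ioo_subset_Icc_self hx
  have hmem : D.infallTime R x ∈ Ioo 0 (D.collapseTime R) := by
    refine ⟨?_, hA ⟨le_rfl, hR.le⟩ hxI hx.1⟩
    have := hA hxI ⟨hR.le, le_rfl⟩ hx.2
    rwa [show D.infallTime R R = 0 by simp [infallTime]] at this
  obtain ⟨h1, h2⟩ := arealRadius_spec hR hm hmem
  exact ⟨hmem, hA.injOn (Ioo_subset_Icc_self h1) hxI h2⟩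

/-- The infall time in closed form. -/
def infallFormula (D : DustData) (R x : ℝ) : ℝ :=
  (f (D.q R * √(x / R)) - f (D.q R)) / (D.q R ^ 3 * √(D.c R))

lemma sqrt_div_mem {R x : ℝ} (hx : x ∈ Ioo 0 R) : √(x / R) ∈ Ioo 0 1 := by
  have hR := hx.1.trans hx.2
  refine ⟨Real.sqrt_pos.2 (div_pos hx.1 hR), ?_⟩
  rw [Real.sqrt_lt' one_pos, one_pow, div_lt_one hR]
  exact hx.2

lemma q_mul_mem (hD : D.IsAdmissible) {R y : ℝ} (hR : R ∈ Ioo 0 D.R₁) (hy : y ∈ Ioo 0 1) :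
    D.q R * y ∈ Ioo (-1 : ℝ) 1 := by
  have h1 := hD.q_pos hR
  have h2 := hD.q_le_one hR
  exact ⟨by nlinarith [mul_pos h1 hy.1], by nlinarith [hy.1, hy.2]⟩

lemma hasDerivAt_sqrt_div {R x : ℝ} (hx : x ∈ Ioo 0 R) :
    HasDerivAt (fun x => √(x / R)) (1 / (2 * R * √(x / R))) x := by
  have hR := hx.1.trans hx.2
  refine (((hasDerivAt_id x).div_const R).sqrt (div_pos hx.1 hR).ne').congr_deriv ?_
  have := (sqrt_div_mem hx).1.ne'
  simp only [id]
  field_simp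

/-- Both sides vanish at x = R and have the same x-derivative on (0, R), because 2E + 2m/z = c(1 -
q²y²)(R/y)² with y = √(z/R). The mean value theorem needs only continuity at the endpoint, so x = 0
is included. -/
lemma infallTime_eq_formula (hD : D.IsAdmissible) {R x : ℝ} (hR : R ∈ Ioo 0 D.R₁)
    (hx : x ∈ Icc 0 R) : D.infallTime R x = D.infallFormula R x := by
  have hm := hD.mass_pos hR
  have hq := hD.q_pos hR
  have hc := hD.c_pos hR
  have hsc := Real.sqrt_pos.2 hc
  have hR0 := hR.1
  rcases hx.2.eq_or_lt with rfl | hlt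
  · simp [infallTime, infallFormula, hR0.ne']
  have hcont : ContinuousOn (fun x => D.infallTime R x - D.infallFormula R x) (Icc x R) := by
    refine ((infallTime_continuousOn hR.1 hm).mono (Icc_subset_Icc_left hx.1)).sub
      (Continuous.continuousOn ?_)
    have := continuous_f
    unfold infallFormula
    fun_prop
  obtain ⟨z, hz, hslope⟩ := exists_hasDerivAt_eq_slope (f' := fun _ => 0) _ hlt hcont fun z hz => by
    have hz' : z ∈ Ioo 0 R := ⟨hx.1.trans_lt hz.1, hz.2⟩
    have hy := sqrt_div_mem hz'
    have hqy := q_mul_mem hD hR hy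
    have h1 := ((hasDerivAt_f hqy).comp z ((hasDerivAt_sqrt_div hz').const_mul (D.q R))).sub_const
      (f (D.q R)) |>.div_const (D.q R ^ 3 * √(D.c R))
    refine ((infallTime_hasDerivAt hR.1 hm hz').sub h1).congr_deriv ?_
    set y := √(z / R) with hydef
    have hzy : z = R * y ^ 2 := by
      rw [hydef, Real.sq_sqrt (div_pos hz'.1 hR.1).le]
      field_simp
    have hs := one_sub_sq_pos hqy
    have hy0 := hy.1
    have hspeed : 2 * D.energy R + 2 * D.mass R / z
        = D.c R * (1 - (D.q R * y) ^ 2) * (R / y) ^ 2 := by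
      rw [hD.energy_eq hR, IsAdmissible.mass_eq hR.1.ne', hzy]
      field_simp
      ring
    have hs' := (Real.sqrt_pos.2 hs).ne'
    rw [hspeed, Real.sqrt_mul (by positivity), Real.sqrt_mul hc.le, Real.sqrt_sq (by positivity)]
    field_simp
    ring
  have h0 : D.infallTime R R - D.infallFormula R R = 0 := by
    simp [infallTime, infallFormula, hR0.ne']
  simp only [h0] at hslope
  have hne : R - x ≠ 0 := by linarith [hlt]
  rw [eq_comm, div_eq_zero_iff] at hslope
  rcases hslope with h | h
  · linarith
  · exact absurd h hne

/-- The collapse time in closed form. -/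
lemma collapseTime_eq (hD : D.IsAdmissible) {R : ℝ} (hR : R ∈ Ioo 0 D.R₁) :
    D.collapseTime R = (f 0 - f (D.q R)) / (D.q R ^ 3 * √(D.c R)) := by
  rw [collapseTime, infallTime_eq_formula hD hR ⟨le_rfl, hR.1.le⟩]
  simp [infallFormula]

lemma isInvertible_of_apply_ne_zero {A : ℝ →L[ℝ] ℝ} (hA : A 1 ≠ 0) : A.IsInvertible := by
  refine ⟨ContinuousLinearEquiv.unitsEquivAut ℝ (Units.mk0 (A 1) hA), ?_⟩
  ext
  simp

/-! ### Smoothness of the areal radius and the closed form of its derivative -/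

namespace IsRegularCentre

variable {b : ℝ} {P₀ : Fin 8 → ℝ}

lemma mem_cloud (hC : D.IsRegularCentre b P₀) {R : ℝ} (hR : R ∈ Ioo 0 b) : R ∈ Ioo 0 D.R₁ :=
  ⟨hR.1, hR.2.trans hC.lt⟩

lemma contDiffAt_infallFormula (hC : D.IsRegularCentre b P₀) (hD : D.IsAdmissible) {R x : ℝ}
    (hR : R ∈ Ioo 0 b) (hx : x ∈ Ioo 0 R) :
    ContDiffAt ℝ ∞ (fun p : ℝ × ℝ => D.infallFormula p.1 p.2) (R, x) := by
  have hR' := hC.mem_cloud hR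
  have hnhds := isOpen_Ioo.mem_nhds hR'
  have hq : ContDiffAt ℝ ∞ (fun p : ℝ × ℝ => D.q p.1) (R, x) :=
    ContDiffAt.comp (g := D.q) (R, x) (hD.contDiffOn_q.contDiffAt hnhds) contDiffAt_fst
  have hc : ContDiffAt ℝ ∞ (fun p : ℝ × ℝ => D.c p.1) (R, x) :=
    ContDiffAt.comp (g := D.c) (R, x) (hD.contDiffOn_c.contDiffAt hnhds) contDiffAt_fst
  have hfq : ContDiffAt ℝ ∞ (fun p : ℝ × ℝ => f (D.q p.1)) (R, x) :=
    ContDiffAt.comp (g := fun R => f (D.q R)) (R, x)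
      (hC.contDiffOn_f_q.contDiffAt (isOpen_Ioo.mem_nhds hR)) contDiffAt_fst
  have hy := sqrt_div_mem hx
  have hys : ContDiffAt ℝ ∞ (fun p : ℝ × ℝ => √(p.2 / p.1)) (R, x) :=
    (contDiffAt_snd.div contDiffAt_fst hR.1.ne').sqrt (div_pos hx.1 hR.1).ne'
  have hf : ContDiffAt ℝ ∞ (fun p : ℝ × ℝ => f (D.q p.1 * √(p.2 / p.1))) (R, x) :=
    ContDiffAt.comp (f := fun p : ℝ × ℝ => D.q p.1 * √(p.2 / p.1)) (R, x)
      (contDiffAt_f (q_mul_mem hD hR' hy)) (hq.mul hys)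
  have hq0 := hD.q_pos hR'
  have hc0 := hD.c_pos hR'
  refine (hf.sub hfq).div ((hq.pow 3).mul (hc.sqrt hc0.ne')) ?_
  have := Real.sqrt_pos.2 hc0
  positivity

/-- The areal radius is a smooth function. -/
lemma contDiffAt_arealRadius (hC : D.IsRegularCentre b P₀) (hD : D.IsAdmissible) {τ R : ℝ}
    (hR : R ∈ Ioo 0 b) (hτ : τ ∈ Ioo 0 (D.collapseTime R)) :
    ContDiffAt ℝ ∞ (fun p : ℝ × ℝ => D.arealRadius p.1 p.2) (τ, R) ∧
      ∀ᶠ p : ℝ × ℝ in 𝓝 (τ, R), p.2 ∈ Ioo 0 b ∧ p.1 ∈ Ioo 0 (D.collapseTime p.2) := by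
  have hR' := hC.mem_cloud hR
  have hm := hD.mass_pos hR'
  obtain ⟨hr, hrτ⟩ := arealRadius_spec hR.1 hm hτ
  set r := D.arealRadius τ R
  set F : (ℝ × ℝ) × ℝ → ℝ := fun u => D.infallFormula u.1.2 u.2 - u.1.1 with hF
  have hFsm : ContDiffAt ℝ ∞ F ((τ, R), r) := by
    refine ContDiffAt.sub ?_ (by fun_prop)
    exact ContDiffAt.comp (g := fun p : ℝ × ℝ => D.infallFormula p.1 p.2)
      (f := fun u : (ℝ × ℝ) × ℝ => (u.1.2, u.2)) ((τ, R), r)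
      (hC.contDiffAt_infallFormula hD hR hr) (by fun_prop)
  have hF0 : F ((τ, R), r) = 0 := by
    simp only [hF]
    rw [← infallTime_eq_formula hD hR' (Ioo_subset_Icc_self hr), hrτ, sub_self]
  -- The partial derivative in the radius is minus the reciprocal of the infall speed, hence
  -- nonzero.
  have hinv : (fderiv ℝ F ((τ, R), r) ∘L .inr ℝ (ℝ × ℝ) ℝ).IsInvertible := by
    refine isInvertible_of_apply_ne_zero ?_
    have h1 : HasDerivAt (fun x : ℝ => F ((τ, R), x)) (fderiv ℝ F ((τ, R), r) ((0, 0), 1)) r :=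
      HasFDerivAt.comp_hasDerivAt (f := fun x : ℝ => ((τ, R), x)) r
        (hFsm.differentiableAt (by simp)).hasFDerivAt
        ((hasDerivAt_const r (τ, R)).prodMk (hasDerivAt_id r))
    have h2 : HasDerivAt (fun x : ℝ => F ((τ, R), x))
        (-(1 / √(2 * D.energy R + 2 * D.mass R / r))) r := by
      refine ((infallTime_hasDerivAt hR.1 hm hr).sub_const τ).congr_of_eventuallyEq ?_
      filter_upwards [isOpen_Ioo.mem_nhds hr] with x hx
      simp only [hF]
      rw [infallTime_eq_formula hD hR' (Ioo_subset_Icc_self hx)]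
    have h3 := h1.unique h2
    have h4 := Real.sqrt_pos.2 (infall_speed_pos hR.1 hm hr)
    simp only [ContinuousLinearMap.comp_apply, ContinuousLinearMap.inr_apply]
    rw [show ((0 : ℝ × ℝ), (1 : ℝ)) = ((0, 0), 1) from rfl, h3]
    exact (neg_neg_of_pos (by positivity)).ne
  set ψ := hFsm.implicitFunction (by simp) hinv
  have hψ : ContDiffAt ℝ ∞ ψ (τ, R) := hFsm.contDiffAt_implicitFunction (by simp) hinv
  have hψ0 : ψ (τ, R) = r := hFsm.implicitFunction_apply_self (by simp) hinv
  have hsol : ∀ᶠ p in 𝓝 (τ, R), F (p, ψ p) = F ((τ, R), r) :=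
    hFsm.eventually_apply_implicitFunction (by simp) hinv
  have e1 : ∀ᶠ p : ℝ × ℝ in 𝓝 (τ, R), p.2 ∈ Ioo 0 b :=
    continuousAt_snd.eventually_mem (isOpen_Ioo.mem_nhds hR)
  have e2 : ∀ᶠ p : ℝ × ℝ in 𝓝 (τ, R), 0 < ψ p :=
    hψ.continuousAt.eventually_const_lt (by rw [hψ0]; exact hr.1)
  have e3 : ∀ᶠ p : ℝ × ℝ in 𝓝 (τ, R), 0 < p.2 - ψ p :=
    (continuousAt_snd.sub hψ.continuousAt).eventually_const_lt (by
      simp only [Pi.sub_apply, hψ0]; linarith [hr.2])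
  -- On each nearby shell the infall time is injective in the radius, which identifies the implicit
  -- function with the areal radius. It also shows that the event remains before the collapse time.
  have key : ∀ᶠ p : ℝ × ℝ in 𝓝 (τ, R), D.arealRadius p.1 p.2 = ψ p ∧
      p.2 ∈ Ioo 0 b ∧ p.1 ∈ Ioo 0 (D.collapseTime p.2) := by
    filter_upwards [hsol, e1, e2, e3] with p h0 h1 h2 h3
    have hp := hC.mem_cloud h1
    have hx : ψ p ∈ Ioo 0 p.2 := ⟨h2, by linarith⟩
    obtain ⟨h4, h5⟩ := arealRadius_infallTime h1.1 (hD.mass_pos hp) hx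
    rw [hF0] at h0
    simp only [hF] at h0
    rw [← infallTime_eq_formula hD hp (Ioo_subset_Icc_self hx), sub_eq_zero] at h0
    rw [h0] at h4 h5
    exact ⟨h5, h1, h4⟩
  exact ⟨hψ.congr_of_eventuallyEq (key.mono fun p hp => hp.1), key.mono fun p hp => hp.2⟩

/-- The partial derivative `r'` is a differentiable function of both variables, and its derivative
in `τ` is given by the differentiated free-fall equation. -/
lemma arealRadiusPrime_regular (hC : D.IsRegularCentre b P₀) (hD : D.IsAdmissible) {τ R : ℝ}
    (hR : R ∈ Ioo 0 b) (hτ : τ ∈ Ioo 0 (D.collapseTime R)) :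
    HasDerivAt (fun R' => D.arealRadius τ R') (D.arealRadiusPrime τ R) R ∧
    DifferentiableAt ℝ (fun p : ℝ × ℝ => D.arealRadius p.1 p.2) (τ, R) ∧
    DifferentiableAt ℝ (fun p : ℝ × ℝ => D.arealRadiusPrime p.1 p.2) (τ, R) ∧
    HasDerivAt (fun t => D.arealRadiusPrime t R)
      (-((deriv D.energy R + deriv D.mass R / D.arealRadius τ R
        - D.mass R * D.arealRadiusPrime τ R / D.arealRadius τ R ^ 2)
        / √(2 * D.energy R + 2 * D.mass R / D.arealRadius τ R))) τ := by
  have hR' := hC.mem_cloud hR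
  have hm := hD.mass_pos hR'
  obtain ⟨hsm, hev⟩ := hC.contDiffAt_arealRadius hD hR hτ
  set S : ℝ × ℝ → ℝ := fun p => D.arealRadius p.1 p.2 with hS
  have hd : ∀ᶠ p : ℝ × ℝ in 𝓝 (τ, R), HasFDerivAt S (fderiv ℝ S p) p := by
    filter_upwards [hev] with p hp
    exact ((hC.contDiffAt_arealRadius hD hp.1 hp.2).1.differentiableAt (by simp)).hasFDerivAt
  have hpart : ∀ p : ℝ × ℝ, HasFDerivAt S (fderiv ℝ S p) p →
      HasDerivAt (fun R' => D.arealRadius p.1 R') (fderiv ℝ S p (0, 1)) p.2 := fun p hp =>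
    HasFDerivAt.comp_hasDerivAt (f := fun x : ℝ => (p.1, x)) p.2 hp
      ((hasDerivAt_const p.2 p.1).prodMk (hasDerivAt_id p.2))
  have hpart' : ∀ p : ℝ × ℝ, HasFDerivAt S (fderiv ℝ S p) p →
      HasDerivAt (fun t => D.arealRadius t p.2) (fderiv ℝ S p (1, 0)) p.1 := fun p hp =>
    HasFDerivAt.comp_hasDerivAt (f := fun x : ℝ => (x, p.2)) p.1 hp
      ((hasDerivAt_id p.1).prodMk (hasDerivAt_const p.1 p.2))
  have hprime : ∀ᶠ p : ℝ × ℝ in 𝓝 (τ, R), D.arealRadiusPrime p.1 p.2 = fderiv ℝ S p (0, 1) := by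
    filter_upwards [hd] with p hp using (hpart p hp).deriv
  have hS'sm : ContDiffAt ℝ 1 (fderiv ℝ S) (τ, R) := hsm.fderiv_right (by norm_cast)
  have hS'd : HasFDerivAt (fderiv ℝ S) (fderiv ℝ (fderiv ℝ S) (τ, R)) (τ, R) :=
    (hS'sm.differentiableAt one_ne_zero).hasFDerivAt
  have hprime_d : HasFDerivAt (fun p : ℝ × ℝ => D.arealRadiusPrime p.1 p.2) _ (τ, R) :=
    (hS'd.clm_apply (hasFDerivAt_const ((0 : ℝ), (1 : ℝ)) (τ, R))).congr_of_eventuallyEq hprime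
  have hd0 := hd.self_of_nhds
  have hp0 : D.arealRadiusPrime τ R = fderiv ℝ S (τ, R) (0, 1) := hprime.self_of_nhds
  refine ⟨hp0 ▸ hpart _ hd0, hd0.differentiableAt, hprime_d.differentiableAt, ?_⟩
  have h1 : HasDerivAt (fun t => D.arealRadiusPrime t R)
      (fderiv ℝ (fderiv ℝ S) (τ, R) (1, 0) (0, 1)) τ := by
    have := HasFDerivAt.comp_hasDerivAt (f := fun x : ℝ => (x, R)) τ hprime_d
      ((hasDerivAt_id τ).prodMk (hasDerivAt_const τ R))
    refine this.congr_deriv ?_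
    simp
  -- Symmetry of second derivatives replaces the τ-derivative of r' by the R-derivative of ṙ, which
  -- the free-fall equation gives explicitly.
  have hsymm : fderiv ℝ (fderiv ℝ S) (τ, R) (1, 0) (0, 1)
      = fderiv ℝ (fderiv ℝ S) (τ, R) (0, 1) (1, 0) :=
    (hsm.of_le (m := 2) (by norm_cast)).isSymmSndFDerivAt (by simp) _ _
  rw [hsymm] at h1
  have h2 : HasDerivAt (fun R' => fderiv ℝ S (τ, R') (1, 0))
      (fderiv ℝ (fderiv ℝ S) (τ, R) (0, 1) (1, 0)) R := by
    have := HasFDerivAt.comp_hasDerivAt (f := fun x : ℝ => (τ, x)) R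
      (hS'd.clm_apply (hasFDerivAt_const ((1 : ℝ), (0 : ℝ)) (τ, R)))
      ((hasDerivAt_const R τ).prodMk (hasDerivAt_id R))
    refine this.congr_deriv ?_
    simp
  obtain ⟨hr, -⟩ := arealRadius_spec hR.1 hm hτ
  have hE : HasDerivAt D.energy (deriv D.energy R) R :=
    ((hD.contDiffOn_energy.contDiffAt (isOpen_Ioo.mem_nhds hR')).differentiableAt
      (by simp)).hasDerivAt
  have hM : HasDerivAt D.mass (deriv D.mass R) R := (hD.hasDerivAt_mass hR').differentiableAt.hasDerivAt
  have h3 : HasDerivAt (fun R' => -√(2 * D.energy R' + 2 * D.mass R' / D.arealRadius τ R'))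
      (fderiv ℝ (fderiv ℝ S) (τ, R) (0, 1) (1, 0)) R := by
    refine h2.congr_of_eventuallyEq ?_
    have hc : ContinuousAt (fun R' : ℝ => (τ, R')) R := by fun_prop
    filter_upwards [hc.eventually hd, hc.eventually hev] with R'' h4 h5
    exact ((hasDerivAt_arealRadius h5.1.1 (hD.mass_pos (hC.mem_cloud h5.1)) h5.2).unique
      (hpart' _ h4))
  have h4 := (((hE.const_mul 2).add ((hM.const_mul 2).div (hpart _ hd0) hr.1.ne')).sqrt
    (infall_speed_pos hR.1 hm hr).ne').neg
  have h5 := h3.unique h4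
  rw [h5] at h1
  refine h1.congr_deriv ?_
  rw [← hp0]
  have hs := (Real.sqrt_pos.2 (infall_speed_pos hR.1 hm hr)).ne'
  have hr0 := hr.1.ne'
  simp only [Pi.add_apply, Pi.div_apply]
  field_simp
  ring

/-- The closed form of `r'`. -/
lemma arealRadiusPrime_eq (hC : D.IsRegularCentre b P₀) (hD : D.IsAdmissible) {τ R y : ℝ}
    (hR : R ∈ Ioo 0 b) (hτ : τ ∈ Ioo 0 (D.collapseTime R)) (hy : 0 < y)
    (hry : D.arealRadius τ R = R * y ^ 2) :
    D.arealRadiusPrime τ R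
      = y ^ 2 + R ^ 2 * LamPar (D.params R) y * √(1 - D.q R ^ 2 * y ^ 2) / y := by
  have hR' := hC.mem_cloud hR
  have hm := hD.mass_pos hR'
  have hR0 := hR.1
  obtain ⟨hr, hrτ⟩ := arealRadius_spec hR.1 hm hτ
  obtain ⟨-, hev⟩ := hC.contDiffAt_arealRadius hD hR hτ
  have hrp := (hC.arealRadiusPrime_regular hD hR hτ).1
  set rp := D.arealRadiusPrime τ R
  have hyy : √(D.arealRadius τ R / R) = y := by
    rw [hry, mul_div_cancel_left₀ _ hR0.ne', Real.sqrt_sq hy.le]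
  have hqy := q_mul_mem hD hR' (sqrt_div_mem hr)
  have hq0 := hD.q_pos hR'
  have hc0 := hD.c_pos hR'
  have hsc := Real.sqrt_pos.2 hc0
  have hqd : HasDerivAt D.q (deriv D.q R) R :=
    ((hD.contDiffOn_q.contDiffAt (isOpen_Ioo.mem_nhds hR')).differentiableAt (by simp)).hasDerivAt
  have hcd := (hD.hasDerivAt_c hR').differentiableAt.hasDerivAt
  have hq' : deriv D.q R = R * D.beta R := by rw [beta]; field_simp
  have hc' : deriv D.c R = R * D.alpha R := by rw [alpha]; field_simp
  have hyd : HasDerivAt (fun R' => √(D.arealRadius τ R' / R')) ((rp - y ^ 2) / (2 * R * y)) R := by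
    refine ((hrp.div (hasDerivAt_id R) hR0.ne').sqrt (div_pos hr.1 hR0).ne').congr_deriv ?_
    simp only [Pi.div_apply, id, hyy]
    rw [hry]
    field_simp
  have hL := ((hasDerivAt_f hqy).comp R (hqd.mul hyd)).sub (hC.hasDerivAt_f_q R hR)
  have hRr := ((hqd.pow 3).mul (hcd.sqrt hc0.ne')).const_mul τ
  -- The relation f(q·y) - f(q) = τq³√c holds on a neighbourhood. Differentiating it in R at fixed τ
  -- gives a linear equation for r'.
  have hform : ∀ p : ℝ × ℝ, p.2 ∈ Ioo 0 b → p.1 ∈ Ioo 0 (D.collapseTime p.2) →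
      f (D.q p.2 * √(D.arealRadius p.1 p.2 / p.2)) - f (D.q p.2)
        = p.1 * (D.q p.2 ^ 3 * √(D.c p.2)) := by
    intro p h1 h2
    have hp := hC.mem_cloud h1
    obtain ⟨h3, h4⟩ := arealRadius_spec h1.1 (hD.mass_pos hp) h2
    rw [infallTime_eq_formula hD hp (Ioo_subset_Icc_self h3), infallFormula, div_eq_iff] at h4
    · exact h4
    · have := Real.sqrt_pos.2 (hD.c_pos hp)
      have := hD.q_pos hp
      positivity
  have hc : ContinuousAt (fun R' : ℝ => (τ, R')) R := by fun_prop
  have heq := hL.unique (hRr.congr_of_eventuallyEq (by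
    filter_upwards [hc.eventually hev] with R'' h5
    exact hform (τ, R'') h5.1 h5.2))
  have hτ' := hform (τ, R) hR hτ
  simp only [hyy] at hτ' heq
  -- The same relation says g(q, y) = τ√c, which eliminates τ in favour of Λ.
  have hg : gPar (D.params R) y = τ * √(D.c R) := by
    change (f (D.q R * y) - f (D.q R)) / D.q R ^ 3 = _
    rw [hτ']
    field_simp
  have hs := one_sub_sq_pos hqy
  rw [hyy] at hs
  have hs' := (Real.sqrt_pos.2 hs).ne'
  have hLam : LamPar (D.params R) y = 2 / D.q R * (D.delta R - D.beta R * (y ^ 3 /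
      √(1 - (D.q R * y) ^ 2)) - 3 / 2 * D.beta R * (τ * √(D.c R)))
      - D.alpha R / (2 * D.c R) * (τ * √(D.c R)) := by
    rw [LamPar, hg, mul_pow]
    rfl
  rw [hLam, ← mul_pow]
  simp only [hq', hc', Pi.pow_apply] at heq
  have hcs := Real.sq_sqrt hc0.le
  set s := √(1 - (D.q R * y) ^ 2)
  set k := √(D.c R)
  rw [← hcs]
  push_cast at heq
  field_simp at heq ⊢
  linear_combination (-1) * heq

end IsRegularCentre

end DustData


/-! ### Inverting the affine parameter -/

/-- If `k > 0` on `(0, B)` tends to `0` at `0`, the primitive of `k` can be inverted. -/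
theorem exists_inverse_primitive {k : ℝ → ℝ} {B R₀ : ℝ} (hR₀ : R₀ ∈ Ioo 0 B)
    (hk : ContinuousOn k (Ioo 0 B)) (hpos : ∀ R ∈ Ioo 0 B, 0 < k R)
    (hlim : Tendsto k (𝓝[>] 0) (𝓝 0)) :
    ∃ (b : ℝ) (ρ : ℝ → ℝ), ∃ l₀ ∈ Ioo 0 b, ρ l₀ = R₀ ∧
      (∀ l ∈ Ioo 0 b, ρ l ∈ Ioo 0 B ∧ HasDerivAt ρ (k (ρ l))⁻¹ l) ∧
      Tendsto ρ (𝓝[>] 0) (𝓝[>] 0) := by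
  -- No bound on k near B is available, so the primitive is cut off at some B₁ strictly between R₀
  -- and B. At 0 the function is extended by its limit 0.
  obtain ⟨B₁, hB₁, hB₁'⟩ := exists_between hR₀.2
  have hB₁0 := hR₀.1.trans hB₁
  set k' := Function.update k 0 0 with hk'
  have hk'_eq : ∀ R, 0 < R → k' R = k R := fun R hR => Function.update_of_ne hR.ne' _ _
  have hcont : ContinuousOn k' (Icc 0 B₁) := by
    intro R hR
    rcases hR.1.eq_or_lt with rfl | h
    · rw [continuousWithinAt_update_same]
      exact hlim.mono_left (nhdsWithin_mono 0 fun x hx => lt_of_le_of_ne hx.1.1 (Ne.symm hx.2))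
    · refine ContinuousAt.continuousWithinAt ?_
      refine (hk.continuousAt (isOpen_Ioo.mem_nhds ⟨h, hR.2.trans_lt hB₁'⟩)).congr ?_
      filter_upwards [lt_mem_nhds h] with x hx using (hk'_eq x hx).symm
  have hint : ∀ x ∈ Icc 0 B₁, ∀ y ∈ Icc 0 B₁,
      IntervalIntegrable k' MeasureTheory.volume x y := fun x hx y hy =>
    (hcont.mono (uIcc_subset_Icc hx hy)).intervalIntegrable
  have h00 : (0 : ℝ) ∈ Icc 0 B₁ := ⟨le_rfl, hB₁0.le⟩
  have h11 : B₁ ∈ Icc 0 B₁ := ⟨hB₁0.le, le_rfl⟩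
  set lam : ℝ → ℝ := fun R => ∫ x in (0 : ℝ)..R, k' x with hlam
  have hlam0 : lam 0 = 0 := by simp [hlam]
  have hmono : StrictMonoOn lam (Icc 0 B₁) := by
    intro x hx y hy hxy
    have h1 := intervalIntegral.integral_add_adjacent_intervals (hint 0 h00 x hx) (hint x hx y hy)
    have h2 : 0 < ∫ z in x..y, k' z :=
      intervalIntegral.intervalIntegral_pos_of_pos_on (hint x hx y hy) (fun z hz => by
        have hz0 := hx.1.trans_lt hz.1
        rw [hk'_eq z hz0]
        exact hpos z ⟨hz0, (hz.2.trans_le hy.2).trans hB₁'⟩) hxy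
    simp only [hlam]
    linarith
  have hlamc : ContinuousOn lam (Icc 0 B₁) := by
    have h := intervalIntegral.continuousOn_primitive_interval
      ((intervalIntegrable_iff' (by exact enorm_ne_top)).1 (hint 0 h00 B₁ h11))
    rwa [uIcc_of_le hB₁0.le] at h
  have hlamd : ∀ R ∈ Ioo 0 B₁, HasDerivAt lam (k R) R := by
    intro R hR
    have hc := (hcont.mono Ioo_subset_Icc_self)
    rw [← hk'_eq R hR.1]
    exact intervalIntegral.integral_hasDerivAt_right (hint 0 h00 R (Ioo_subset_Icc_self hR))
      (hc.stronglyMeasurableAtFilter isOpen_Ioo R hR) (hc.continuousAt (isOpen_Ioo.mem_nhds hR))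
  have hsurj : ∀ l, ∃ R, l ∈ Ioo 0 (lam B₁) → R ∈ Ioo 0 B₁ ∧ lam R = l := by
    intro l
    by_cases hl : l ∈ Ioo 0 (lam B₁)
    · have := intermediate_value_Ioo hB₁0.le hlamc
      rw [hlam0] at this
      obtain ⟨R, hR, h⟩ := this hl
      exact ⟨R, fun _ => ⟨hR, h⟩⟩
    · exact ⟨0, fun h => absurd h hl⟩
  choose ρ hρ using hsurj
  have hupper : ∀ l ∈ Ioo 0 (lam B₁), ∀ a, ρ l < a → ∃ l', l < l' ∧
      ∀ x ∈ Ioo 0 (lam B₁), x < l' → ρ x < a := by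
    intro l hl a ha
    obtain ⟨h1, h2⟩ := hρ l hl
    have hI : min a B₁ ∈ Icc 0 B₁ := ⟨le_min (h1.1.trans ha).le hB₁0.le, min_le_right _ _⟩
    refine ⟨lam (min a B₁), ?_, fun x hx hxl => ?_⟩
    · rw [← h2]
      exact hmono (Ioo_subset_Icc_self h1) hI (lt_min ha h1.2)
    · obtain ⟨h3, h4⟩ := hρ x hx
      rw [← h4] at hxl
      exact ((hmono.lt_iff_lt (Ioo_subset_Icc_self h3) hI).1 hxl).trans_le (min_le_left _ _)
  have hρc : ∀ l ∈ Ioo 0 (lam B₁), ContinuousAt ρ l := by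
    intro l hl
    obtain ⟨h1, h2⟩ := hρ l hl
    have hnhds : ∀ᶠ x in 𝓝 l, x ∈ Ioo 0 (lam B₁) := isOpen_Ioo.mem_nhds hl
    refine tendsto_order.2 ⟨fun a ha => ?_, fun a ha => ?_⟩
    · have hI : max a 0 ∈ Icc 0 B₁ := ⟨le_max_right _ _, (max_lt ha h1.1).le.trans h1.2.le⟩
      have hlt : lam (max a 0) < l := by
        rw [← h2]
        exact hmono hI (Ioo_subset_Icc_self h1) (max_lt ha h1.1)
      filter_upwards [hnhds, lt_mem_nhds hlt] with x hx hxl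
      obtain ⟨h3, h4⟩ := hρ x hx
      rw [← h4] at hxl
      exact (le_max_left a 0).trans_lt ((hmono.lt_iff_lt hI (Ioo_subset_Icc_self h3)).1 hxl)
    · obtain ⟨l', hl', h⟩ := hupper l hl a ha
      filter_upwards [hnhds, gt_mem_nhds hl'] with x hx hxl using h x hx hxl
  have hb : 0 < lam B₁ := hlam0 ▸ hmono h00 h11 hB₁0
  have hR₀' : R₀ ∈ Ioo 0 B₁ := ⟨hR₀.1, hB₁⟩
  have hl₀ : lam R₀ ∈ Ioo 0 (lam B₁) :=
    ⟨hlam0 ▸ hmono h00 (Ioo_subset_Icc_self hR₀') hR₀.1, hmono (Ioo_subset_Icc_self hR₀') h11 hB₁⟩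
  refine ⟨lam B₁, ρ, lam R₀, hl₀, ?_, fun l hl => ?_, ?_⟩
  · obtain ⟨h1, h2⟩ := hρ _ hl₀
    exact hmono.injOn (Ioo_subset_Icc_self h1) (Ioo_subset_Icc_self hR₀') h2
  · obtain ⟨h1, h2⟩ := hρ l hl
    refine ⟨⟨h1.1, h1.2.trans hB₁'⟩, ?_⟩
    refine (hlamd _ h1).of_local_left_inverse (hρc l hl)
      (hpos _ ⟨h1.1, h1.2.trans hB₁'⟩).ne' ?_
    filter_upwards [isOpen_Ioo.mem_nhds hl] with x hx using (hρ x hx).2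
  · have hIoo : ∀ᶠ x in 𝓝[>] (0 : ℝ), x ∈ Ioo 0 (lam B₁) := Ioo_mem_nhdsGT hb
    refine tendsto_nhdsWithin_iff.2 ⟨tendsto_order.2 ⟨fun a ha => ?_, fun a ha => ?_⟩, ?_⟩
    · filter_upwards [hIoo] with x hx using ha.trans (hρ x hx).1.1
    · have hI : min a B₁ ∈ Icc 0 B₁ := ⟨(lt_min ha hB₁0).le, min_le_right _ _⟩
      have hlt : 0 < lam (min a B₁) := hlam0 ▸ hmono h00 hI (lt_min ha hB₁0)
      filter_upwards [hIoo, Ioo_mem_nhdsGT hlt] with x hx hxl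
      obtain ⟨h3, h4⟩ := hρ x hx
      have hxl' := hxl.2
      rw [← h4] at hxl'
      exact ((hmono.lt_iff_lt (Ioo_subset_Icc_self h3) hI).1 hxl').trans_le (min_le_left _ _)
    · filter_upwards [hIoo] with x hx using (hρ x hx).1.1

namespace DustData

variable {D : DustData}

/-! ### Null geodesics parametrized by the shell label -/

/-- `√g_RR` at the event `(τ, R)`. -/
def radialScale (D : DustData) (τ R : ℝ) : ℝ :=
  D.arealRadiusPrime τ R / √(1 + 2 * D.energy R)

/-- An equatorial null geodesic described by the functions `τ(R)`, `Π(R)` and `om(R) = dτ/dλ`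
of the shell label; `rT` and `rpT` are the `τ`-derivatives of `r` and `r'` along the curve. -/
structure IsNullCurve (D : DustData) (B : ℝ) (tt p om rT rpT : ℝ → ℝ) : Prop where
  mem : ∀ R ∈ Ioo 0 B, R ∈ Ioo 0 D.R₁ ∧ tt R ∈ Ioo 0 (D.collapseTime R)
  radius_pos : ∀ R ∈ Ioo 0 B, 0 < D.arealRadius (tt R) R
  prime_pos : ∀ R ∈ Ioo 0 B, 0 < D.arealRadiusPrime (tt R) R
  energy_pos : ∀ R ∈ Ioo 0 B, 0 < 1 + 2 * D.energy R
  p_pos : ∀ R ∈ Ioo 0 B, 0 < p R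
  freq_pos : ∀ R ∈ Ioo 0 B, 0 < om R
  radius_diff : ∀ R ∈ Ioo 0 B,
    DifferentiableAt ℝ (fun u : ℝ × ℝ => D.arealRadius u.1 u.2) (tt R, R)
  prime_diff : ∀ R ∈ Ioo 0 B,
    DifferentiableAt ℝ (fun u : ℝ × ℝ => D.arealRadiusPrime u.1 u.2) (tt R, R)
  energy_diff : ∀ R ∈ Ioo 0 B, DifferentiableAt ℝ D.energy R
  radius_τ : ∀ R ∈ Ioo 0 B, HasDerivAt (fun t => D.arealRadius t R) (rT R) (tt R)
  prime_τ : ∀ R ∈ Ioo 0 B, HasDerivAt (fun t => D.arealRadiusPrime t R) (rpT R) (tt R)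
  deriv_tt : ∀ R ∈ Ioo 0 B, HasDerivAt tt (D.radialScale (tt R) R / p R) R
  deriv_p : ∀ R ∈ Ioo 0 B, HasDerivAt p ((1 - p R ^ 2) / p R
      * (D.arealRadiusPrime (tt R) R / D.arealRadius (tt R) R)
    + (1 - p R ^ 2) * (D.radialScale (tt R) R * rT R / D.arealRadius (tt R) R
      - rpT R / √(1 + 2 * D.energy R))) R
  deriv_freq : ∀ R ∈ Ioo 0 B, HasDerivAt om (-(om R / p R) * (p R ^ 2 * (rpT R / √(1 + 2 * D.energy R))
    + (1 - p R ^ 2) * (D.radialScale (tt R) R * rT R / D.arealRadius (tt R) R))) R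

/-- Total derivative of a function of two variables along a graph. -/
lemma hasDerivAt_along {F : ℝ × ℝ → ℝ} {tt : ℝ → ℝ} {R t' FT FR : ℝ}
    (hF : DifferentiableAt ℝ F (tt R, R)) (ht : HasDerivAt tt t' R)
    (hT : HasDerivAt (fun t => F (t, R)) FT (tt R)) (hR : HasDerivAt (fun x => F (tt R, x)) FR R) :
    HasDerivAt (fun x => F (tt x, x)) (FT * t' + FR) R := by
  have h1 := HasFDerivAt.comp_hasDerivAt (f := fun x : ℝ => (tt x, x)) R hF.hasFDerivAt
    (ht.prodMk (hasDerivAt_id R))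
  have h2 := HasFDerivAt.comp_hasDerivAt (f := fun x : ℝ => (x, R)) (tt R) hF.hasFDerivAt
    ((hasDerivAt_id (tt R)).prodMk (hasDerivAt_const (tt R) R))
  have h3 := HasFDerivAt.comp_hasDerivAt (f := fun x : ℝ => (tt R, x)) R hF.hasFDerivAt
    ((hasDerivAt_const R (tt R)).prodMk (hasDerivAt_id R))
  refine h1.congr_deriv ?_
  have e2 := hT.unique h2
  have e3 := hR.unique h3
  have : (t', (1 : ℝ)) = t' • ((1 : ℝ), (0 : ℝ)) + ((0 : ℝ), (1 : ℝ)) := by simp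
  rw [e2, e3, this, map_add, map_smul, smul_eq_mul, mul_comm]

lemma hasDerivAt_snd_of_differentiableAt {F : ℝ × ℝ → ℝ} {t R : ℝ}
    (hF : DifferentiableAt ℝ F (t, R)) :
    HasDerivAt (fun x => F (t, x)) (deriv (fun x => F (t, x)) R) R := by
  have := HasFDerivAt.comp_hasDerivAt (f := fun x : ℝ => (t, x)) R hF.hasFDerivAt
    ((hasDerivAt_const R t).prodMk (hasDerivAt_id R))
  exact this.differentiableAt.hasDerivAt

namespace IsNullCurve

variable {B : ℝ} {tt p om rT rpT : ℝ → ℝ}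

lemma scale_pos (hN : D.IsNullCurve B tt p om rT rpT) {R : ℝ} (hR : R ∈ Ioo 0 B) :
    0 < D.radialScale (tt R) R :=
  div_pos (hN.prime_pos R hR) (Real.sqrt_pos.2 (hN.energy_pos R hR))

lemma hasDerivAt_radius (hN : D.IsNullCurve B tt p om rT rpT) {R : ℝ} (hR : R ∈ Ioo 0 B) :
    HasDerivAt (fun R => D.arealRadius (tt R) R)
      (rT R * (D.radialScale (tt R) R / p R) + D.arealRadiusPrime (tt R) R) R :=
  hasDerivAt_along (F := fun u : ℝ × ℝ => D.arealRadius u.1 u.2) (hN.radius_diff R hR)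
    (hN.deriv_tt R hR) (hN.radius_τ R hR)
    (hasDerivAt_snd_of_differentiableAt (F := fun u : ℝ × ℝ => D.arealRadius u.1 u.2)
      (hN.radius_diff R hR))

/-- Conservation of angular momentum. -/
lemma exists_angularMomentum (hN : D.IsNullCurve B tt p om rT rpT) {R₀ : ℝ} (hR₀ : R₀ ∈ Ioo 0 B)
    (hp : p R₀ ≤ 1) : ∃ L : ℝ, (L = 0 ↔ p R₀ = 1) ∧ ∀ R ∈ Ioo 0 B,
      L ^ 2 = D.arealRadius (tt R) R ^ 2 * om R ^ 2 * (1 - p R ^ 2) := by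
  set Q : ℝ → ℝ := fun R => D.arealRadius (tt R) R ^ 2 * om R ^ 2 * (1 - p R ^ 2) with hQ
  have hder : ∀ R ∈ Ioo 0 B, HasDerivAt Q 0 R := by
    intro R hR
    have h1 := (((hN.hasDerivAt_radius hR).pow 2).mul ((hN.deriv_freq R hR).pow 2)).mul
      (((hN.deriv_p R hR).pow 2).const_sub 1)
    refine h1.congr_deriv ?_
    have e1 := (hN.radius_pos R hR).ne'
    have e2 := (hN.p_pos R hR).ne'
    simp only [Pi.pow_apply, Pi.mul_apply]
    field_simp
    ring
  have hconst : ∀ R ∈ Ioo 0 B, Q R = Q R₀ := by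
    intro R hR
    refine isOpen_Ioo.is_const_of_deriv_eq_zero isPreconnected_Ioo
      (fun R hR => (hder R hR).differentiableAt.differentiableWithinAt)
      (fun R hR => (hder R hR).deriv) hR hR₀
  have h0 := hN.p_pos R₀ hR₀
  -- The assumption Π ≤ 1 enters here. It makes the conserved quantity r²ω²(1 - Π²) nonnegative,
  -- hence the square of an angular momentum.
  have hnn : 0 ≤ 1 - p R₀ ^ 2 := by nlinarith
  have hQ0 : 0 ≤ Q R₀ := mul_nonneg (by positivity) hnn
  refine ⟨√(Q R₀), ?_, fun R hR => ?_⟩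
  · rw [Real.sqrt_eq_zero hQ0]
    have e1 := hN.radius_pos R₀ hR₀
    have e2 := hN.freq_pos R₀ hR₀
    have e3 : D.arealRadius (tt R₀) R₀ ^ 2 * om R₀ ^ 2 ≠ 0 := by positivity
    simp only [hQ, mul_eq_zero, e3, false_or]
    constructor
    · intro h; nlinarith
    · intro h; rw [h]; ring
  · rw [Real.sq_sqrt hQ0, ← hconst R hR]

end IsNullCurve

lemma metric_mulVec (x : Fin 4 → ℝ) (v : Fin 4 → ℝ) (i : Fin 4) :
    ∑ j, D.metric x i j * v j = D.metric x i i * v i := by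
  refine (Finset.sum_eq_single i (fun j _ hj => ?_) (by simp))
  rw [metric, Matrix.diagonal_apply_ne _ hj.symm, zero_mul]

lemma sum_lineDeriv_metric (x v e : Fin 4 → ℝ) :
    ∑ j, ∑ k, lineDeriv ℝ (fun x => D.metric x j k) x e * v j * v k
      = lineDeriv ℝ (fun x => D.arealRadiusPrime (x 0) (x 1) ^ 2 / (1 + 2 * D.energy (x 1))) x e
          * v 1 ^ 2
        + lineDeriv ℝ (fun x => D.arealRadius (x 0) (x 1) ^ 2) x e * v 2 ^ 2
        + lineDeriv ℝ (fun x => D.arealRadius (x 0) (x 1) ^ 2 * Real.sin (x 2) ^ 2) x e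
          * v 3 ^ 2 := by
  have h : ∀ j, ∑ k, lineDeriv ℝ (fun x => D.metric x j k) x e * v j * v k
      = lineDeriv ℝ (fun x => D.metric x j j) x e * v j ^ 2 := by
    intro j
    rw [Finset.sum_eq_single j (fun k _ hk => ?_) (by simp)]
    · ring
    · have : (fun x => D.metric x j k) = fun _ => (0 : ℝ) := by
        funext x
        rw [metric, Matrix.diagonal_apply_ne _ hk.symm]
      rw [this, lineDeriv]
      simp
  simp only [h, Fin.sum_univ_four]
  have h0 : lineDeriv ℝ (fun x => D.metric x 0 0) x e = 0 := by
    simp [metric, lineDeriv]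
  rw [h0]
  simp only [metric, Matrix.diagonal_apply_eq, Matrix.cons_val]
  ring

namespace IsNullCurve

variable {B : ℝ} {tt p om rT rpT : ℝ → ℝ}

/-- Diagonality reduces each geodesic equation to one momentum g_ii·γ̇ⁱ. The momenta are -ω,
√g_RR·Πω, 0 and L. The τ equation is the evolution law of ω, the R equation combines the laws of τ,
Π and ω, and nullity is L² = r²ω²(1 - Π²). -/
theorem isFutureNullGeodesic (hN : D.IsNullCurve B tt p om rT rpT) {b L : ℝ} {ρ φ : ℝ → ℝ}
    (hb : 0 < b)
    (hρ : ∀ l ∈ Ioo 0 b, ρ l ∈ Ioo 0 B ∧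
      HasDerivAt ρ (D.radialScale (tt (ρ l)) (ρ l) / (p (ρ l) * om (ρ l)))⁻¹ l)
    (hL : ∀ R ∈ Ioo 0 B, L ^ 2 = D.arealRadius (tt R) R ^ 2 * om R ^ 2 * (1 - p R ^ 2))
    (hφ : ∀ R ∈ Ioo 0 B, HasDerivAt φ (L / D.arealRadius (tt R) R ^ 2
      * (D.radialScale (tt R) R / (p R * om R))) R) :
    (∀ l ∈ Ioo 0 b, deriv (fun l => ![tt (ρ l), ρ l, Real.pi / 2, φ (ρ l)]) l
      = ![om (ρ l), p (ρ l) * om (ρ l) / D.radialScale (tt (ρ l)) (ρ l), 0,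
          L / D.arealRadius (tt (ρ l)) (ρ l) ^ 2]) ∧
    D.IsFutureNullGeodesic (fun l => ![tt (ρ l), ρ l, Real.pi / 2, φ (ρ l)]) b := by
  set γ : ℝ → Fin 4 → ℝ := fun l => ![tt (ρ l), ρ l, Real.pi / 2, φ (ρ l)] with hγ
  set v : ℝ → Fin 4 → ℝ := fun R => ![om R, p R * om R / D.radialScale (tt R) R, 0,
    L / D.arealRadius (tt R) R ^ 2] with hv
  have hvel : ∀ l ∈ Ioo 0 b, HasDerivAt γ (v (ρ l)) l := by
    intro l hl
    obtain ⟨hR, hd⟩ := hρ l hl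
    have e1 := (hN.scale_pos hR).ne'
    have e2 := (hN.p_pos _ hR).ne'
    have e3 := (hN.freq_pos _ hR).ne'
    refine hasDerivAt_pi.2 fun i => ?_
    fin_cases i
    · refine ((hN.deriv_tt _ hR).comp l hd).congr_deriv ?_
      simp only [hv, Fin.zero_eta, Matrix.cons_val_zero]
      field_simp
    · refine hd.congr_deriv ?_
      simp [hv]
    · exact hasDerivAt_const l (Real.pi / 2)
    · refine ((hφ _ hR).comp l hd).congr_deriv ?_
      simp only [hv, Fin.reduceFinMk, Matrix.cons_val]
      field_simp
  have hderiv : ∀ l ∈ Ioo 0 b, deriv γ l = v (ρ l) := fun l hl => (hvel l hl).deriv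
  refine ⟨hderiv, hb, fun l hl => ?_, fun l hl => (hvel l hl).differentiableAt, fun l hl i => ?_,
    fun l hl => ?_, fun l hl => ?_⟩
  · obtain ⟨hR, -⟩ := hρ l hl
    obtain ⟨h1, h2⟩ := hN.mem _ hR
    exact ⟨h1, h2, by simp only [hγ, Matrix.cons_val]; constructor <;> linarith [Real.pi_pos]⟩
  · obtain ⟨hR, hd⟩ := hρ l hl
    rw [sum_lineDeriv_metric, hderiv l hl]
    have hev : (fun l' => ∑ j, D.metric (γ l') i j * deriv γ l' j) =ᶠ[𝓝 l]
        fun l' => (fun R => D.metric ![tt R, R, Real.pi / 2, φ R] i i * v R i) (ρ l') := by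
      filter_upwards [isOpen_Ioo.mem_nhds hl] with l' hl'
      rw [metric_mulVec, hderiv l' hl']
    refine HasDerivAt.congr_of_eventuallyEq ?_ hev
    set R := ρ l with hRdef
    have hr := hN.radius_pos R hR
    have hrp := hN.prime_pos R hR
    have hE := hN.energy_pos R hR
    have hW := Real.sqrt_pos.2 hE
    have hp := hN.p_pos R hR
    have hom := hN.freq_pos R hR
    have ha := hN.scale_pos hR
    have hL2 := hL R hR
    have hWsq := Real.sq_sqrt hE.le
    set W := √(1 + 2 * D.energy R)
    have hscale : D.radialScale (tt R) R = D.arealRadiusPrime (tt R) R / W := rfl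
    have hrR := hasDerivAt_snd_of_differentiableAt (F := fun u : ℝ × ℝ => D.arealRadius u.1 u.2)
      (hN.radius_diff R hR)
    change HasDerivAt (fun x => D.arealRadius (tt R) x) (D.arealRadiusPrime (tt R) R) R at hrR
    have hrpR := hasDerivAt_snd_of_differentiableAt
      (F := fun u : ℝ × ℝ => D.arealRadiusPrime u.1 u.2) (hN.prime_diff R hR)
    simp only at hrpR
    set rpR := deriv (fun x => D.arealRadiusPrime (tt R) x) R
    have hER := (hN.energy_diff R hR).hasDerivAt
    set E' := deriv D.energy R
    have hrT := hN.radius_τ R hR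
    have hrpT := hN.prime_τ R hR
    have hγl : γ l = ![tt R, R, Real.pi / 2, φ R] := rfl
    rw [hγl]
    have hcomp : ∀ (g : ℝ → ℝ) (g' : ℝ), HasDerivAt g g' R →
        HasDerivAt (fun l' => g (ρ l')) (g' * (p R * om R / D.radialScale (tt R) R)) l := by
      intro g g' hg
      have := hg.comp l hd
      rwa [inv_div] at this
    fin_cases i
    · -- the `τ` equation
      have d1 : lineDeriv ℝ (fun x : Fin 4 → ℝ =>
          D.arealRadiusPrime (x 0) (x 1) ^ 2 / (1 + 2 * D.energy (x 1)))
          ![tt R, R, Real.pi / 2, φ R] (Pi.single 0 1)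
          = 2 * D.arealRadiusPrime (tt R) R * rpT R / (1 + 2 * D.energy R) := by
        have : HasDerivAt (fun t : ℝ => D.arealRadiusPrime (tt R + t) R ^ 2 / (1 + 2 * D.energy R))
            (2 * D.arealRadiusPrime (tt R) R * rpT R / (1 + 2 * D.energy R)) 0 := by
          have h := HasDerivAt.comp_const_add (tt R) (0 : ℝ) (by simpa using hrpT)
          refine ((h.pow 2).div_const _).congr_deriv ?_
          simp
        simpa [lineDeriv] using this.deriv
      have d3 : lineDeriv ℝ (fun x : Fin 4 → ℝ =>
          D.arealRadius (x 0) (x 1) ^ 2 * Real.sin (x 2) ^ 2)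
          ![tt R, R, Real.pi / 2, φ R] (Pi.single 0 1)
          = 2 * D.arealRadius (tt R) R * rT R := by
        have : HasDerivAt (fun t : ℝ => D.arealRadius (tt R + t) R ^ 2)
            (2 * D.arealRadius (tt R) R * rT R) 0 := by
          have h := HasDerivAt.comp_const_add (tt R) (0 : ℝ) (by simpa using hrT)
          refine (h.pow 2).congr_deriv ?_
          simp
        simpa [lineDeriv] using this.deriv
      have hg := (hN.deriv_freq R hR).neg
      have := hcomp _ _ hg
      refine (this.congr_of_eventuallyEq (Eventually.of_forall fun l' => ?_)).congr_deriv ?_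
      · simp [metric, hv]
      · simp only [Fin.zero_eta]
        rw [d1, d3]
        simp only [hv, Matrix.cons_val, hscale, ← hWsq, Real.sqrt_sq hW.le, div_pow, hL2]
        field_simp
        ring
    · -- the `R` equation
      have d1 : lineDeriv ℝ (fun x : Fin 4 → ℝ =>
          D.arealRadiusPrime (x 0) (x 1) ^ 2 / (1 + 2 * D.energy (x 1)))
          ![tt R, R, Real.pi / 2, φ R] (Pi.single 1 1)
          = (2 * D.arealRadiusPrime (tt R) R * rpR * (1 + 2 * D.energy R)
            - D.arealRadiusPrime (tt R) R ^ 2 * (2 * E')) / (1 + 2 * D.energy R) ^ 2 := by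
        have : HasDerivAt (fun t : ℝ =>
            D.arealRadiusPrime (tt R) (R + t) ^ 2 / (1 + 2 * D.energy (R + t)))
            ((2 * D.arealRadiusPrime (tt R) R * rpR * (1 + 2 * D.energy R)
            - D.arealRadiusPrime (tt R) R ^ 2 * (2 * E')) / (1 + 2 * D.energy R) ^ 2) 0 := by
          have h := HasDerivAt.comp_const_add R (0 : ℝ) (by simpa using hrpR)
          have h' := HasDerivAt.comp_const_add R (0 : ℝ) (by simpa using hER)
          refine ((h.pow 2).div ((h'.const_mul 2).const_add 1) (by simpa using hE.ne')).congr_deriv ?_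
          simp
        simpa [lineDeriv] using this.deriv
      have d3 : lineDeriv ℝ (fun x : Fin 4 → ℝ =>
          D.arealRadius (x 0) (x 1) ^ 2 * Real.sin (x 2) ^ 2)
          ![tt R, R, Real.pi / 2, φ R] (Pi.single 1 1)
          = 2 * D.arealRadius (tt R) R * D.arealRadiusPrime (tt R) R := by
        have : HasDerivAt (fun t : ℝ => D.arealRadius (tt R) (R + t) ^ 2)
            (2 * D.arealRadius (tt R) R * D.arealRadiusPrime (tt R) R) 0 := by
          have h := HasDerivAt.comp_const_add R (0 : ℝ) (by simpa using hrR)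
          refine (h.pow 2).congr_deriv ?_
          simp
        simpa [lineDeriv] using this.deriv
      -- The covariant radial momentum is √g_RR·Π·ω, so its derivative needs the total derivative of
      -- √g_RR along the curve.
      have hscale_d : HasDerivAt (fun R => D.radialScale (tt R) R) _ R :=
        (hasDerivAt_along (F := fun u : ℝ × ℝ => D.arealRadiusPrime u.1 u.2) (hN.prime_diff R hR)
          (hN.deriv_tt R hR) hrpT hrpR).div (((hER.const_mul 2).const_add 1).sqrt hE.ne') hW.ne'
      have hg := hscale_d.mul ((hN.deriv_p R hR).mul (hN.deriv_freq R hR))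
      have := hcomp _ _ hg
      refine (this.congr_of_eventuallyEq ?_).congr_deriv ?_
      · filter_upwards [isOpen_Ioo.mem_nhds hl] with l' hl'
        have hR' := (hρ l' hl').1
        have e1 := (hN.prime_pos _ hR').ne'
        have e2 := hN.energy_pos _ hR'
        have e3 := (Real.sqrt_pos.2 e2).ne'
        have e4 := Real.sq_sqrt e2.le
        simp only [metric, hv, Fin.mk_one, Matrix.diagonal_apply_eq, Matrix.cons_val, Pi.mul_apply]
        have hs : D.radialScale (tt (ρ l')) (ρ l') = D.arealRadiusPrime (tt (ρ l')) (ρ l')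
          / √(1 + 2 * D.energy (ρ l')) := rfl
        rw [hs]
        generalize √(1 + 2 * D.energy (ρ l')) = W' at *
        rw [← e4]
        field_simp
      · simp only [Fin.mk_one]
        rw [d1, d3]
        simp only [hv, Matrix.cons_val, hscale, Pi.mul_apply, ← hWsq, Real.sqrt_sq hW.le,
          div_pow, hL2]
        field_simp
        ring
    -- The `ϑ` equation: no force leaves the equatorial plane, because sin² is stationary at π/2.
    · have d1 : lineDeriv ℝ (fun x : Fin 4 → ℝ =>
          D.arealRadiusPrime (x 0) (x 1) ^ 2 / (1 + 2 * D.energy (x 1)))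
          ![tt R, R, Real.pi / 2, φ R] (Pi.single 2 1) = 0 := by
        simp [lineDeriv]
      have d3 : lineDeriv ℝ (fun x : Fin 4 → ℝ =>
          D.arealRadius (x 0) (x 1) ^ 2 * Real.sin (x 2) ^ 2)
          ![tt R, R, Real.pi / 2, φ R] (Pi.single 2 1) = 0 := by
        have : HasDerivAt (fun t : ℝ => D.arealRadius (tt R) R ^ 2 * Real.sin (Real.pi / 2 + t) ^ 2)
            0 0 := by
          have h := HasDerivAt.comp_const_add (Real.pi / 2) (0 : ℝ) (Real.hasDerivAt_sin _)
          refine ((h.pow 2).const_mul _).congr_deriv ?_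
          simp
        simpa [lineDeriv] using this.deriv
      refine ((hasDerivAt_const l (0 : ℝ)).congr_of_eventuallyEq
        (Eventually.of_forall fun l' => ?_)).congr_deriv ?_
      · simp [hv]
      · simp only [Fin.reduceFinMk]
        rw [d1, d3]
        simp [hv]
    -- The `φ` equation: the metric does not depend on φ, and the momentum is the constant L.
    · have d1 : lineDeriv ℝ (fun x : Fin 4 → ℝ =>
          D.arealRadiusPrime (x 0) (x 1) ^ 2 / (1 + 2 * D.energy (x 1)))
          ![tt R, R, Real.pi / 2, φ R] (Pi.single 3 1) = 0 := by
        simp [lineDeriv]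
      have d3 : lineDeriv ℝ (fun x : Fin 4 → ℝ =>
          D.arealRadius (x 0) (x 1) ^ 2 * Real.sin (x 2) ^ 2)
          ![tt R, R, Real.pi / 2, φ R] (Pi.single 3 1) = 0 := by
        simp [lineDeriv]
      refine ((hasDerivAt_const l L).congr_of_eventuallyEq ?_).congr_deriv ?_
      · filter_upwards [isOpen_Ioo.mem_nhds hl] with l' hl'
        have e1 := (hN.radius_pos _ (hρ l' hl').1).ne'
        simp only [metric, hv, Fin.reduceFinMk, Matrix.diagonal_apply_eq, Matrix.cons_val,
          Real.sin_pi_div_two]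
        field_simp
      · simp only [Fin.reduceFinMk]
        rw [d1, d3]
        simp [hv]
  · obtain ⟨hR, -⟩ := hρ l hl
    have hr := hN.radius_pos _ hR
    have hrp := hN.prime_pos _ hR
    have hE := hN.energy_pos _ hR
    have hW := Real.sqrt_pos.2 hE
    have hWsq := Real.sq_sqrt hE.le
    have hL2 := hL _ hR
    have hsum : ∀ i, ∑ j, D.metric (γ l) i j * deriv γ l i * deriv γ l j
        = D.metric (γ l) i i * v (ρ l) i ^ 2 := by
      intro i
      rw [hderiv l hl, Finset.sum_eq_single i (fun j _ hj => ?_) (by simp)]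
      · ring
      · rw [metric, Matrix.diagonal_apply_ne _ hj.symm]
        ring
    have hscale : D.radialScale (tt (ρ l)) (ρ l)
      = D.arealRadiusPrime (tt (ρ l)) (ρ l) / √(1 + 2 * D.energy (ρ l)) := rfl
    rw [Finset.sum_congr rfl fun i _ => hsum i]
    simp only [Fin.sum_univ_four, metric, Matrix.diagonal_apply_eq, hγ, hv, Matrix.cons_val,
      Real.sin_pi_div_two, div_pow, hL2, hscale]
    simp only [hWsq]
    field_simp
    ring
  · obtain ⟨hR, -⟩ := hρ l hl
    rw [hderiv l hl]
    exact hN.freq_pos _ hR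

end IsNullCurve
end DustData


namespace DustData

variable {D : DustData}

/-! ### From the phase space to the spacetime -/

/-- The areal radius of the event on the shell `R` with coordinates `x = (χ, Π)`. -/
def radiusOf (D : DustData) (R : ℝ) (x : ℝ × ℝ) : ℝ := R * yPar (D.params R, x) ^ 2

/-- The proper time of the event on the shell `R` with coordinates `x = (χ, Π)`. -/
def timeOf (D : DustData) (R : ℝ) (x : ℝ × ℝ) : ℝ := D.infallTime R (D.radiusOf R x)

/-- `∂r'/∂τ` at the event on the shell `R` with coordinates `x = (χ, Π)`. -/
def primeRateOf (D : DustData) (R : ℝ) (x : ℝ × ℝ) : ℝ :=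
  -((deriv D.energy R + deriv D.mass R / D.radiusOf R x
        - D.mass R * D.arealRadiusPrime (D.timeOf R x) R / D.radiusOf R x ^ 2)
        / (x.1 * sigPar (D.params R, x)))

lemma rpow_three_halves {c : ℝ} (hc : 0 ≤ c) : c ^ (3 / 2 : ℝ) = √c ^ 3 := by
  rw [Real.sqrt_eq_rpow, ← Real.rpow_natCast, ← Real.rpow_mul hc]
  norm_num

namespace IsRegularCentre

variable {b : ℝ} {P₀ : Fin 8 → ℝ} {R : ℝ} {x : ℝ × ℝ}

lemma yPar_mem (hR : 0 < R) (hz : Regular (D.params R, x)) :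
    yPar (D.params R, x) ∈ Ioo 0 1 := by
  refine ⟨?_, hz.y_lt⟩
  have h1 : 0 < D.c R := hz.c_pos
  have h2 : 0 < x.1 := hz.χ_pos
  have h3 := Real.sqrt_pos.2 h1
  change 0 < R * √(D.c R) / x.1
  positivity

lemma radiusOf_mem (hR : 0 < R) (hz : Regular (D.params R, x)) : D.radiusOf R x ∈ Ioo 0 R := by
  obtain ⟨h1, h2⟩ := yPar_mem hR hz
  unfold radiusOf
  exact ⟨by positivity, by nlinarith [mul_pos hR h1]⟩

lemma sqrt_radiusOf (hR : 0 < R) (hz : Regular (D.params R, x)) :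
    √(D.radiusOf R x / R) = yPar (D.params R, x) := by
  rw [radiusOf, mul_div_cancel_left₀ _ hR.ne', Real.sqrt_sq (yPar_mem hR hz).1.le]

lemma c_eq (hR : 0 < R) (hz : Regular (D.params R, x)) :
    D.c R = D.radiusOf R x * x.1 ^ 2 / R ^ 3 := by
  have h1 : 0 < D.c R := hz.c_pos
  have h2 : 0 < x.1 := hz.χ_pos
  have h3 := Real.sq_sqrt h1.le
  have : yPar (D.params R, x) = R * √(D.c R) / x.1 := rfl
  rw [radiusOf, this, div_pow, mul_pow, h3]
  field_simp

lemma mass_eq_radiusOf (hR : 0 < R) (hz : Regular (D.params R, x)) :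
    D.mass R = D.radiusOf R x * x.1 ^ 2 / 2 := by
  rw [IsAdmissible.mass_eq hR.ne', c_eq hR hz]
  field_simp

lemma sigPar_pos (hz : Regular (D.params R, x)) : 0 < sigPar (D.params R, x) :=
  Real.sqrt_pos.2 hz.sig_pos

lemma energy_eq_sigPar (hz : Regular (D.params R, x)) :
    D.energy R = x.1 ^ 2 * (sigPar (D.params R, x) ^ 2 - 1) / 2 := by
  have h : sigPar (D.params R, x) ^ 2 = 1 + 2 * D.energy R / x.1 ^ 2 := Real.sq_sqrt hz.sig_pos.le
  have h2 : 0 < x.1 := hz.χ_pos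
  rw [h]
  field_simp
  ring

/-- Since 2E = -q²cR² and cR² = χ²y², the product q²y² equals -2E/χ². Hence √(1 - q²y²) and √(1 +
2E/χ²) are the same quantity σ. -/
lemma q_y_eq (hC : D.IsRegularCentre b P₀) (hD : D.IsAdmissible) (hR : R ∈ Ioo 0 b)
    (hz : Regular (D.params R, x)) :
    D.q R ^ 2 * yPar (D.params R, x) ^ 2 = 1 - sigPar (D.params R, x) ^ 2 := by
  have h1 := hD.energy_eq (hC.mem_cloud hR)
  have h2 : 0 < x.1 := hz.χ_pos
  have h3 := hR.1
  have h4 : yPar (D.params R, x) ^ 2 = D.radiusOf R x / R := by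
    rw [radiusOf]; field_simp
  rw [energy_eq_sigPar hz, c_eq hR.1 hz] at h1
  rw [h4]
  field_simp at h1 ⊢
  linear_combination h1

/-- This is ṙ = -χσ: with 2m/r = χ² the radicand is χ² + 2E = χ²σ². -/
lemma speed_eq (hR : 0 < R) (hz : Regular (D.params R, x)) :
    √(2 * D.energy R + 2 * D.mass R / D.radiusOf R x) = x.1 * sigPar (D.params R, x) := by
  have h2 : 0 < x.1 := hz.χ_pos
  have h3 := sigPar_pos hz
  have h4 := (radiusOf_mem hR hz).1
  rw [← Real.sqrt_sq (mul_pos h2 h3).le, energy_eq_sigPar hz, mass_eq_radiusOf hR hz]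
  congr 1
  field_simp
  ring

lemma timeOf_mem (hC : D.IsRegularCentre b P₀) (hD : D.IsAdmissible) (hR : R ∈ Ioo 0 b)
    (hz : Regular (D.params R, x)) : D.timeOf R x ∈ Ioo 0 (D.collapseTime R) ∧
      D.arealRadius (D.timeOf R x) R = D.radiusOf R x :=
  arealRadius_infallTime hR.1 (hD.mass_pos (hC.mem_cloud hR)) (radiusOf_mem hR.1 hz)

/-- The bracket R + χ³c^{-3/2}σΛ that occurs in X₁ is R²r'/r. This is the bridge between Λ and the
geometry. -/
lemma prime_eq (hC : D.IsRegularCentre b P₀) (hD : D.IsAdmissible) (hR : R ∈ Ioo 0 b)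
    (hz : Regular (D.params R, x)) : D.arealRadiusPrime (D.timeOf R x) R
      = D.radiusOf R x / R ^ 2 * (R + rhoPar (D.params R, x) * sigPar (D.params R, x)) := by
  obtain ⟨h1, h2⟩ := hC.timeOf_mem hD hR hz
  have hy := (yPar_mem hR.1 hz).1
  rw [hC.arealRadiusPrime_eq hD hR h1 hy h2, q_y_eq hC hD hR hz, sub_sub_cancel,
    Real.sqrt_sq (sigPar_pos hz).le, radiusOf]
  have hc : 0 < D.c R := hz.c_pos
  have hk := Real.sqrt_pos.2 hc
  have hχ : 0 < x.1 := hz.χ_pos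
  have hR0 := hR.1
  have hyy : yPar (D.params R, x) = R * √(D.c R) / x.1 := rfl
  have hrho : rhoPar (D.params R, x)
      = x.1 ^ 3 / √(D.c R) ^ 3 * LamPar (D.params R) (yPar (D.params R, x)) := by
    rw [← rpow_three_halves hc.le]; rfl
  rw [hrho]
  generalize LamPar (D.params R) (yPar (D.params R, x)) = Λ
  rw [hyy]
  field_simp

/-- Logarithmic derivatives of E = -q²cR²/2 and m = cR³/2. -/
lemma deriv_energy_eq (hC : D.IsRegularCentre b P₀) (hD : D.IsAdmissible) (hR : R ∈ Ioo 0 b) :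
    deriv D.energy R = D.energy R * (2 * (R * D.beta R) / D.q R + R * D.alpha R / D.c R + 2 / R) ∧
    deriv D.mass R = D.mass R * (R * D.alpha R / D.c R + 3 / R) := by
  have hR' := hC.mem_cloud hR
  have hR0 := hR.1
  have hq0 := hD.q_pos hR'
  have hc0 := hD.c_pos hR'
  have hqd : HasDerivAt D.q (deriv D.q R) R :=
    ((hD.contDiffOn_q.contDiffAt (isOpen_Ioo.mem_nhds hR')).differentiableAt (by simp)).hasDerivAt
  have hcd := (hD.hasDerivAt_c hR').differentiableAt.hasDerivAt
  have hq' : deriv D.q R = R * D.beta R := by rw [beta]; field_simp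
  have hc' : deriv D.c R = R * D.alpha R := by rw [alpha]; field_simp
  constructor
  · have h1 := (((((hqd.pow 2).mul hcd).mul (hasDerivAt_pow 2 R)).div_const 2).neg).congr_of_eventuallyEq
      (f₁ := D.energy) (by
        filter_upwards [isOpen_Ioo.mem_nhds hR'] with t ht using hD.energy_eq ht)
    rw [h1.deriv, hD.energy_eq hR', hq', hc']
    simp only [Pi.mul_apply, Pi.pow_apply]
    push_cast
    field_simp
  · have h1 := ((hcd.mul (hasDerivAt_pow 3 R)).div_const 2).congr_of_eventuallyEq
      (f₁ := D.mass) (by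
        filter_upwards [isOpen_Ioo.mem_nhds hR'] with t ht using IsAdmissible.mass_eq ht.1.ne')
    rw [h1.deriv, IsAdmissible.mass_eq hR0.ne', hc']
    push_cast
    field_simp

/-- The vector field, expressed through the geometry. -/
lemma X₁Par_eq (hC : D.IsRegularCentre b P₀) (hD : D.IsAdmissible) (hR : R ∈ Ioo 0 b)
    (hz : Regular (D.params R, x)) : X₁Par (D.params R, x)
      = x.1 / 2 * (R ^ 2 / D.radiusOf R x * D.arealRadiusPrime (D.timeOf R x) R
        * (1 - x.1 * sigPar (D.params R, x) / (√(1 + 2 * D.energy R) * x.2))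
        - 3 * R - R ^ 3 * D.alpha R / D.c R) := by
  have hr := (radiusOf_mem hR.1 hz).1
  have hR0 := hR.1
  have hE : 0 < 1 + 2 * D.energy R := hz.E_pos
  have hW := Real.sqrt_pos.2 hE
  have hχ : 0 < x.1 := hz.χ_pos
  have hp : 0 < x.2 := hz.p_pos
  have hs : √((1 + 2 * D.energy R / x.1 ^ 2) / (1 + 2 * D.energy R))
      = sigPar (D.params R, x) / √(1 + 2 * D.energy R) := Real.sqrt_div hz.sig_pos.le _
  rw [hC.prime_eq hD hR hz]
  change x.1 / 2 * ((R + rhoPar (D.params R, x) * sigPar (D.params R, x))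
    * (1 - √((1 + 2 * D.energy R / x.1 ^ 2) / (1 + 2 * D.energy R)) * (x.1 / x.2)) - 3 * R
      - R ^ 3 * D.alpha R / D.c R) = _
  rw [hs]
  have hc : 0 < D.c R := hz.c_pos
  field_simp

/-- The large bracket is dΠ/dR from the null geodesic equations, and -R² is the factor dR/ds. Once
E, m and their derivatives are written through χ, σ and r, the K term is what remains of ∂r'/∂τ, and
the claim is a rational identity. -/
lemma X₂Par_eq (hC : D.IsRegularCentre b P₀) (hD : D.IsAdmissible) (hR : R ∈ Ioo 0 b)
    (hz : Regular (D.params R, x)) : X₂Par (D.params R, x)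
      = -R ^ 2 * ((1 - x.2 ^ 2) / x.2
          * (D.arealRadiusPrime (D.timeOf R x) R / D.radiusOf R x)
        + (1 - x.2 ^ 2) * (D.radialScale (D.timeOf R x) R * (-(x.1 * sigPar (D.params R, x)))
          / D.radiusOf R x - D.primeRateOf R x / √(1 + 2 * D.energy R))) := by
  have hr := (radiusOf_mem hR.1 hz).1
  have hR0 := hR.1
  have hE : 0 < 1 + 2 * D.energy R := hz.E_pos
  have hW := Real.sqrt_pos.2 hE
  have hχ : 0 < x.1 := hz.χ_pos
  have hp : 0 < x.2 := hz.p_pos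
  have hc : 0 < D.c R := hz.c_pos
  have hq : 0 < D.q R := hz.q_pos
  have hσ := sigPar_pos hz
  have hK : KPar (D.params R, x) = 1 / √(1 + 2 * D.energy R)
      * (sigPar (D.params R, x) * (R ^ 2 * D.alpha R / (2 * D.c R))
      - (1 - sigPar (D.params R, x) ^ 2) / sigPar (D.params R, x) * (R ^ 2 * D.beta R / D.q R)) := by
    change 1 / √(1 + 2 * D.energy R)
      * (√(1 - D.q R ^ 2 * yPar (D.params R, x) ^ 2) * (R ^ 2 * D.alpha R / (2 * D.c R))
      - D.q R ^ 2 * yPar (D.params R, x) ^ 2 / √(1 - D.q R ^ 2 * yPar (D.params R, x) ^ 2)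
        * (R ^ 2 * D.beta R / D.q R)) = _
    rw [q_y_eq hC hD hR hz, sub_sub_cancel, Real.sqrt_sq hσ.le]
  obtain ⟨hE', hM'⟩ := hC.deriv_energy_eq hD hR
  rw [radialScale, primeRateOf, hC.prime_eq hD hR hz, hE', hM']
  change (1 - x.2 ^ 2) * (rhoPar (D.params R, x) * ((3 + 4 * D.energy R / x.1 ^ 2)
    / (2 * √(1 + 2 * D.energy R)) * x.1 - sigPar (D.params R, x) * (1 / x.2))
      - R * KPar (D.params R, x) * x.1 - R / x.2) = _
  rw [hK]
  have e1 := energy_eq_sigPar hz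
  have e2 := mass_eq_radiusOf hR.1 hz
  generalize √(1 + 2 * D.energy R) = W at *
  rw [e1, e2]
  generalize sigPar (D.params R, x) = σ at *
  generalize rhoPar (D.params R, x) = ρ at *
  generalize D.radiusOf R x = r at *
  field_simp
  ring

/-- This matches d(log ω)/ds with the τ-component of the geodesic equation, by the same reduction to
a rational identity. -/
lemma ZPar_eq (hC : D.IsRegularCentre b P₀) (hD : D.IsAdmissible) (hR : R ∈ Ioo 0 b)
    (hz : Regular (D.params R, x)) : ZPar (D.params R, x)
      = R ^ 2 / x.2 * (x.2 ^ 2 * (D.primeRateOf R x / √(1 + 2 * D.energy R))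
        + (1 - x.2 ^ 2) * (D.radialScale (D.timeOf R x) R * (-(x.1 * sigPar (D.params R, x)))
          / D.radiusOf R x)) := by
  have hr := (radiusOf_mem hR.1 hz).1
  have hR0 := hR.1
  have hE : 0 < 1 + 2 * D.energy R := hz.E_pos
  have hW := Real.sqrt_pos.2 hE
  have hχ : 0 < x.1 := hz.χ_pos
  have hp : 0 < x.2 := hz.p_pos
  have hc : 0 < D.c R := hz.c_pos
  have hq : 0 < D.q R := hz.q_pos
  have hσ := sigPar_pos hz
  obtain ⟨hE', hM'⟩ := hC.deriv_energy_eq hD hR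
  rw [radialScale, primeRateOf, hC.prime_eq hD hR hz, hE', hM']
  change 1 / (√(1 + 2 * D.energy R) * x.2) *
    (x.2 ^ 2 * ((x.1 * (R + rhoPar (D.params R, x) * sigPar (D.params R, x)) / 2
        - D.energy R * (2 * D.beta R * R ^ 3 / D.q R + D.alpha R * R ^ 3 / D.c R + 2 * R) / x.1
        - x.1 / 2 * (R ^ 3 * D.alpha R / D.c R + 3 * R)) / sigPar (D.params R, x))
      - (1 - x.2 ^ 2) * (R + rhoPar (D.params R, x) * sigPar (D.params R, x)) * x.1
        * sigPar (D.params R, x)) = _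
  have e2 := mass_eq_radiusOf hR.1 hz
  generalize √(1 + 2 * D.energy R) = W at *
  rw [e2]
  generalize sigPar (D.params R, x) = σ at *
  generalize rhoPar (D.params R, x) = ρ at *
  generalize D.radiusOf R x = r at *
  field_simp
  ring

end IsRegularCentre

end DustData


/-! ### Orbits as null curves -/

namespace DustData

variable {D : DustData}

/-- A solution of the dynamical system, as a function `ξ` of the shell label, with values in the
region where the vector field is smooth and the frequency increases towards the centre. -/
structure IsOrbit (D : DustData) (B : ℝ) (ξ : ℝ → ℝ × ℝ) : Prop where
  deriv : ∀ R ∈ Ioo 0 B, HasDerivAt ξ (-(1 / R ^ 2) • D.X R (ξ R)) R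
  regular : ∀ R ∈ Ioo 0 B, Regular (D.params R, ξ R)
  Lam_pos : ∀ R ∈ Ioo 0 B, 0 < LamPar (D.params R) (yPar (D.params R, ξ R))
  Z_pos : ∀ R ∈ Ioo 0 B, 0 < ZPar (D.params R, ξ R)

/-- `dτ/dλ` along the geodesic of an orbit, normalized to `1` at the shell `R₀`. -/
def freqOf (D : DustData) (ξ : ℝ → ℝ × ℝ) (R₀ R : ℝ) : ℝ :=
  Real.exp (∫ t in R..R₀, ZPar (D.params t, ξ t) / t ^ 2)

namespace IsOrbit

variable {b B R R₀ : ℝ} {P₀ : Fin 8 → ℝ} {ξ : ℝ → ℝ × ℝ}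

lemma hasDerivAt_fst (hξ : D.IsOrbit B ξ) (hR : R ∈ Ioo 0 B) :
    HasDerivAt (fun R => (ξ R).1) (-(X₁Par (D.params R, ξ R) / R ^ 2)) R := by
  have h := (hξ.deriv R hR).hasFDerivAt.fst.hasDerivAt
  refine h.congr_deriv ?_
  rw [X_eq hR.1.ne']
  simp [XPar]
  ring

lemma hasDerivAt_snd (hξ : D.IsOrbit B ξ) (hR : R ∈ Ioo 0 B) :
    HasDerivAt (fun R => (ξ R).2) (-(X₂Par (D.params R, ξ R) / R ^ 2)) R := by
  have h := (hξ.deriv R hR).hasFDerivAt.snd.hasDerivAt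
  refine h.congr_deriv ?_
  rw [X_eq hR.1.ne']
  simp [XPar]
  ring

lemma prime_pos (hC : D.IsRegularCentre b P₀) (hD : D.IsAdmissible) (hB : B ≤ b)
    (hξ : D.IsOrbit B ξ) (hR : R ∈ Ioo 0 B) :
    0 < D.arealRadiusPrime (D.timeOf R (ξ R)) R := by
  have hz := hξ.regular R hR
  rw [hC.prime_eq hD ⟨hR.1, hR.2.trans_le hB⟩ hz]
  have h1 := (IsRegularCentre.radiusOf_mem hR.1 hz).1
  have h2 := IsRegularCentre.sigPar_pos hz
  have h3 : 0 < rhoPar (D.params R, ξ R) := by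
    have h4 : 0 < D.c R := hz.c_pos
    have h5 := hz.χ_pos
    exact mul_pos (div_pos (pow_pos h5 3) (Real.rpow_pos_of_pos h4 _)) (hξ.Lam_pos R hR)
  have := hR.1
  positivity

/-- The areal radius along an orbit. -/
lemma hasDerivAt_radiusOf (hC : D.IsRegularCentre b P₀) (hD : D.IsAdmissible) (hB : B ≤ b)
    (hξ : D.IsOrbit B ξ) (hR : R ∈ Ioo 0 B) :
    HasDerivAt (fun R => D.radiusOf R (ξ R)) (D.arealRadiusPrime (D.timeOf R (ξ R)) R
      * (1 - (ξ R).1 * sigPar (D.params R, ξ R) / (√(1 + 2 * D.energy R) * (ξ R).2))) R := by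
  have hRb : R ∈ Ioo 0 b := ⟨hR.1, hR.2.trans_le hB⟩
  have hR' := hC.mem_cloud hRb
  have hz := hξ.regular R hR
  have hR0 := hR.1
  have hχ := hz.χ_pos
  have hp := hz.p_pos
  have hc : 0 < D.c R := hz.c_pos
  have hr := (IsRegularCentre.radiusOf_mem hR.1 hz).1
  have hW := Real.sqrt_pos.2 hz.E_pos
  have hcd := (hD.hasDerivAt_c hR').differentiableAt.hasDerivAt
  have hc' : _root_.deriv D.c R = R * D.alpha R := by rw [alpha]; field_simp
  have h1 := ((hasDerivAt_pow 3 R).mul hcd).div ((hξ.hasDerivAt_fst hR).pow 2)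
    (pow_pos hχ 2).ne'
  -- Along the orbit r = cR³/χ², so the derivative of r follows from c' and from X₁.
  have hev : (fun R => D.radiusOf R (ξ R)) =ᶠ[𝓝 R] ((fun R => R ^ 3) * D.c) / (fun R => (ξ R).1) ^ 2 := by
    filter_upwards [isOpen_Ioo.mem_nhds hR] with t ht
    have hz' := hξ.regular t ht
    have := IsRegularCentre.c_eq ht.1 hz'
    have e1 := ht.1.ne'
    have e2 := hz'.χ_pos.ne'
    simp only at e2
    simp only [Pi.div_apply, Pi.mul_apply, Pi.pow_apply]
    rw [this]
    field_simp
  refine (h1.congr_of_eventuallyEq hev).congr_deriv ?_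
  have hX := hC.X₁Par_eq hD hRb hz
  have hcr : D.c R = D.radiusOf R (ξ R) * (ξ R).1 ^ 2 / R ^ 3 := IsRegularCentre.c_eq hR.1 hz
  simp only [Pi.mul_apply, Pi.pow_apply]
  rw [hX, hc', hcr]
  change 0 < √(1 + 2 * D.energy R) at hW
  generalize √(1 + 2 * D.energy R) = W at *
  generalize D.radiusOf R (ξ R) = r at *
  field_simp
  ring

/-- The derivative of r along the orbit is computed twice: from X₁, and by the chain rule as r' +
ṙ·dτ/dR. Since ṙ = -χσ is nonzero, comparison determines dτ/dR = √g_RR/Π. -/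
lemma hasDerivAt_timeOf (hC : D.IsRegularCentre b P₀) (hD : D.IsAdmissible) (hB : B ≤ b)
    (hξ : D.IsOrbit B ξ) (hR : R ∈ Ioo 0 B) :
    HasDerivAt (fun R => D.timeOf R (ξ R))
      (D.radialScale (D.timeOf R (ξ R)) R / (ξ R).2) R := by
  have hRb : R ∈ Ioo 0 b := ⟨hR.1, hR.2.trans_le hB⟩
  have hR' := hC.mem_cloud hRb
  have hz := hξ.regular R hR
  have hr := IsRegularCentre.radiusOf_mem hR.1 hz
  have hrr := hξ.hasDerivAt_radiusOf hC hD hB hR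
  obtain ⟨ht, htr⟩ := hC.timeOf_mem hD hRb hz
  have hdiff : DifferentiableAt ℝ (fun R => D.timeOf R (ξ R)) R := by
    have h1 := (hC.contDiffAt_infallFormula hD hRb hr).differentiableAt (by simp)
    have h2 := DifferentiableAt.comp (f := fun R => (R, D.radiusOf R (ξ R))) R h1
      (differentiableAt_id.prodMk hrr.differentiableAt)
    refine h2.congr_of_eventuallyEq ?_
    filter_upwards [isOpen_Ioo.mem_nhds hR] with t ht
    have hr' := IsRegularCentre.radiusOf_mem ht.1 (hξ.regular t ht)
    exact infallTime_eq_formula hD (hC.mem_cloud ⟨ht.1, ht.2.trans_le hB⟩)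
      (Ioo_subset_Icc_self hr')
  obtain ⟨g1, g2, -, -⟩ := hC.arealRadiusPrime_regular hD hRb ht
  have hT := hasDerivAt_arealRadius hR.1 (hD.mass_pos hR') ht
  rw [htr, IsRegularCentre.speed_eq hR.1 hz] at hT
  have h3 := hasDerivAt_along (F := fun u : ℝ × ℝ => D.arealRadius u.1 u.2)
    (tt := fun R => D.timeOf R (ξ R)) g2 hdiff.hasDerivAt hT g1
  have h4 : (fun R => D.arealRadius (D.timeOf R (ξ R)) R) =ᶠ[𝓝 R]
      fun R => D.radiusOf R (ξ R) := by
    filter_upwards [isOpen_Ioo.mem_nhds hR] with t ht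
    exact (hC.timeOf_mem hD ⟨ht.1, ht.2.trans_le hB⟩ (hξ.regular t ht)).2
  have h5 := (hrr.congr_of_eventuallyEq h4).unique h3
  refine hdiff.hasDerivAt.congr_deriv ?_
  have hχ := hz.χ_pos
  have hp := hz.p_pos
  have hσ := IsRegularCentre.sigPar_pos hz
  have hW := Real.sqrt_pos.2 hz.E_pos
  simp only at hχ hp
  change 0 < √(1 + 2 * D.energy R) at hW
  rw [radialScale]
  generalize √(1 + 2 * D.energy R) = W at *
  generalize _root_.deriv (fun R => D.timeOf R (ξ R)) R = T at *
  generalize sigPar (D.params R, ξ R) = σ at *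
  field_simp at h5 ⊢
  refine mul_left_cancel₀ (mul_pos hχ hσ).ne' ?_
  linear_combination h5

lemma continuousOn_Z (hC : D.IsRegularCentre b P₀) (hB : B ≤ b) (hξ : D.IsOrbit B ξ) :
    ContinuousOn (fun t => ZPar (D.params t, ξ t) / t ^ 2) (Ioo 0 B) := by
  intro t ht
  have hp : ContinuousAt D.params t :=
    hC.continuousOn.continuousAt (isOpen_Ioo.mem_nhds ⟨ht.1, ht.2.trans_le hB⟩)
  have h1 : ContinuousAt (fun t => ZPar (D.params t, ξ t)) t :=
    ContinuousAt.comp (f := fun t => (D.params t, ξ t)) (hξ.regular t ht).continuousAt_ZPar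
      (hp.prodMk (hξ.deriv t ht).continuousAt)
  exact (h1.div (continuousAt_id.pow 2) (pow_pos ht.1 2).ne').continuousWithinAt

lemma hasDerivAt_freqOf (hC : D.IsRegularCentre b P₀) (hB : B ≤ b) (hξ : D.IsOrbit B ξ)
    (hR₀ : R₀ ∈ Ioo 0 B) (hR : R ∈ Ioo 0 B) : HasDerivAt (D.freqOf ξ R₀)
      (-(D.freqOf ξ R₀ R * (ZPar (D.params R, ξ R) / R ^ 2))) R := by
  have hZ := hξ.continuousOn_Z hC hB
  have hI : IntervalIntegrable (fun t => ZPar (D.params t, ξ t) / t ^ 2)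
      MeasureTheory.volume R R₀ :=
    (hZ.mono (ordConnected_Ioo.uIcc_subset hR hR₀)).intervalIntegrable
  have h1 := intervalIntegral.integral_hasDerivAt_left hI
    (hZ.stronglyMeasurableAtFilter isOpen_Ioo R hR) (hZ.continuousAt (isOpen_Ioo.mem_nhds hR))
  refine h1.exp.congr_deriv ?_
  rw [freqOf]
  ring

/-- Positivity of `ZPar` means that ω increases towards the centre. This bounds dλ/dR and so keeps
the affine distance to the singularity finite. -/
lemma one_le_freqOf (hξ : D.IsOrbit B ξ) (hR₀ : R₀ ∈ Ioo 0 B) (hR : R ∈ Ioc 0 R₀) :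
    1 ≤ D.freqOf ξ R₀ R := by
  refine Real.one_le_exp (intervalIntegral.integral_nonneg hR.2 fun t ht => ?_)
  exact (div_pos (hξ.Z_pos t ⟨hR.1.trans_le ht.1, ht.2.trans_lt hR₀.2⟩)
    (pow_pos (hR.1.trans_le ht.1) 2)).le

/-- Here the phase-space identities become the evolution laws of Π and ω. The common factor R²
disappears in passing from s to R. -/
theorem isNullCurve (hC : D.IsRegularCentre b P₀) (hD : D.IsAdmissible) (hB : B ≤ b)
    (hξ : D.IsOrbit B ξ) (hR₀ : R₀ ∈ Ioo 0 B) :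
    D.IsNullCurve B (fun R => D.timeOf R (ξ R)) (fun R => (ξ R).2) (D.freqOf ξ R₀)
      (fun R => -((ξ R).1 * sigPar (D.params R, ξ R))) (fun R => D.primeRateOf R (ξ R)) := by
  have hb : ∀ R ∈ Ioo 0 B, R ∈ Ioo 0 b := fun R hR => ⟨hR.1, hR.2.trans_le hB⟩
  have ht := fun R hR => hC.timeOf_mem hD (hb R hR) (hξ.regular R hR)
  have hg := fun R hR => hC.arealRadiusPrime_regular hD (hb R hR) (ht R hR).1
  refine ⟨fun R hR => ⟨hC.mem_cloud (hb R hR), (ht R hR).1⟩, fun R hR => ?_,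
    fun R hR => hξ.prime_pos hC hD hB hR, fun R hR => (hξ.regular R hR).E_pos,
    fun R hR => (hξ.regular R hR).p_pos, fun R _ => Real.exp_pos _,
    fun R hR => (hg R hR).2.1, fun R hR => (hg R hR).2.2.1, fun R hR => ?_, fun R hR => ?_,
    fun R hR => ?_, fun R hR => hξ.hasDerivAt_timeOf hC hD hB hR, fun R hR => ?_,
    fun R hR => ?_⟩
  · rw [(ht R hR).2]
    exact (IsRegularCentre.radiusOf_mem hR.1 (hξ.regular R hR)).1
  · exact (hD.contDiffOn_energy.contDiffAt
      (isOpen_Ioo.mem_nhds (hC.mem_cloud (hb R hR)))).differentiableAt (by simp)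
  · have h := hasDerivAt_arealRadius hR.1 (hD.mass_pos (hC.mem_cloud (hb R hR))) (ht R hR).1
    rwa [(ht R hR).2, IsRegularCentre.speed_eq hR.1 (hξ.regular R hR)] at h
  · have h := (hg R hR).2.2.2
    rwa [(ht R hR).2, IsRegularCentre.speed_eq hR.1 (hξ.regular R hR)] at h
  · refine (hξ.hasDerivAt_snd hR).congr_deriv ?_
    rw [hC.X₂Par_eq hD (hb R hR) (hξ.regular R hR), (ht R hR).2]
    have := hR.1.ne'
    field_simp
  · refine (hξ.hasDerivAt_freqOf hC hB hR₀ hR).congr_deriv ?_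
    rw [hC.ZPar_eq hD (hb R hR) (hξ.regular R hR), (ht R hR).2]
    have := hR.1.ne'
    field_simp

end IsOrbit

end DustData


/-! ### Limits at the central singularity and the geodesic of an orbit -/

namespace DustData

variable {D : DustData}

namespace IsRegularCentre

variable {b : ℝ} {P₀ : Fin 8 → ℝ}

lemma tendsto_params_apply (hC : D.IsRegularCentre b P₀) (i : Fin 8) :
    Tendsto (fun R => D.params R i) (𝓝[>] 0) (𝓝 (P₀ i)) :=
  (tendsto_pi_nhds.1 hC.tendsto) i

/-- The collapse time of the central shell. -/
lemma tendsto_collapseTime (hC : D.IsRegularCentre b P₀) (hD : D.IsAdmissible) :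
    Tendsto D.collapseTime (𝓝[>] 0) (𝓝 ((f 0 - P₀ 4) / (P₀ 3 ^ 3 * √(P₀ 2)))) := by
  have h2 : Tendsto D.c (𝓝[>] 0) (𝓝 (P₀ 2)) := hC.tendsto_params_apply 2
  have h3 : Tendsto D.q (𝓝[>] 0) (𝓝 (P₀ 3)) := hC.tendsto_params_apply 3
  have h4 : Tendsto (fun R => f (D.q R)) (𝓝[>] 0) (𝓝 (P₀ 4)) := hC.tendsto_params_apply 4
  have hne : P₀ 3 ^ 3 * √(P₀ 2) ≠ 0 :=
    mul_ne_zero (pow_pos hC.pos₃ 3).ne' (Real.sqrt_pos.2 hC.pos₂).ne'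
  refine ((h4.const_sub _).div ((h3.pow 3).mul h2.sqrt) hne).congr' ?_
  filter_upwards [Ioo_mem_nhdsGT hC.pos] with R hR
  exact (collapseTime_eq hD (hC.mem_cloud hR)).symm

end IsRegularCentre

namespace IsOrbit

variable {b B R R₀ : ℝ} {P₀ : Fin 8 → ℝ} {ξ : ℝ → ℝ × ℝ}

/-- Convergence to (1, 1) forces y → 0, so f(q·y) → f(0) and the closed form of the infall time
acquires the same limit as the collapse time. -/
lemma tendsto_timeOf (hC : D.IsRegularCentre b P₀) (hD : D.IsAdmissible) (hB : B ≤ b)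
    (hB0 : 0 < B) (hξ : D.IsOrbit B ξ) (hlim : Tendsto ξ (𝓝[>] 0) (𝓝 (1, 1))) :
    Tendsto (fun R => D.timeOf R (ξ R)) (𝓝[>] 0)
      (𝓝 ((f 0 - P₀ 4) / (P₀ 3 ^ 3 * √(P₀ 2)))) := by
  have h2 : Tendsto D.c (𝓝[>] 0) (𝓝 (P₀ 2)) := hC.tendsto_params_apply 2
  have h3 : Tendsto D.q (𝓝[>] 0) (𝓝 (P₀ 3)) := hC.tendsto_params_apply 3
  have h4 : Tendsto (fun R => f (D.q R)) (𝓝[>] 0) (𝓝 (P₀ 4)) := hC.tendsto_params_apply 4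
  have hy : Tendsto (fun R => yPar (D.params R, ξ R)) (𝓝[>] 0) (𝓝 0) := by
    have h := hC.regular_centre.contDiffAt_yPar.continuousAt.tendsto.comp
      (hC.tendsto.prodMk_nhds hlim)
    rwa [hC.yPar_centre] at h
  have hne : P₀ 3 ^ 3 * √(P₀ 2) ≠ 0 :=
    mul_ne_zero (pow_pos hC.pos₃ 3).ne' (Real.sqrt_pos.2 hC.pos₂).ne'
  have h5 : Tendsto (fun R => f (D.q R * yPar (D.params R, ξ R))) (𝓝[>] 0) (𝓝 (f 0)) := by
    have h := (continuous_f.tendsto _).comp (h3.mul hy)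
    rwa [mul_zero] at h
  refine ((h5.sub h4).div ((h3.pow 3).mul h2.sqrt) hne).congr' ?_
  filter_upwards [Ioo_mem_nhdsGT hB0] with R hR
  have hz := hξ.regular R hR
  have hr := IsRegularCentre.radiusOf_mem hR.1 hz
  rw [timeOf, infallTime_eq_formula hD (hC.mem_cloud ⟨hR.1, hR.2.trans_le hB⟩)
    (Ioo_subset_Icc_self hr), infallFormula, IsRegularCentre.sqrt_radiusOf hR.1 hz]
  rfl

/-- In r' = (r/R²)(R + ρσ) the first factor is cR/χ² and tends to 0, while the second converges. -/
lemma tendsto_radialScale (hC : D.IsRegularCentre b P₀) (hD : D.IsAdmissible) (hB : B ≤ b)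
    (hB0 : 0 < B) (hξ : D.IsOrbit B ξ) (hlim : Tendsto ξ (𝓝[>] 0) (𝓝 (1, 1))) :
    Tendsto (fun R => D.radialScale (D.timeOf R (ξ R)) R) (𝓝[>] 0) (𝓝 0) := by
  have h0 : Tendsto (fun R : ℝ => R) (𝓝[>] 0) (𝓝 0) := nhdsWithin_le_nhds
  have h1 : Tendsto D.energy (𝓝[>] 0) (𝓝 (P₀ 1)) := hC.tendsto_params_apply 1
  have h2 : Tendsto D.c (𝓝[>] 0) (𝓝 (P₀ 2)) := hC.tendsto_params_apply 2
  have hz := hC.tendsto.prodMk_nhds hlim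
  have hρ : Tendsto (fun R => rhoPar (D.params R, ξ R)) (𝓝[>] 0) _ :=
    hC.regular_centre.contDiffAt_rhoPar.continuousAt.tendsto.comp hz
  have hσ : Tendsto (fun R => sigPar (D.params R, ξ R)) (𝓝[>] 0) _ :=
    hC.regular_centre.contDiffAt_sigPar.continuousAt.tendsto.comp hz
  have hχ : Tendsto (fun R => (ξ R).1) (𝓝[>] 0) (𝓝 1) := hlim.fst_nhds
  have hW := ((h1.const_mul 2).const_add 1).sqrt
  have hne : √(1 + 2 * P₀ 1) ≠ 0 := by simp [hC.zero₁]
  have h := (((h0.mul h2).div (hχ.pow 2) (by norm_num)).mul (h0.add (hρ.mul hσ))).div hW hne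
  simp only [zero_mul, zero_div] at h
  refine h.congr' ?_
  filter_upwards [Ioo_mem_nhdsGT hB0] with R hR
  have hz := hξ.regular R hR
  have hχ : 0 < (ξ R).1 := hz.χ_pos
  have hR0 := hR.1
  rw [radialScale, hC.prime_eq hD ⟨hR.1, hR.2.trans_le hB⟩ hz]
  simp only [Pi.div_apply]
  rw [IsRegularCentre.c_eq hR.1 hz]
  congr 1
  field_simp

/-- The null geodesic of an orbit. -/
theorem exists_geodesic (hC : D.IsRegularCentre b P₀) (hD : D.IsAdmissible) (hB : B ≤ b)
    (hξ : D.IsOrbit B ξ) (hlim : Tendsto ξ (𝓝[>] 0) (𝓝 (1, 1))) (hR₀ : R₀ ∈ Ioo 0 B)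
    (hp : (ξ R₀).2 ≤ 1) :
    ∃ (γ : ℝ → Fin 4 → ℝ) (b' : ℝ), ∃ l ∈ Ioo 0 b', ∃ L : ℝ,
      D.EmanatesFromCentralSingularity γ b' ∧ IsEquatorial γ b' ∧
      γ l 1 = R₀ ∧
      D.chiAlong γ l = (ξ R₀).1 ∧ D.PiAlong γ l = (ξ R₀).2 ∧
      (∀ l' ∈ Ioo 0 b', D.angularMomentum γ l' = L) ∧ (L = 0 ↔ (ξ R₀).2 = 1) ∧
      Tendsto (fun l' => (D.chiAlong γ l', D.PiAlong γ l')) (𝓝[>] 0) (𝓝 (1, 1)) := by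
  have hB0 : 0 < B := hR₀.1.trans hR₀.2
  have hN := hξ.isNullCurve hC hD hB hR₀
  have hbd : ∀ R ∈ Ioo 0 B, R ∈ Ioo 0 b := fun R hR => ⟨hR.1, hR.2.trans_le hB⟩
  have ht := fun R hR => hC.timeOf_mem hD (hbd R hR) (hξ.regular R hR)
  obtain ⟨L, hL0, hL⟩ := hN.exists_angularMomentum hR₀ hp
  set tt : ℝ → ℝ := fun R => D.timeOf R (ξ R) with htt
  set om := D.freqOf ξ R₀
  set k : ℝ → ℝ := fun R => D.radialScale (tt R) R / ((ξ R).2 * om R) with hk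
  have hkc : ContinuousOn k (Ioo 0 B) := by
    intro R hR
    have h1 : ContinuousAt (fun R => D.arealRadiusPrime (tt R) R) R :=
      ContinuousAt.comp (g := fun u : ℝ × ℝ => D.arealRadiusPrime u.1 u.2) (f := fun R => (tt R, R))
        (hN.prime_diff R hR).continuousAt ((hN.deriv_tt R hR).continuousAt.prodMk continuousAt_id)
    have h2 : ContinuousAt (fun R => √(1 + 2 * D.energy R)) R :=
      ((hN.energy_diff R hR).continuousAt.const_mul 2).const_add 1 |>.sqrt
    exact ((h1.div h2 (Real.sqrt_pos.2 (hN.energy_pos R hR)).ne').div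
      ((hN.deriv_p R hR).continuousAt.mul (hN.deriv_freq R hR).continuousAt)
      (mul_pos (hN.p_pos R hR) (hN.freq_pos R hR)).ne').continuousWithinAt
  have hkpos : ∀ R ∈ Ioo 0 B, 0 < k R := fun R hR =>
    div_pos (hN.scale_pos hR) (mul_pos (hN.p_pos R hR) (hN.freq_pos R hR))
  -- Since ω ≥ 1 below R₀, the integrand dλ/dR is squeezed between 0 and √g_RR/Π.
  have hklim : Tendsto k (𝓝[>] 0) (𝓝 0) := by
    have h1 := (hξ.tendsto_radialScale hC hD hB hB0 hlim).div hlim.snd_nhds one_ne_zero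
    rw [zero_div] at h1
    refine tendsto_of_tendsto_of_tendsto_of_le_of_le' tendsto_const_nhds h1 ?_ ?_
    · filter_upwards [Ioo_mem_nhdsGT hB0] with R hR using (hkpos R hR).le
    · filter_upwards [Ioo_mem_nhdsGT hB0, Ioo_mem_nhdsGT hR₀.1] with R hR hR'
      have h2 := hξ.one_le_freqOf hR₀ ⟨hR'.1, hR'.2.le⟩
      have h3 := hN.p_pos R hR
      exact div_le_div_of_nonneg_left (hN.scale_pos hR).le h3 (le_mul_of_one_le_right h3.le h2)
  obtain ⟨b', ρ, l₀, hl₀, hρl₀, hρ, hρlim⟩ := exists_inverse_primitive hR₀ hkc hkpos hklim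
  have hb' : 0 < b' := hl₀.1.trans hl₀.2
  -- This is dφ/dR, from r²·dφ/dλ = L and dλ/dR = k. Integrability at the centre is not needed,
  -- because φ may start at R₀.
  set w : ℝ → ℝ := fun R => L / D.arealRadius (tt R) R ^ 2 * k R
  have hwc : ContinuousOn w (Ioo 0 B) := by
    intro R hR
    have h1 := (hN.hasDerivAt_radius hR).continuousAt
    exact ((continuousAt_const.div (h1.pow 2) (pow_pos (hN.radius_pos R hR) 2).ne').mul
      (hkc.continuousAt (isOpen_Ioo.mem_nhds hR))).continuousWithinAt
  set φ : ℝ → ℝ := fun R => ∫ t in R₀..R, w t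
  have hφ : ∀ R ∈ Ioo 0 B, HasDerivAt φ (w R) R := by
    intro R hR
    exact intervalIntegral.integral_hasDerivAt_right
      (hwc.mono (ordConnected_Ioo.uIcc_subset hR₀ hR)).intervalIntegrable
      (hwc.stronglyMeasurableAtFilter isOpen_Ioo R hR) (hwc.continuousAt (isOpen_Ioo.mem_nhds hR))
  obtain ⟨hder, hgeo⟩ := hN.isFutureNullGeodesic hb' hρ hL hφ
  set γ : ℝ → Fin 4 → ℝ := fun l => ![tt (ρ l), ρ l, Real.pi / 2, φ (ρ l)] with hγ
  have hchi : ∀ l ∈ Ioo 0 b', D.chiAlong γ l = (ξ (ρ l)).1 := by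
    intro l hl
    have hR := (hρ l hl).1
    have hz := hξ.regular _ hR
    have hr := (IsRegularCentre.radiusOf_mem hR.1 hz).1
    change √(2 * D.mass (ρ l) / D.arealRadius (tt (ρ l)) (ρ l)) = _
    have hχ : 0 < (ξ (ρ l)).1 := hz.χ_pos
    rw [(ht _ hR).2, IsRegularCentre.mass_eq_radiusOf hR.1 hz, ← Real.sqrt_sq hχ.le]
    congr 1
    rw [Real.sqrt_sq hχ.le]
    field_simp
  have hPi : ∀ l ∈ Ioo 0 b', D.PiAlong γ l = (ξ (ρ l)).2 := by
    intro l hl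
    have hR := (hρ l hl).1
    have h1 := (hN.scale_pos hR).ne'
    have h2 := (hN.freq_pos _ hR).ne'
    rw [PiAlong, hder l hl]
    change D.radialScale (tt (ρ l)) (ρ l)
      * (((ξ (ρ l)).2 * om (ρ l) / D.radialScale (tt (ρ l)) (ρ l)) / om (ρ l)) = _
    field_simp
  have hang : ∀ l ∈ Ioo 0 b', D.angularMomentum γ l = L := by
    intro l hl
    have hR := (hρ l hl).1
    have h1 := (hN.radius_pos _ hR).ne'
    rw [angularMomentum, hder l hl]
    change D.arealRadius (tt (ρ l)) (ρ l) ^ 2 * (L / D.arealRadius (tt (ρ l)) (ρ l) ^ 2) = L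
    field_simp
  refine ⟨γ, b', l₀, hl₀, L, ⟨hgeo, hρlim.mono_right nhdsWithin_le_nhds, _,
    hC.tendsto_collapseTime hD, (hξ.tendsto_timeOf hC hD hB hB0 hlim).comp hρlim⟩,
    fun _ _ => rfl, hρl₀, ?_, ?_, hang, hL0, ?_⟩
  · rw [hchi l₀ hl₀, hρl₀]
  · rw [hPi l₀ hl₀, hρl₀]
  · refine (hlim.comp hρlim).congr' ?_
    filter_upwards [Ioo_mem_nhdsGT hb'] with l hl
    rw [hchi l hl, hPi l hl]
    rfl

end IsOrbit

end DustData


/-! ### The basin of (1, 1) and the geodesics through it -/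

namespace DustData

variable {D : DustData}

/-- From the shell `1/S` inwards, the ball of radius `e` about `(1, 1)` is attracted to `(1, 1)`, and
it lies in the region where the vector field describes null geodesics. -/
structure IsBasin (D : DustData) (b S e : ℝ) : Prop where
  inv_lt : 1 / b < S
  attracting : ∃ (α : ℝ) (K M : NNReal) (η : ℝ → ℝ),
    IsAttracting (fun s => D.X (1 / s)) S e α K M η
  regular : ∀ s, S ≤ s → ∀ x ∈ box e, Regular (D.params (1 / s), x) ∧
    0 < LamPar (D.params (1 / s)) (yPar (D.params (1 / s), x)) ∧ 0 < ZPar (D.params (1 / s), x)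

namespace IsBasin

variable {b S e R : ℝ} {P₀ : Fin 8 → ℝ}

lemma e_pos (hV : D.IsBasin b S e) : 0 < e := by
  obtain ⟨α, K, M, η, hA⟩ := hV.attracting
  exact hA.e_pos

lemma S_pos (hC : D.IsRegularCentre b P₀) (hV : D.IsBasin b S e) : 0 < S :=
  (one_div_pos.2 hC.pos).trans hV.inv_lt

lemma one_div_mem (hC : D.IsRegularCentre b P₀) (hV : D.IsBasin b S e) {s : ℝ} (hs : S ≤ s) :
    1 / s ∈ Ioo 0 b := by
  have hS := hV.S_pos hC
  have hs0 : 0 < s := hS.trans_le hs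
  exact ⟨one_div_pos.2 hs0, (one_div_lt hs0 hC.pos).2 (hV.inv_lt.trans_le hs)⟩

lemma mem_phaseDomain (hC : D.IsRegularCentre b P₀) (hV : D.IsBasin b S e) {s : ℝ} (hs : S ≤ s)
    {x : ℝ × ℝ} (hx : x ∈ box e) : x ∈ D.phaseDomain (1 / s) := by
  have hz := (hV.regular s hs x hx).1
  exact ⟨hC.mem_cloud (hV.one_div_mem hC hs), hz.χ_pos, hz.p_pos.ne', hz.y_lt⟩

/-- Every point of the basin lies on a solution that converges to `(1, 1)`. -/
lemma exists_maximalSolution (hC : D.IsRegularCentre b P₀) (hV : D.IsBasin b S e)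
    (hR : S < 1 / R) {x₀ : ℝ × ℝ} (hx₀ : sqDist x₀ < e ^ 2) :
    ∃ x : ℝ → ℝ × ℝ, D.IsMaximalSolutionOn (1 / R) ⊤ x ∧ x (1 / R) = x₀ ∧
      (∀ s, 1 / R ≤ s → HasDerivAt x (D.X (1 / s) (x s)) s ∧ x s ∈ box e) ∧
      Tendsto x atTop (𝓝 (1, 1)) := by
  obtain ⟨α, K, M, η, hA⟩ := hV.attracting
  obtain ⟨x, a', -, ha', hxa, hx, hlim⟩ := hA.exists_solution hR hx₀
  have hbox : ∀ s, 1 / R ≤ s → x s ∈ box e := fun s hs =>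
    mem_box_of_sqDist_le hA.e_pos.le (hx s (ha'.trans_le hs)).2.le
  refine ⟨x, ⟨⟨EReal.coe_lt_top _, fun s hs _ => ⟨hV.mem_phaseDomain hC (hR.le.trans hs) (hbox s hs),
    (hx s (ha'.trans_le hs)).1.hasDerivWithinAt⟩⟩, fun T' _ hT' => absurd hT' not_top_lt⟩, hxa,
    fun s hs => ⟨(hx s (ha'.trans_le hs)).1, hbox s hs⟩, hlim⟩

/-- Every maximal solution that starts in the basin is global and converges to `(1, 1)`. -/
lemma tendsto_of_isMaximalSolutionOn (hC : D.IsRegularCentre b P₀) (hV : D.IsBasin b S e)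
    (hR : S < 1 / R) {T : EReal} {x : ℝ → ℝ × ℝ} (hx : D.IsMaximalSolutionOn (1 / R) T x)
    (hx₀ : sqDist (x (1 / R)) < e ^ 2) : T = ⊤ ∧ Tendsto x atTop (𝓝 (1, 1)) := by
  obtain ⟨y, hy, hy₀, hyd, hlim⟩ := hV.exists_maximalSolution hC hR hx₀
  obtain ⟨α, K, M, η, hA⟩ := hV.attracting
  have hEq : ∀ s : ℝ, 1 / R ≤ s → (s : EReal) < T → y s = x s := by
    intro s hs hsT
    have hlt : ∀ t ≤ s, (t : EReal) < T := fun t ht =>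
      (EReal.coe_le_coe_iff.2 ht).trans_lt hsT
    have hxc : ContinuousOn x (Icc (1 / R) s) := fun t ht =>
      ((hx.1.2 t ht.1 (hlt t ht.2)).2.continuousWithinAt).mono
        fun u hu => ⟨hu.1, hlt u hu.2⟩
    have hxd : ∀ t ∈ Ico (1 / R) s, HasDerivWithinAt x (D.X (1 / t) (x t)) (Ici t) t :=
      fun t ht => (hx.1.2 t ht.1 (hlt t ht.2.le)).2.mono_of_mem_nhdsWithin
        (mem_of_superset (Ico_mem_nhdsGE ht.2) fun u hu => ⟨ht.1.trans hu.1, hlt u hu.2.le⟩)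
    have hxb := hA.sqDist_lt hR.le hxc hxd (fun _ _ _ => rfl) hx₀
    refine (hA.eqOn hR.le hxc (fun t ht => ⟨hxd t ht, mem_box_of_sqDist_le hA.e_pos.le
      (hxb t ⟨ht.1, ht.2.le⟩).le⟩) (fun t ht => (hyd t ht.1).1.continuousAt.continuousWithinAt)
      (fun t ht => ⟨(hyd t ht.1).1.hasDerivWithinAt, (hyd t ht.1).2⟩) hy₀.symm ⟨hs, le_rfl⟩).symm
  -- Uniqueness identifies the solution with the global one on [1/R, T), so a finite T would
  -- contradict maximality.
  have hT : T = ⊤ := by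
    by_contra hne
    exact hx.2 ⊤ y (lt_top_iff_ne_top.2 hne) hy.1 hEq
  refine ⟨hT, hlim.congr' ?_⟩
  filter_upwards [eventually_ge_atTop (1 / R)] with s hs
  exact hEq s hs (hT ▸ EReal.coe_lt_top s)

/-- Reading a solution as a function of t = 1/s turns its short continuation into the past into
shells outside R, so R is interior to the orbit's domain (0, B). -/
lemma exists_orbit (hC : D.IsRegularCentre b P₀) (hV : D.IsBasin b S e) (hR0 : 0 < R)
    (hR : S < 1 / R) {x₀ : ℝ × ℝ} (hx₀ : sqDist x₀ < e ^ 2) :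
    ∃ (B : ℝ) (ξ : ℝ → ℝ × ℝ), B ≤ b ∧ D.IsOrbit B ξ ∧ Tendsto ξ (𝓝[>] 0) (𝓝 (1, 1)) ∧
      R ∈ Ioo 0 B ∧ ξ R = x₀ := by
  obtain ⟨α, K, M, η, hA⟩ := hV.attracting
  obtain ⟨x, a', hSa, ha', hxa, hx, hlim⟩ := hA.exists_solution hR hx₀
  have ha0 : 0 < a' := (hV.S_pos hC).trans_le hSa
  have hs : ∀ t ∈ Ioo 0 (1 / a'), a' < 1 / t := fun t ht => (lt_one_div ha0 ht.1).2 ht.2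
  have hreg := fun t (ht : t ∈ Ioo 0 (1 / a')) => hV.regular (1 / t) (hSa.trans (hs t ht).le) _
    (mem_box_of_sqDist_le hA.e_pos.le (hx _ (hs t ht)).2.le)
  simp only [one_div_one_div] at hreg
  refine ⟨1 / a', fun t => x (1 / t), (hV.one_div_mem hC hSa).2.le, ⟨fun t ht => ?_,
    fun t ht => (hreg t ht).1, fun t ht => (hreg t ht).2.1, fun t ht => (hreg t ht).2.2⟩, ?_,
    ⟨hR0, (lt_one_div hR0 ha0).2 ha'⟩, hxa⟩
  · have h1 : HasDerivAt (fun t : ℝ => 1 / t) (-(1 / t ^ 2)) t := by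
      simpa only [one_div] using hasDerivAt_inv ht.1.ne'
    have h2 := HasDerivAt.scomp t (hx _ (hs t ht)).1 h1
    rwa [one_div_one_div] at h2
  · simp only [one_div]
    exact hlim.comp tendsto_inv_nhdsGT_zero

lemma exists_geodesic (hC : D.IsRegularCentre b P₀) (hD : D.IsAdmissible) (hV : D.IsBasin b S e)
    (hR0 : 0 < R) (hR : S < 1 / R) {x₀ : ℝ × ℝ} (hx₀ : sqDist x₀ < e ^ 2) (hp : x₀.2 ≤ 1) :
    ∃ (γ : ℝ → Fin 4 → ℝ) (b : ℝ), ∃ l ∈ Ioo 0 b, ∃ L : ℝ,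
      D.EmanatesFromCentralSingularity γ b ∧ IsEquatorial γ b ∧
      γ l 1 = R ∧ D.chiAlong γ l = x₀.1 ∧ D.PiAlong γ l = x₀.2 ∧
      (∀ l' ∈ Ioo 0 b, D.angularMomentum γ l' = L) ∧ (L = 0 ↔ x₀.2 = 1) ∧
      Tendsto (fun l' => (D.chiAlong γ l', D.PiAlong γ l')) (𝓝[>] 0) (𝓝 (1, 1)) := by
  obtain ⟨B, ξ, hB, hξ, hlim, hRB, rfl⟩ := hV.exists_orbit hC hR0 hR hx₀
  exact hξ.exists_geodesic hC hD hB hlim hRB hp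

/-- The geodesics with the same value `p` of `Π` at the shell `R` reach it at infinitely many
different times. -/
lemma infinite_times (hC : D.IsRegularCentre b P₀) (hD : D.IsAdmissible) (hV : D.IsBasin b S e)
    (hR0 : 0 < R) (hR : S < 1 / R) {p : ℝ} (hp : p ≤ 1) (hp' : sqDist (1, p) < e ^ 2) :
    {t : ℝ | ∃ (γ : ℝ → Fin 4 → ℝ) (b : ℝ), ∃ l ∈ Ioo 0 b, ∃ L : ℝ,
      D.EmanatesFromCentralSingularity γ b ∧ IsEquatorial γ b ∧
      (∀ l' ∈ Ioo 0 b, D.angularMomentum γ l' = L) ∧ (L = 0 ↔ p = 1) ∧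
      γ l 0 = t ∧ γ l 1 = R}.Infinite := by
  -- At the fixed shell, χ = √(2m/r) is a function of the arrival time. Its values fill a
  -- neighbourhood of 1, which is impossible with finitely many times.
  refine Infinite.of_image (fun t => √(2 * D.mass R / D.arealRadius t R)) ?_
  have hnhds : {u : ℝ | sqDist (u, p) < e ^ 2} ∈ 𝓝 (1 : ℝ) :=
    (continuous_sqDist.comp (by fun_prop : Continuous fun u : ℝ => (u, p))).continuousAt
      |>.eventually_lt_const hp'
  refine (infinite_of_mem_nhds 1 hnhds).mono fun u hu => ?_
  obtain ⟨γ, b', l, hl, L, h1, h2, h3, h4, -, h5, h6, -⟩ := hV.exists_geodesic hC hD hR0 hR hu hp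
  refine ⟨γ l 0, ⟨γ, b', l, hl, L, h1, h2, h5, h6, rfl, h3⟩, ?_⟩
  rw [chiAlong, h3] at h4
  exact h4

end IsBasin

end DustData

end

theorem mainTheorem1 (D : DustData) (hD : D.IsAdmissible) :
    ∃ (V : Set (ℝ × ℝ)) (R₀ : ℝ), IsOpen V ∧ ((1 : ℝ), (1 : ℝ)) ∈ V ∧ 0 < R₀ ∧ R₀ < D.R₁ ∧
      ∀ R ∈ Ioc 0 R₀,
        -- solutions of the nonautonomous system through `V` at `s = 1/R`
        (∀ x₀ ∈ V, ∃ (T : EReal) (x : ℝ → ℝ × ℝ),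
          D.IsMaximalSolutionOn (1 / R) T x ∧ x (1 / R) = x₀) ∧
        (∀ (T : EReal) (x : ℝ → ℝ × ℝ), D.IsMaximalSolutionOn (1 / R) T x → x (1 / R) ∈ V →
          T = ⊤ ∧ Tendsto x atTop (𝓝 (1, 1))) ∧
        -- the corresponding null geodesics emanate from the central singularity
        (∀ p ∈ V, p.2 ≤ 1 → ∃ (γ : ℝ → Fin 4 → ℝ) (b : ℝ), ∃ l ∈ Ioo 0 b, ∃ L : ℝ,
          D.EmanatesFromCentralSingularity γ b ∧ DustData.IsEquatorial γ b ∧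
          γ l 1 = R ∧ D.chiAlong γ l = p.1 ∧ D.PiAlong γ l = p.2 ∧
          (∀ l' ∈ Ioo 0 b, D.angularMomentum γ l' = L) ∧ (L = 0 ↔ p.2 = 1) ∧
          Tendsto (fun l' => (D.chiAlong γ l', D.PiAlong γ l')) (𝓝[>] 0) (𝓝 (1, 1))) ∧
        -- infinitely many radial ones, arriving at the shell `R` at pairwise different times
        {t : ℝ | ∃ (γ : ℝ → Fin 4 → ℝ) (b : ℝ), ∃ l ∈ Ioo 0 b,
          D.EmanatesFromCentralSingularity γ b ∧ DustData.IsEquatorial γ b ∧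
          (∀ l' ∈ Ioo 0 b, D.angularMomentum γ l' = 0) ∧ γ l 0 = t ∧ γ l 1 = R}.Infinite ∧
        -- and infinitely many nonradial ones
        {t : ℝ | ∃ (γ : ℝ → Fin 4 → ℝ) (b : ℝ), ∃ l ∈ Ioo 0 b,
          D.EmanatesFromCentralSingularity γ b ∧ DustData.IsEquatorial γ b ∧
          (∃ L : ℝ, L ≠ 0 ∧ ∀ l' ∈ Ioo 0 b, D.angularMomentum γ l' = L) ∧
          γ l 0 = t ∧ γ l 1 = R}.Infinite := by
  obtain ⟨b, P₀, hC⟩ := D.exists_isRegularCentre hD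
  obtain ⟨S, e, α, K, M, η, hS, hA, hreg⟩ := hC.exists_isAttracting
  have hV : D.IsBasin b S e := ⟨hS, ⟨α, K, M, η, hA⟩, hreg⟩
  have hS0 := hV.S_pos hC
  have he := hV.e_pos
  have hone : sqDist (1, 1) < e ^ 2 := by
    simpa [sqDist] using pow_pos he 2
  -- The choice 1/(S + 1) makes 1/R exceed S strictly, which leaves room to continue solutions
  -- backwards in s.
  refine ⟨{x | sqDist x < e ^ 2}, 1 / (S + 1), isOpen_lt continuous_sqDist continuous_const, hone,
    by positivity, (hV.one_div_mem hC (by linarith)).2.trans hC.lt, fun R hR => ?_⟩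
  have hR0 := hR.1
  have hSR : S < 1 / R :=
    (lt_add_one S).trans_le ((le_one_div (by linarith) hR0).2 hR.2)
  refine ⟨fun x₀ hx₀ => ?_, fun T x hx hx₀ => hV.tendsto_of_isMaximalSolutionOn hC hSR hx hx₀,
    fun p hp hp1 => hV.exists_geodesic hC hD hR0 hSR hp hp1, ?_, ?_⟩
  · obtain ⟨x, h1, h2, -⟩ := hV.exists_maximalSolution hC hSR hx₀
    exact ⟨⊤, x, h1, h2⟩
  · refine (hV.infinite_times hC hD hR0 hSR le_rfl hone).mono ?_
    rintro t ⟨γ, b', l, hl, L, h1, h2, h3, h4, h5, h6⟩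
    exact ⟨γ, b', l, hl, h1, h2, h4.2 rfl ▸ h3, h5, h6⟩
  -- A value of Π strictly below 1 but still in the disc forces a nonzero angular momentum.
  · obtain ⟨p, hp, hp1⟩ : ∃ p < 1, sqDist (1, p) < e ^ 2 := by
      refine ⟨1 - e / 2, by linarith, ?_⟩
      simp only [sqDist]
      nlinarith [pow_pos he 2]
    refine (hV.infinite_times hC hD hR0 hSR hp.le hp1).mono ?_
    rintro t ⟨γ, b', l, hl, L, h1, h2, h3, h4, h5, h6⟩
    exact ⟨γ, b', l, hl, h1, h2, ⟨L, fun h => hp.ne (h4.1 h), h3⟩, h5, h6⟩
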